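/- Let $\mathbf{k}=\mathbb{F}_q$ be a finite field of characteristic $\neq 2$, let $\mathbf{v}=\sqrt q$, and let $\mathcal{A}$ be a hereditary $\mathbf{k}$-linear abelian category, essentially small, with finite-dimensional spaces $\operatorname{Hom}(X,Y)$ and $\operatorname{Ext}^1(X,Y)$ for all objects $X,Y$. Let $\varrho:\mathcal{A}\to\mathcal{A}$ be a $\mathbf{k}$-linear involution, $\varrho^2=\mathrm{Id}$. Write $\widehat X$ for the class of $X$ in $K_0(\mathcal{A})$ and $\langle X,Y\rangle=\dim\operatorname{Hom}(X,Y)-\dim\operatorname{Ext}^1(X,Y)$ for the Euler form. A $\varrho$-complex is a pair $M^\bullet=(M,d)$ with $d:M\to\varrho(M)$ and $\varrho(d)d=0$; a morphism $(M,d)\to(N,e)$ is a morphism $f:M\to N$ with $\varrho(f)d=ef$. These form an abelian category $\mathcal{C}_\varrho(\mathcal{A})$. Put $\operatorname{res}(M^\bullet)=M$ and $H(M^\bullet)=\operatorname{Ker}(d)/\operatorname{Im}(\varrho^{-1}(d))$; $M^\bullet$ is acyclic if $H(M^\bullet)=0$. An object $M$ of $\mathcal{A}$ is regarded as the complex $(M,0)$,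 and $K_X=(X\oplus\varrho(X),d)$, where $d$ maps $X$ identically to the summand $X=\varrho(\varrho(X))$ of $\varrho(X\oplus\varrho(X))$ and is zero on $\varrho(X)$. The Hall algebra $\mathcal{H}(\mathcal{C}_\varrho(\mathcal{A}))$ is the $\mathbb{Q}(\mathbf{v})$-vector space with basis the isomorphism classes $[M^\bullet]$ and product $$[M^\bullet]\diamond[N^\bullet]=\sum_{[L^\bullet]}\frac{|\operatorname{Ext}^1(M^\bullet,N^\bullet)_{L^\bullet}|}{|\operatorname{Hom}(M^\bullet,N^\bullet)|}[L^\bullet],$$ where $\operatorname{Ext}^1(M^\bullet,N^\bullet)_{L^\bullet}$ is the set of classes of extensions of $M^\bullet$ by $N^\bullet$ with middle term isomorphic to $L^\bullet$. Let $\mathcal{I}$ be the two-sided ideal generated by all $[M^\bullet]-[N^\bullet]$ with $H(M^\bullet)\cong H(N^\bullet)$ and $\widehat{\operatorname{Im} d_{M^\bullet}}=\widehat{\operatorname{Im} d_{N^\bullet}}$, and localize $\mathcal{H}(\mathcal{C}_\varrho(\mathcal{A}))/\mathcal{I}$ at all $a[K^\bullet]$ with $a\in\mathbb{Q}(\mathbf{v})^\times$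 and $K^\bullet$ acyclic. The $\imath$Hall algebra ${}^\imath\widetilde{\mathcal{H}}(\mathcal{A},\varrho)$ is this localization with the twisted product $[M^\bullet]*[N^\bullet]=\mathbf{v}^{\langle\operatorname{res}(M^\bullet),\operatorname{res}(N^\bullet)\rangle}[M^\bullet]\diamond[N^\bullet]$. For $\alpha\in K_0(\mathcal{A})$ write $\alpha=\widehat X-\widehat Y$ and put $[K_\alpha]=[K_X]*[K_Y]^{-1}$. Then $[K_\alpha]$ does not depend on the choice of $X,Y$, and: 1. The subalgebra of ${}^\imath\widetilde{\mathcal{H}}(\mathcal{A},\varrho)$ generated by the $[K_\alpha]$, $\alpha\in K_0(\mathcal{A})$ (the quantum torus), is isomorphic to the group algebra of the abelian group $K_0(\mathcal{A})$ over $\mathbb{Q}(\mathbf{v})$, through an isomorphism that takes the group element $\alpha$ to $[K_\alpha]$. 2. The elements $[M]*[K_\alpha]$, with $[M]$ ranging over the isomorphism classes of objects of $\mathcal{A}$ and $\alpha$ over $K_0(\mathcal{A})$, form a basis of ${}^\imath\widetilde{\mathcal{H}}(\mathcal{A},\varrho)$ over $\mathbb{Q}(\mathbf{v})$. -/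

import Mathlib

open CategoryTheory CategoryTheory.Limits CategoryTheory.Abelian
open scoped ZeroObject

universe w v u u'

noncomputable section

namespace IHall

/-! ### The ground field `ℚ(√q)` -/

/-- The field `ℚ(𝐯)`, `𝐯 = √q`, where `q` is the number of elements of the finite field `k`,
realised as a subfield of `ℝ`. -/
abbrev QV (k : Type u') : Type :=
  IntermediateField.adjoin ℚ ({Real.sqrt (Nat.card k : ℝ)} : Set ℝ)

/-- The element `𝐯 = √q` of `ℚ(𝐯)`. -/
def vv (k : Type u') : QV k :=
  ⟨Real.sqrt (Nat.card k : ℝ), IntermediateField.mem_adjoin_simple_self ℚ _⟩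

/-! ### Grothendieck group and Euler form of an abelian category -/

section Abelian

variable (A : Type u) [Category.{v} A] [Abelian A]

/-- The relations of the Grothendieck group. -/
def k0Relations : AddSubgroup (FreeAbelianGroup A) :=
  AddSubgroup.closure
    {x | ∃ S : ShortComplex A, S.ShortExact ∧
      x = FreeAbelianGroup.of S.X₂ - FreeAbelianGroup.of S.X₁ - FreeAbelianGroup.of S.X₃}

/-- The Grothendieck group `K₀(A)`. -/
abbrev K0 : Type u := FreeAbelianGroup A ⧸ k0Relations A

variable {A}

/-- The class of an object in the Grothendieck group. -/
def K0.cls (X : A) : K0 A := QuotientAddGroup.mk (FreeAbelianGroup.of X)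

theorem K0.cls_of_shortExact {S : ShortComplex A} (hS : S.ShortExact) :
    K0.cls S.X₂ = K0.cls S.X₁ + K0.cls S.X₃ := by
  have h : (QuotientAddGroup.mk (FreeAbelianGroup.of S.X₂ - FreeAbelianGroup.of S.X₁
      - FreeAbelianGroup.of S.X₃) : K0 A) = 0 :=
    (QuotientAddGroup.eq_zero_iff _).2 (AddSubgroup.subset_closure ⟨S, hS, rfl⟩)
  have h' : K0.cls S.X₂ - K0.cls S.X₁ - K0.cls S.X₃ = 0 := h
  rw [sub_sub, sub_eq_zero] at h'
  exact h'

theorem K0.cls_biprod (X Y : A) : K0.cls (X ⊞ Y) = K0.cls X + K0.cls Y :=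
  K0.cls_of_shortExact (ShortComplex.Splitting.ofHasBinaryBiproduct X Y).shortExact

/-- Every element of `K₀(A)` is a difference of classes of objects. -/
theorem K0.exists_eq_sub (α : K0 A) : ∃ X Y : A, α = K0.cls X - K0.cls Y := by
  obtain ⟨a, rfl⟩ := QuotientAddGroup.mk_surjective α
  induction a using FreeAbelianGroup.induction_on with
  | zero => exact ⟨0, 0, by simp⟩
  | of X =>
    refine ⟨X ⊞ 0, 0, ?_⟩
    rw [K0.cls_biprod, add_sub_cancel_right]
    rfl
  | neg X h =>
    refine ⟨0, X ⊞ 0, ?_⟩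
    rw [K0.cls_biprod, sub_add_cancel_right]
    rfl
  | add x y hx hy =>
    obtain ⟨X, Y, h⟩ := hx
    obtain ⟨X', Y', h'⟩ := hy
    refine ⟨X ⊞ X', Y ⊞ Y', ?_⟩
    rw [K0.cls_biprod, K0.cls_biprod, QuotientAddGroup.mk_add, h, h']
    abel

/-- The Euler form `⟨X, Y⟩ = dim Hom(X, Y) - dim Ext¹(X, Y)` on objects of `A`. -/
def euler (k : Type u') [Field k] [Linear k A] [HasExt.{w} A] (X Y : A) : ℤ :=
  (Module.finrank k (X ⟶ Y) : ℤ) - (Module.finrank k (Ext X Y 1) : ℤ)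

/-- The set `Iso(C)` of isomorphism classes of objects of a category. -/
abbrev IsoCl (C : Type*) [Category C] : Type _ := Quotient (isIsomorphicSetoid C)

end Abelian

/-! ### Involutions and `ϱ`-complexes -/

section Complexes

variable (k : Type u') [Field k] (A : Type u) [Category.{v} A] [Abelian A] [Linear k A]

/-- An involution of a `k`-linear abelian category: a `k`-linear endofunctor `ϱ` with an
identification `ϱ² ≅ Id` which is compatible with `ϱ`. A strict involution `ϱ² = Id` is the case
in which this identification is the identity, see `Involution.ofEq`. -/
structure Involution where
  functor : A ⥤ A
  additive : functor.Additive
  linear : functor.Linear k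
  sq : functor ⋙ functor ≅ 𝟭 A
  map_sq : ∀ X : A, functor.map (sq.hom.app X) = sq.hom.app (functor.obj X)

attribute [instance] Involution.additive Involution.linear

variable {k A}

/-- A strict involution, `ϱ² = Id`. -/
def Involution.ofEq (F : A ⥤ A) (hadd : F.Additive) (hlin : F.Linear k) (h : F ⋙ F = 𝟭 A) :
    Involution k A where
  functor := F
  additive := hadd
  linear := hlin
  sq := eqToIso h
  map_sq X := by simp [eqToHom_map]

/-- A `ϱ`-complex: an object `X` with `d : X ⟶ ϱ X` such that `ϱ(d) ∘ d = 0`. -/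
structure Cpx (ρ : Involution k A) where
  X : A
  d : X ⟶ ρ.functor.obj X
  d_comp_d : d ≫ ρ.functor.map d = 0

namespace Cpx

variable {ρ : Involution k A}

/-- Morphisms of `ϱ`-complexes. -/
@[ext]
structure Hom (M N : Cpx ρ) where
  f : M.X ⟶ N.X
  comm : M.d ≫ ρ.functor.map f = f ≫ N.d

/-- The category of `ϱ`-complexes. -/
instance : Category (Cpx ρ) where
  Hom M N := Hom M N
  id M := ⟨𝟙 M.X, by simp⟩
  comp f g := ⟨f.f ≫ g.f, by
    rw [Functor.map_comp, ← Category.assoc, f.comm, Category.assoc, g.comm, Category.assoc]⟩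

/-- The stalk complex `(X, 0)`. -/
def stalk (ρ : Involution k A) (X : A) : Cpx ρ := ⟨X, 0, by simp⟩

/-- The complex `K_X = (X ⊕ ϱ X, d)`, where `d` maps `X` identically to `ϱ (ϱ X) = X` and
vanishes on `ϱ X`. -/
def kk (ρ : Involution k A) (X : A) : Cpx ρ where
  X := X ⊞ ρ.functor.obj X
  d := biprod.fst ≫ ρ.sq.inv.app X ≫ ρ.functor.map biprod.inr
  d_comp_d := by
    simp only [Functor.map_comp, Category.assoc]
    rw [← ρ.functor.map_comp_assoc biprod.inr biprod.fst]
    simp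

/-- The short complex `ϱ M ⟶ M ⟶ ϱ M`; its first map is `ϱ⁻¹(d) = ϱ(d)`. -/
def sc (M : Cpx ρ) : ShortComplex A :=
  ShortComplex.mk (ρ.functor.map M.d ≫ ρ.sq.hom.app M.X) M.d (by
    have h := ρ.sq.hom.naturality M.d
    simp only [Functor.comp_map, Functor.id_map] at h
    rw [Category.assoc, ← h, ← Category.assoc, ← Functor.map_comp, M.d_comp_d]
    simp)

/-- The homology `H(M) = Ker(d) / Im(ϱ⁻¹(d))`. -/
def homology (M : Cpx ρ) : A := M.sc.homology

/-- Acyclic `ϱ`-complexes. -/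
def IsAcyclic (M : Cpx ρ) : Prop := IsZero M.homology

/-- The class of `Im(d)` in `K₀(A)`. -/
def imCls (M : Cpx ρ) : K0 A := K0.cls (Limits.image M.d)

/-- Short exact sequences `0 ⟶ N ⟶ L ⟶ M ⟶ 0` of `ϱ`-complexes with given terms. -/
structure SES (M N L : Cpx ρ) where
  i : N ⟶ L
  p : L ⟶ M
  zero : i.f ≫ p.f = 0
  shortExact : (ShortComplex.mk i.f p.f zero).ShortExact

/-- Equivalence of extensions of `M` by `N` with middle term `L`. -/
instance sesSetoid (M N L : Cpx ρ) : Setoid (SES M N L) where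
  r s t := ∃ φ : L ≅ L, s.i ≫ φ.hom = t.i ∧ φ.hom ≫ t.p = s.p
  iseqv :=
    { refl := fun s => ⟨Iso.refl L, by simp⟩
      symm := by
        rintro s t ⟨φ, h₁, h₂⟩
        exact ⟨φ.symm, by simp [← h₁], by simp [← h₂]⟩
      trans := by
        rintro s t r ⟨φ, h₁, h₂⟩ ⟨ψ, h₃, h₄⟩
        exact ⟨φ ≪≫ ψ, by simp [← h₁, ← h₃], by simp [← h₂, ← h₄]⟩ }

/-- The set `Ext¹(M, N)_L` of equivalence classes of extensions of `M` by `N` whose middle term is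
isomorphic to `L`. -/
def ExtMid (M N L : Cpx ρ) : Type _ := Quotient (sesSetoid M N L)

end Cpx

end Complexes

/-! ### Localization

`R` is a vector space with a bilinear product `μ` and a unit `e`. -/

section Localization

variable {F : Type*} [CommRing F] {R : Type*} [AddCommGroup R] [Module F R]

/-- The two-sided ideal generated by a set. -/
def idealSpan (μ : R →ₗ[F] R →ₗ[F] R) (G : Set R) : Submodule F R :=
  sInf {J | G ⊆ J ∧ ∀ x, ∀ y ∈ J, μ x y ∈ J ∧ μ y x ∈ J}

theorem idealSpan_mul_mem (μ : R →ₗ[F] R →ₗ[F] R) (G : Set R) (x : R) {y : R}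
    (hy : y ∈ idealSpan μ G) : μ x y ∈ idealSpan μ G ∧ μ y x ∈ idealSpan μ G := by
  constructor
  · refine Submodule.mem_sInf.2 fun J hJ => (hJ.2 x y ?_).1
    exact Submodule.mem_sInf.1 hy J hJ
  · refine Submodule.mem_sInf.2 fun J hJ => (hJ.2 x y ?_).2
    exact Submodule.mem_sInf.1 hy J hJ

/-- The product on the quotient by the two-sided ideal generated by a set. -/
def quotMul (μ : R →ₗ[F] R →ₗ[F] R) (G : Set R) :
    (R ⧸ idealSpan μ G) →ₗ[F] (R ⧸ idealSpan μ G) →ₗ[F] (R ⧸ idealSpan μ G) :=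
  (idealSpan μ G).liftQ
    { toFun := fun x => (idealSpan μ G).mapQ (idealSpan μ G) (μ x)
        fun _ hy => (idealSpan_mul_mem μ G x hy).1
      map_add' := fun x y => by ext z; simp
      map_smul' := fun c x => by ext z; simp }
    (fun x hx => by
      rw [LinearMap.mem_ker]
      ext z
      simpa using (Submodule.Quotient.mk_eq_zero _).2 (idealSpan_mul_mem μ G z hx).2)

theorem quotMul_mk (μ : R →ₗ[F] R →ₗ[F] R) (G : Set R) (x y : R) :
    quotMul μ G (Submodule.Quotient.mk x) (Submodule.Quotient.mk y)
      = Submodule.Quotient.mk (μ x y) := rfl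

/-- The relations of the localization `R[S⁻¹]`, on the generators `x ∈ R` and `s⁻¹`, `s ∈ S`. -/
inductive LocRel (μ : R →ₗ[F] R →ₗ[F] R) (e : R) (S : Set R) :
    FreeAlgebra F (R ⊕ S) → FreeAlgebra F (R ⊕ S) → Prop
  | add (x y : R) : LocRel μ e S (FreeAlgebra.ι F (Sum.inl (x + y)))
      (FreeAlgebra.ι F (Sum.inl x) + FreeAlgebra.ι F (Sum.inl y))
  | smul (c : F) (x : R) : LocRel μ e S (FreeAlgebra.ι F (Sum.inl (c • x)))
      (c • FreeAlgebra.ι F (Sum.inl x))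
  | mul (x y : R) : LocRel μ e S (FreeAlgebra.ι F (Sum.inl (μ x y)))
      (FreeAlgebra.ι F (Sum.inl x) * FreeAlgebra.ι F (Sum.inl y))
  | one : LocRel μ e S (FreeAlgebra.ι F (Sum.inl e)) 1
  | mul_inv (s : S) : LocRel μ e S
      (FreeAlgebra.ι F (Sum.inl s.1) * FreeAlgebra.ι F (Sum.inr s)) 1
  | inv_mul (s : S) : LocRel μ e S
      (FreeAlgebra.ι F (Sum.inr s) * FreeAlgebra.ι F (Sum.inl s.1)) 1

/-- The localization `R[S⁻¹]` of the algebra `(R, μ, e)`: the universal `F`-algebra under `R` in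
which the elements of `S` are invertible. -/
abbrev Loc (μ : R →ₗ[F] R →ₗ[F] R) (e : R) (S : Set R) : Type _ := RingQuot (LocRel μ e S)

/-- The canonical map `R → R[S⁻¹]`. -/
def Loc.of (μ : R →ₗ[F] R →ₗ[F] R) (e : R) (S : Set R) (x : R) : Loc μ e S :=
  RingQuot.mkAlgHom F (LocRel μ e S) (FreeAlgebra.ι F (Sum.inl x))

end Localization

/-! ### The `ı`Hall algebra -/

section Hall

variable {k : Type u'} [Field k] {A : Type u} [Category.{v} A] [Abelian A] [Linear k A]

/-- The vector space of the Hall algebra of the category of `ϱ`-complexes, with basis the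
isomorphism classes of `ϱ`-complexes. -/
abbrev Hall (ρ : Involution k A) : Type _ := IsoCl (Cpx ρ) →₀ QV k

/-- The basis element `[M]` of the Hall algebra. -/
def Hall.mk {ρ : Involution k A} (M : Cpx ρ) : Hall ρ := Finsupp.single (Quotient.mk _ M) 1

/-- The Hall product
`[M] ⋄ [N] = ∑_[L] |Ext¹(M, N)_L| / |Hom(M, N)| [L]`. The sum has finitely many nonzero terms
when the spaces `Hom` and `Ext¹` of `A` are finite. -/
def hallProd {ρ : Involution k A} (M N : Cpx ρ) : Hall ρ :=
  ∑ᶠ L : IsoCl (Cpx ρ),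
    Finsupp.single L ((Nat.card (Cpx.ExtMid M N L.out) : QV k) / (Nat.card (M ⟶ N) : QV k))

variable [HasExt.{w} A]

/-- The Hall product twisted by the Euler form of `A`, extended bilinearly:
`[M] * [N] = 𝐯 ^ ⟨res M, res N⟩ [M] ⋄ [N]`. -/
def hallMul (ρ : Involution k A) : Hall ρ →ₗ[QV k] Hall ρ →ₗ[QV k] Hall ρ :=
  Finsupp.lsum (QV k) fun M => LinearMap.toSpanSingleton (QV k) _ <|
    Finsupp.lsum (QV k) fun N => LinearMap.toSpanSingleton (QV k) _ <|
      (vv k ^ euler k M.out.X N.out.X) • hallProd M.out N.out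

/-- The generators `[M] - [N]`, where `H(M) ≅ H(N)` and `Im d_M`, `Im d_N` have the same class in
`K₀(A)`, of the ideal that is factored out. -/
def idealGens (ρ : Involution k A) : Set (Hall ρ) :=
  {x | ∃ M N : Cpx ρ, Nonempty (M.homology ≅ N.homology) ∧ M.imCls = N.imCls ∧
    x = Hall.mk M - Hall.mk N}

/-- The quotient of the (twisted) Hall algebra by the two-sided ideal. -/
abbrev HallQuot (ρ : Involution k A) : Type _ := Hall ρ ⧸ idealSpan (hallMul ρ) (idealGens ρ)

/-- The class of `[M]` in the quotient. -/
def HallQuot.mk {ρ : Involution k A} (M : Cpx ρ) : HallQuot ρ :=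
  Submodule.Quotient.mk (Hall.mk M)

/-- The set `{a [K] | a ≠ 0, K acyclic}`. -/
def acyclicSet (ρ : Involution k A) : Set (HallQuot ρ) :=
  {x | ∃ (a : QV k) (K : Cpx ρ), a ≠ 0 ∧ K.IsAcyclic ∧ x = a • HallQuot.mk K}

/-- The `ı`Hall algebra: the localization of the quotient at the classes of the acyclic
complexes. The twist by the Euler form is already built into the product of `Hall ρ`; as the
ideal and the localized set are homogeneous for the `K₀(A)`-grading by the class of `res M`,
twisting before or after the quotient and the localization gives the same algebra. -/
abbrev IHallAlg (ρ : Involution k A) : Type _ :=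
  Loc (quotMul (hallMul ρ) (idealGens ρ)) (HallQuot.mk (Cpx.stalk ρ 0)) (acyclicSet ρ)

/-- The class `[M]` of a `ϱ`-complex in the `ı`Hall algebra. -/
def IHallAlg.mk {ρ : Involution k A} (M : Cpx ρ) : IHallAlg ρ :=
  Loc.of _ _ _ (HallQuot.mk M)

/-- The element `[K_α] = [K_X] * [K_Y]⁻¹` of the `ı`Hall algebra, where `α` is the difference of
the classes of `X` and `Y`. -/
def kElt (ρ : Involution k A) (α : K0 A) : IHallAlg ρ :=
  IHallAlg.mk (Cpx.kk ρ (K0.exists_eq_sub α).choose) *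
    Ring.inverse (IHallAlg.mk (Cpx.kk ρ (K0.exists_eq_sub α).choose_spec.choose))

/-- The quantum torus: the subalgebra generated by the `[K_α]`. -/
def quantumTorus (ρ : Involution k A) : Subalgebra (QV k) (IHallAlg ρ) :=
  Algebra.adjoin (QV k) (Set.range (kElt ρ))

end Hall

end IHall

end

-- The heart of the matter is linear independence: a localization of a quotient by a two-sided ideal
-- could collapse. This is excluded by letting the algebra act on a space where the result can be
-- read off.
--
-- Let `Dat` have as basis the pairs (isomorphism class of an object of A, element of K₀(A)). The
-- map `tau` sends a complex M to the pair (H(M), class of Im d). The decisive fact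
-- (`tau_hallProd_right`, `tau_hallProd_left`) is that `tau` of a Hall product depends on each
-- factor, up to an explicit power of `vv` and a translation, only through this pair. Two
-- ingredients give it. (a) If K is acyclic, then Ext²(N, K) = Ext²(K, N) = 0 in the category of
-- ϱ-complexes. Moreover |Hom|/|Ext¹| is an Euler form of A: for (N, K) it is that of res N and Ker
-- d_K, for (K, N) that of the cokernel of ϱ K ⟶ K and res N. Every N is an extension of one stalk
-- complex by another, which reduces this to stalk complexes; there Ext¹(S, K) = Ext¹(S, Ker d_K) in
-- A. Hence if K is the kernel of L ⟶ M, the map Ext¹(N, L) ⟶ Ext¹(N, M) is onto with fibres of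
-- known size, and corresponding middle terms differ by K (`tau_hallProd_sub`, `tau_hallProd_quot`).
-- (b) Since A is hereditary, M and the stalk complex of H(M) are both quotients of one complex by
-- acyclic subcomplexes, and dually both subcomplexes of one complex with acyclic cokernels
-- (`exists_roof_sub`, `exists_roof_quot`).
--
-- It follows that the Hall algebra, which is associative by Ringel's count of filtrations, acts on
-- `Dat` (`act`). The action kills the ideal, and an acyclic complex acts by a weighted permutation
-- of the basis, because all of K₀(A) is allowed in the second coordinate. So the action extends to
-- the localization (`exists_representation`). On the basis vector (0, 0) the element [M] * [K_α]
-- gives a nonzero multiple of (M, α), which proves independence.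
--
-- For spanning, (a) and (b) show that in the `ı`Hall algebra [N] is a multiple of [H(N)] * [K_α],
-- where α is the class of Im d_N. Acyclic classes commute with all [N] up to scalars. Among
-- themselves they multiply without any scalar, because ϱ is self-adjoint for the Euler form
-- (`eulerK_rho_left`). So [K_α] is well defined and multiplicative in α, and the statement on the
-- quantum torus follows from independence.

universe w'

noncomputable section

namespace IHall

/-! ### The abelian category of ϱ-complexes -/

section ComplexesAbelian

variable {k : Type u'} [Field k] {A : Type u} [Category.{v} A] [Abelian A] [Linear k A]

/-- An involution is an equivalence of categories. -/
instance Involution.isEquivalence (ρ : Involution k A) : ρ.functor.IsEquivalence :=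
  (CategoryTheory.Equivalence.mk ρ.functor ρ.functor ρ.sq.symm ρ.sq).isEquivalence_functor

namespace Cpx

variable {ρ : Involution k A}

@[ext]
theorem hom_ext {M N : Cpx ρ} {f g : M ⟶ N} (h : f.f = g.f) : f = g := Hom.ext h

@[simp] theorem id_f (M : Cpx ρ) : Hom.f (𝟙 M) = 𝟙 M.X := rfl

@[simp] theorem comp_f {M N L : Cpx ρ} (f : M ⟶ N) (g : N ⟶ L) :
    Hom.f (f ≫ g) = f.f ≫ g.f := rfl

/-- The morphism of complexes given by a compatible morphism of objects. -/
def mkHom {M N : Cpx ρ} (f : M.X ⟶ N.X) (h : M.d ≫ ρ.functor.map f = f ≫ N.d) : M ⟶ N := ⟨f, h⟩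

@[simp] theorem mkHom_f {M N : Cpx ρ} (f : M.X ⟶ N.X)
    (h : M.d ≫ ρ.functor.map f = f ≫ N.d) : Hom.f (mkHom f h) = f := rfl

theorem Hom.comm' {M N : Cpx ρ} (f : M ⟶ N) : M.d ≫ ρ.functor.map f.f = f.f ≫ N.d := f.comm

instance (M N : Cpx ρ) : Zero (M ⟶ N) := ⟨mkHom 0 (by simp)⟩
instance (M N : Cpx ρ) : Add (M ⟶ N) :=
  ⟨fun f g => mkHom (f.f + g.f) (by simp [Functor.map_add, f.comm', g.comm'])⟩
instance (M N : Cpx ρ) : Neg (M ⟶ N) :=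
  ⟨fun f => mkHom (-f.f) (by simp [Functor.map_neg, f.comm'])⟩
instance (M N : Cpx ρ) : Sub (M ⟶ N) :=
  ⟨fun f g => mkHom (f.f - g.f) (by simp [Functor.map_sub, f.comm', g.comm'])⟩
instance (M N : Cpx ρ) : SMul ℕ (M ⟶ N) :=
  ⟨fun n f => mkHom (n • f.f) (by simp [f.comm'])⟩
instance (M N : Cpx ρ) : SMul ℤ (M ⟶ N) :=
  ⟨fun n f => mkHom (n • f.f) (by simp [f.comm'])⟩

instance (M N : Cpx ρ) : AddCommGroup (M ⟶ N) :=
  Function.Injective.addCommGroup (fun f : M ⟶ N => f.f) (fun _ _ h => hom_ext h) rfl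
    (fun _ _ => rfl) (fun _ => rfl) (fun _ _ => rfl) (fun _ _ => rfl) (fun _ _ => rfl)

@[simp] theorem zero_f (M N : Cpx ρ) : Hom.f (0 : M ⟶ N) = 0 := rfl
@[simp] theorem add_f {M N : Cpx ρ} (f g : M ⟶ N) : Hom.f (f + g) = f.f + g.f := rfl

instance : Preadditive (Cpx ρ) where

variable (ρ) in
/-- The functor forgetting the differential. -/
@[simps] def res : Cpx ρ ⥤ A where
  obj M := M.X
  map f := f.f

instance : (res ρ).Additive where
instance : (res ρ).Faithful where
  map_injective h := hom_ext h

/-- Isomorphisms of complexes from isomorphisms of objects. -/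
def isoMk {M N : Cpx ρ} (e : M.X ≅ N.X) (h : M.d ≫ ρ.functor.map e.hom = e.hom ≫ N.d) :
    M ≅ N where
  hom := mkHom e.hom h
  inv := mkHom e.inv (by
    rw [← cancel_epi e.hom, e.hom_inv_id_assoc, ← Category.assoc, ← h, Category.assoc,
      ← Functor.map_comp, e.hom_inv_id, CategoryTheory.Functor.map_id, Category.comp_id])
  hom_inv_id := by ext; simp
  inv_hom_id := by ext; simp

instance : (res ρ).ReflectsIsomorphisms where
  reflects {M N} f hf :=
    (isoMk (M := M) (N := N) (@asIso _ _ _ _ f.f hf) f.comm').isIso_hom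

theorem exact_map_kernel {M N : Cpx ρ} (f : M ⟶ N) :
    (ShortComplex.mk (ρ.functor.map (kernel.ι f.f)) (ρ.functor.map f.f)
      (by rw [← Functor.map_comp, kernel.condition, Functor.map_zero])).Exact :=
  (ShortComplex.exact_kernel f.f).map ρ.functor

/-- The differential on the kernel of a morphism. -/
def kerD {M N : Cpx ρ} (f : M ⟶ N) : kernel f.f ⟶ ρ.functor.obj (kernel f.f) :=
  (exact_map_kernel f).lift (kernel.ι f.f ≫ M.d)
    (by simp only [Category.assoc, f.comm', kernel.condition_assoc, zero_comp])

theorem kerD_comp {M N : Cpx ρ} (f : M ⟶ N) :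
    kerD f ≫ ρ.functor.map (kernel.ι f.f) = kernel.ι f.f ≫ M.d :=
  (exact_map_kernel f).lift_f _ _

/-- The complex on the kernel of a morphism. -/
abbrev ker {M N : Cpx ρ} (f : M ⟶ N) : Cpx ρ where
  X := kernel f.f
  d := kerD f
  d_comp_d := by
    rw [← cancel_mono (ρ.functor.map (ρ.functor.map (kernel.ι f.f))), Category.assoc,
      ← Functor.map_comp, kerD_comp, Functor.map_comp, ← Category.assoc, kerD_comp,
      Category.assoc, M.d_comp_d, comp_zero, zero_comp]

/-- The inclusion of the kernel. -/
def kerι {M N : Cpx ρ} (f : M ⟶ N) : ker f ⟶ M := mkHom (kernel.ι f.f) (kerD_comp f)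

theorem kerι_comp {M N : Cpx ρ} (f : M ⟶ N) : kerι f ≫ f = 0 := by
  ext; exact kernel.condition f.f

/-- The kernel of a morphism of complexes is computed in `A`. -/
def kerIsLimit {M N : Cpx ρ} (f : M ⟶ N) : IsLimit (KernelFork.ofι (kerι f) (kerι_comp f)) :=
  KernelFork.IsLimit.ofι _ _
    (fun {W} g hg => mkHom (kernel.lift f.f g.f (by rw [← comp_f, hg, zero_f])) (by
      rw [← cancel_mono (ρ.functor.map (kernel.ι f.f)), Category.assoc, Category.assoc, kerD_comp,
        ← Functor.map_comp, kernel.lift_ι, kernel.lift_ι_assoc, g.comm']))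
    (fun {W} g hg => by ext; exact kernel.lift_ι _ _ _)
    (fun {W} g hg m hm => by
      refine hom_ext ?_
      rw [← cancel_mono (kernel.ι f.f)]
      exact (congrArg Hom.f hm).trans (kernel.lift_ι _ _ _).symm)

/-- The differential on the cokernel of a morphism. -/
def cokerD {M N : Cpx ρ} (f : M ⟶ N) : cokernel f.f ⟶ ρ.functor.obj (cokernel f.f) :=
  cokernel.desc f.f (N.d ≫ ρ.functor.map (cokernel.π f.f))
    (by rw [← Category.assoc, ← f.comm', Category.assoc, ← Functor.map_comp,
          cokernel.condition, Functor.map_zero, comp_zero])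

theorem comp_cokerD {M N : Cpx ρ} (f : M ⟶ N) :
    cokernel.π f.f ≫ cokerD f = N.d ≫ ρ.functor.map (cokernel.π f.f) :=
  cokernel.π_desc _ _ _

/-- The complex on the cokernel of a morphism. -/
abbrev coker {M N : Cpx ρ} (f : M ⟶ N) : Cpx ρ where
  X := cokernel f.f
  d := cokerD f
  d_comp_d := by
    rw [← cancel_epi (cokernel.π f.f), ← Category.assoc, comp_cokerD, Category.assoc,
      ← Functor.map_comp, comp_cokerD, Functor.map_comp, ← Category.assoc, N.d_comp_d, zero_comp,
      comp_zero]

/-- The projection to the cokernel. -/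
def cokerπ {M N : Cpx ρ} (f : M ⟶ N) : N ⟶ coker f := mkHom (cokernel.π f.f) (comp_cokerD f).symm

theorem comp_cokerπ {M N : Cpx ρ} (f : M ⟶ N) : f ≫ cokerπ f = 0 := by
  ext; exact cokernel.condition f.f

/-- The cokernel of a morphism of complexes is computed in `A`. -/
def cokerIsColimit {M N : Cpx ρ} (f : M ⟶ N) :
    IsColimit (CokernelCofork.ofπ (cokerπ f) (comp_cokerπ f)) :=
  CokernelCofork.IsColimit.ofπ _ _
    (fun {W} g hg => mkHom (cokernel.desc f.f g.f (by rw [← comp_f, hg, zero_f])) (by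
      rw [← cancel_epi (cokernel.π f.f), ← Category.assoc, comp_cokerD, Category.assoc,
        ← Functor.map_comp, cokernel.π_desc, cokernel.π_desc_assoc, g.comm']))
    (fun {W} g hg => by ext; exact cokernel.π_desc _ _ _)
    (fun {W} g hg m hm => by
      refine hom_ext ?_
      rw [← cancel_epi (cokernel.π f.f)]
      exact (congrArg Hom.f hm).trans (cokernel.π_desc _ _ _).symm)

/-- The direct sum of two complexes. -/
abbrev sum (M N : Cpx ρ) : Cpx ρ where
  X := M.X ⊞ N.X
  d := biprod.desc (M.d ≫ ρ.functor.map biprod.inl) (N.d ≫ ρ.functor.map biprod.inr)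
  d_comp_d := by
    ext1
    · simp only [biprod.inl_desc_assoc, Category.assoc, ← Functor.map_comp, biprod.inl_desc,
        comp_zero]
      rw [Functor.map_comp, reassoc_of% M.d_comp_d, zero_comp]
    · simp only [biprod.inr_desc_assoc, Category.assoc, ← Functor.map_comp, biprod.inr_desc,
        comp_zero]
      rw [Functor.map_comp, reassoc_of% N.d_comp_d, zero_comp]

/-- The bicone on the direct sum. -/
def sumBicone (M N : Cpx ρ) : BinaryBicone M N where
  pt := sum M N
  fst := mkHom biprod.fst (by
    apply biprod.hom_ext' <;> simp [← Functor.map_comp])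
  snd := mkHom biprod.snd (by
    apply biprod.hom_ext' <;> simp [← Functor.map_comp])
  inl := mkHom biprod.inl (by simp)
  inr := mkHom biprod.inr (by simp)
  inl_fst := by ext; simp
  inl_snd := by ext; simp
  inr_fst := by ext; simp
  inr_snd := by ext; simp

instance : HasBinaryBiproducts (Cpx ρ) :=
  HasBinaryBiproducts.mk fun {M N} => HasBinaryBiproduct.mk
    ⟨sumBicone M N, isBinaryBilimitOfTotal _ (by ext1; exact biprod.total)⟩

theorem isZero_of_isZero_X {M : Cpx ρ} (h : IsZero M.X) : IsZero M := by
  rw [IsZero.iff_id_eq_zero]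
  ext
  exact h.eq_of_src _ _

instance : HasZeroObject (Cpx ρ) :=
  ⟨stalk ρ 0, isZero_of_isZero_X (isZero_zero A)⟩

instance : HasKernels (Cpx ρ) where
  has_limit f := ⟨⟨_, kerIsLimit f⟩⟩

instance : HasCokernels (Cpx ρ) where
  has_colimit f := ⟨⟨_, cokerIsColimit f⟩⟩

instance {M N : Cpx ρ} (f : M ⟶ N) : PreservesLimit (parallelPair f 0) (res ρ) :=
  preservesLimit_of_preserves_limit_cone (kerIsLimit f)
    ((KernelFork.isLimitMapConeEquiv _ _).symm (kernelIsKernel f.f))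

instance {M N : Cpx ρ} (f : M ⟶ N) : PreservesColimit (parallelPair f 0) (res ρ) :=
  preservesColimit_of_preserves_colimit_cocone (cokerIsColimit f)
    ((CokernelCofork.isColimitMapCoconeEquiv _ _).symm (cokernelIsCokernel f.f))

instance : HasFiniteProducts (Cpx ρ) := 
  hasFiniteProducts_of_has_binary_and_terminal

/-- The category of `ϱ`-complexes is abelian. -/
instance : Abelian (Cpx ρ) := by
  have : ∀ {M N : Cpx ρ} (f : M ⟶ N), IsIso (Abelian.coimageImageComparison f) := by
    intro M N f
    have : IsIso ((res ρ).map (Abelian.coimageImageComparison f)) := by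
      -- `res` preserves kernels and cokernels, so it turns the comparison map of `f` into that of
      -- `f.f` in A, which is invertible; `res` reflects isomorphisms.
      rw [Arrow.isIso_iff_isIso_of_isIso
        (Abelian.PreservesCoimageImageComparison.iso (res ρ) f).hom]
      infer_instance
    exact isIso_of_reflects_iso _ (res ρ)
  exact Abelian.ofCoimageImageComparisonIsIso

instance : PreservesFiniteLimits (res ρ) :=
  Functor.preservesFiniteLimits_of_preservesKernels _

instance : PreservesFiniteColimits (res ρ) :=
  Functor.preservesFiniteColimits_of_preservesCokernels _

end Cpx

end ComplexesAbelian

end IHall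

namespace IHall

/-! ### Extensions and `Ext` in an abelian category -/

section ExtGeneralities

variable {C : Type u} [Category.{v} C] [Abelian C]

open DerivedCategory in
/-- A morphism `X ⟶ Y[m]`, `m ≠ 0`, in the derived category becomes zero after restriction along
some epimorphism `P ⟶ X`. -/
theorem exists_epi_singleFunctor_comp_eq_zero [HasDerivedCategory.{w} C] {X Y : C} {m : ℤ}
    (hm : m ≠ 0)
    (f : Q.obj ((HomologicalComplex.single C (ComplexShape.up ℤ) 0).obj X) ⟶
      Q.obj (((HomologicalComplex.single C (ComplexShape.up ℤ) 0).obj Y : CochainComplex C ℤ)⟦m⟧)) :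
    ∃ (P : C) (p : P ⟶ X), Epi p ∧
      Q.map ((HomologicalComplex.single C (ComplexShape.up ℤ) 0).map p) ≫ f = 0 := by
  -- Write `f` as a fraction over a quasi-isomorphism `s` whose source Z vanishes in positive
  -- degrees. Then Z⁰ consists of cycles, so it maps to Z as a complex concentrated in degree 0,
  -- while Y[m] is zero in that degree.
  obtain ⟨Z, hZ, s, hs, g, rfl⟩ := right_fac_of_isStrictlyLE f 0
  let p : Z.X 0 ⟶ X := s.f 0 ≫ (HomologicalComplex.singleObjXSelf (ComplexShape.up ℤ) 0 X).hom
  let j : (HomologicalComplex.single C (ComplexShape.up ℤ) 0).obj (Z.X 0) ⟶ Z :=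
    HomologicalComplex.mkHomFromSingle (𝟙 _)
      (fun i hi => (Z.isZero_of_isStrictlyLE 0 i (by simp at hi; lia)).eq_of_tgt _ _)
  have hjs : j ≫ s = (HomologicalComplex.single C (ComplexShape.up ℤ) 0).map p := by
    apply HomologicalComplex.from_single_hom_ext
    rw [HomologicalComplex.single_map_f_self]
    simp [j, p]
  have hjg : j ≫ g = 0 := by
    apply HomologicalComplex.from_single_hom_ext
    refine IsZero.eq_of_tgt ?_ _ _
    exact HomologicalComplex.isZero_single_obj_X (ComplexShape.up ℤ) 0 Y _ (by simpa using hm)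
  refine ⟨Z.X 0, p, ?_, ?_⟩
  -- If `p ≫ q = 0` then `s` followed by `q` vanishes as a map of complexes; `s` is invertible in
  -- the derived category and objects embed there faithfully, so `q = 0`.
  · rw [Preadditive.epi_iff_cancel_zero]
    intro W q hq
    have h0 : s ≫ (HomologicalComplex.single C (ComplexShape.up ℤ) 0).map q = 0 := by
      apply HomologicalComplex.to_single_hom_ext
      rw [HomologicalComplex.comp_f, HomologicalComplex.single_map_f_self]
      have : s.f 0 ≫ (HomologicalComplex.singleObjXSelf (ComplexShape.up ℤ) 0 X).hom ≫ q = 0 := by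
        simpa [p] using hq
      rw [reassoc_of% this, zero_comp, HomologicalComplex.zero_f]
    have h1 : Q.map ((HomologicalComplex.single C (ComplexShape.up ℤ) 0).map q) = 0 := by
      rw [← cancel_epi (Q.map s), ← Functor.map_comp, h0, Functor.map_zero, comp_zero]
    apply (singleFunctor C 0).map_injective
    rw [Functor.map_zero]
    exact h1
  · rw [← hjs, Functor.map_comp, Category.assoc, IsIso.hom_inv_id_assoc, ← Functor.map_comp, hjg,
      Functor.map_zero]

/-- The pushout of a short exact sequence. -/
theorem exists_pushout_shortExact {S : ShortComplex C} (hS : S.ShortExact) {Y : C}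
    (a : S.X₁ ⟶ Y) :
    ∃ (E : C) (i : Y ⟶ E) (p : E ⟶ S.X₃) (z : i ≫ p = 0) (b : S.X₂ ⟶ E)
      (_ : (ShortComplex.mk i p z).ShortExact), S.f ≫ b = a ≫ i ∧ b ≫ p = S.g := by
  have := hS.mono_f
  have := hS.epi_g
  let p : pushout S.f a ⟶ S.X₃ := pushout.desc S.g 0 (by simp)
  have z : pushout.inr S.f a ≫ p = 0 := pushout.inr_desc _ _ _
  have hep : Epi p := epi_of_epi_fac (pushout.inl_desc S.g (0 : Y ⟶ S.X₃) (by simp))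
  have hcol : IsColimit (CokernelCofork.ofπ p z) := by
    refine CokernelCofork.IsColimit.ofπ _ _
      (fun {W} g hg => hS.exact.desc (pushout.inl S.f a ≫ g)
        (by rw [pushout.condition_assoc, hg, comp_zero])) ?_ ?_
    · intro W g hg
      apply pushout.hom_ext
      · rw [pushout.inl_desc_assoc]
        exact hS.exact.g_desc _ _
      · rw [pushout.inr_desc_assoc, zero_comp, hg]
    · intro W g hg m hm
      rw [← cancel_epi S.g, hS.exact.g_desc, ← hm, pushout.inl_desc_assoc]
  exact ⟨_, _, p, z, pushout.inl S.f a,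
    { exact := ShortComplex.exact_of_g_is_cokernel _ hcol }, pushout.condition,
    pushout.inl_desc _ _ _⟩

variable [HasExt.{w} C]

/-- Positive degree classes are effaced by epimorphisms. -/
theorem exists_epi_comp_eq_zero {X Y : C} {n : ℕ} (hn : n ≠ 0) (x : Ext X Y n) :
    ∃ (P : C) (p : P ⟶ X), Epi p ∧ (Ext.mk₀ p).comp x (zero_add n) = 0 := by
  let := HasDerivedCategory.standard C
  let e : ((DerivedCategory.singleFunctor C 0).obj Y)⟦(n : ℤ)⟧ ≅
      DerivedCategory.Q.obj (((CochainComplex.singleFunctor C 0).obj Y)⟦(n : ℤ)⟧) :=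
    ((DerivedCategory.Q.commShiftIso (n : ℤ)).app
      ((CochainComplex.singleFunctor C 0).obj Y)).symm
  obtain ⟨P, p, hp, h⟩ := exists_epi_singleFunctor_comp_eq_zero (X := X) (Y := Y) (m := n)
    (by exact_mod_cast hn) (x.hom ≫ e.hom)
  refine ⟨P, p, hp, ?_⟩
  ext
  rw [Ext.comp_hom, Ext.mk₀_hom, ShiftedHom.mk₀_comp, Ext.zero_hom, ← cancel_mono e.hom,
    zero_comp, Category.assoc]
  exact h

/-- A class of positive degree is the product of the class of a short exact sequence and a class of
degree one less. -/
theorem exists_extClass_comp_eq {X Y : C} {n m : ℕ} (h : 1 + n = m) (x : Ext X Y m) :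
    ∃ (T P : C) (i : T ⟶ P) (p : P ⟶ X) (z : i ≫ p = 0)
      (hS : (ShortComplex.mk i p z).ShortExact) (y : Ext T Y n), hS.extClass.comp y h = x := by
  obtain ⟨P, p, hp, hx⟩ := exists_epi_comp_eq_zero (by lia) x
  have hS : (ShortComplex.mk (kernel.ι p) p (kernel.condition p)).ShortExact :=
    { exact := ShortComplex.exact_kernel p }
  obtain ⟨y, hy⟩ := Ext.contravariant_sequence_exact₃ hS Y x hx h
  exact ⟨_, _, _, _, _, hS, y, hy⟩

/-- Every class of degree one is the class of a short exact sequence. -/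
theorem exists_extClass_eq {X Y : C} (x : Ext X Y 1) :
    ∃ (E : C) (i : Y ⟶ E) (p : E ⟶ X) (z : i ≫ p = 0)
      (hS : (ShortComplex.mk i p z).ShortExact), hS.extClass = x := by
  obtain ⟨T, P, i, p, z, hS, y, rfl⟩ := exists_extClass_comp_eq (add_zero 1) x
  -- Dimension shifting ended in degree 0, so the second factor is a morphism and the class is a
  -- pushout along it.
  obtain ⟨a, rfl⟩ := (Ext.mk₀_bijective _ _).2 y
  obtain ⟨E, i', p', z', b, hS', h₁, h₂⟩ := exists_pushout_shortExact hS a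
  refine ⟨E, i', p', z', hS', ?_⟩
  let φ : ShortComplex.mk i p z ⟶ ShortComplex.mk i' p' z' :=
    { τ₁ := a, τ₂ := b, τ₃ := 𝟙 X, comm₁₂ := h₁.symm, comm₂₃ := by simpa using h₂ }
  have := ShortComplex.ShortExact.extClass_naturality hS hS' φ
  rw [Ext.mk₀_id_comp] at this
  exact this.symm

/-- Positive degree classes are effaced by monomorphisms. -/
theorem exists_mono_comp_eq_zero {n : ℕ} {X Y : C} (x : Ext X Y (n + 1)) :
    ∃ (I : C) (i : Y ⟶ I), Mono i ∧ x.comp (Ext.mk₀ i) (add_zero _) = 0 := by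
  induction n generalizing X with
  | zero =>
    -- The class of an extension dies in its own middle term, so no injective objects are needed.
    obtain ⟨E, i, p, z, hS, rfl⟩ := exists_extClass_eq x
    exact ⟨E, i, hS.mono_f, hS.extClass_comp⟩
  | succ n ih =>
    obtain ⟨T, P, i, p, z, hS, y, rfl⟩ := exists_extClass_comp_eq (add_comm 1 (n + 1)) x
    obtain ⟨I, j, hj, hy⟩ := ih y
    exact ⟨I, j, hj, by rw [Ext.comp_assoc_of_third_deg_zero, hy, Ext.comp_zero]⟩

theorem mk₀_inj {X Y : C} {f g : X ⟶ Y} : Ext.mk₀ f = Ext.mk₀ g ↔ f = g :=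
  (Ext.mk₀_bijective X Y).1.eq_iff

/-- The pushed-out class is the obstruction to extending `a` along `S.f`. This and its dual
translate vanishing in `Ext` into existence of morphisms. -/
theorem exists_desc_of_extClass_comp {S : ShortComplex C} (hS : S.ShortExact) {Y : C}
    (a : S.X₁ ⟶ Y) (h : hS.extClass.comp (Ext.mk₀ a) (add_zero 1) = 0) :
    ∃ b : S.X₂ ⟶ Y, S.f ≫ b = a := by
  obtain ⟨x, hx⟩ := Ext.contravariant_sequence_exact₁ hS _ (Ext.mk₀ a) (add_zero 1) h
  obtain ⟨b, rfl⟩ := (Ext.mk₀_bijective _ _).2 x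
  exact ⟨b, by rwa [Ext.mk₀_comp_mk₀, mk₀_inj] at hx⟩

theorem exists_lift_of_comp_extClass {S : ShortComplex C} (hS : S.ShortExact) {X : C}
    (c : X ⟶ S.X₃) (h : (Ext.mk₀ c).comp hS.extClass (zero_add 1) = 0) :
    ∃ b : X ⟶ S.X₂, b ≫ S.g = c := by
  obtain ⟨x, hx⟩ := Ext.covariant_sequence_exact₃ _ hS (Ext.mk₀ c) (zero_add 1) h
  obtain ⟨b, rfl⟩ := (Ext.mk₀_bijective _ _).2 x
  exact ⟨b, by rwa [Ext.mk₀_comp_mk₀, mk₀_inj] at hx⟩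

theorem exists_retraction_of_extClass_eq_zero {S : ShortComplex C} (hS : S.ShortExact)
    (h : hS.extClass = 0) : ∃ r : S.X₂ ⟶ S.X₁, S.f ≫ r = 𝟙 S.X₁ :=
  exists_desc_of_extClass_comp hS (𝟙 _) (by rw [h, Ext.zero_comp])

theorem extClass_eq_zero_of_retraction {S : ShortComplex C} (hS : S.ShortExact)
    (r : S.X₂ ⟶ S.X₁) (h : S.f ≫ r = 𝟙 S.X₁) : hS.extClass = 0 := by
  have := hS.extClass_comp_assoc (Ext.mk₀ r) (h := add_zero 1)
  rwa [Ext.mk₀_comp_mk₀, h, Ext.comp_mk₀_id] at this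

theorem extClass_eq_zero_of_section {S : ShortComplex C} (hS : S.ShortExact)
    (r : S.X₃ ⟶ S.X₂) (h : r ≫ S.g = 𝟙 S.X₃) : hS.extClass = 0 := by
  rw [← Ext.mk₀_id_comp hS.extClass, ← h, ← Ext.mk₀_comp_mk₀, Ext.comp_assoc_of_second_deg_zero,
    hS.comp_extClass, Ext.comp_zero]

/-- A morphism between the end terms of two short exact sequences which is compatible with the
classes extends to a morphism of short exact sequences. -/
theorem exists_hom_of_extClass {S₁ S₂ : ShortComplex C} (h₁ : S₁.ShortExact) (h₂ : S₂.ShortExact)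
    (a : S₁.X₁ ⟶ S₂.X₁) (c : S₁.X₃ ⟶ S₂.X₃)
    (h : h₁.extClass.comp (Ext.mk₀ a) (add_zero 1) =
      (Ext.mk₀ c).comp h₂.extClass (zero_add 1)) :
    ∃ φ : S₁.X₂ ⟶ S₂.X₂, S₁.f ≫ φ = a ≫ S₂.f ∧ φ ≫ S₂.g = S₁.g ≫ c := by
  obtain ⟨φ, hx⟩ := exists_desc_of_extClass_comp h₁ (a ≫ S₂.f) (by
    rw [← Ext.mk₀_comp_mk₀, ← Ext.comp_assoc_of_second_deg_zero, h,
      Ext.comp_assoc_of_third_deg_zero, h₂.extClass_comp, Ext.comp_zero])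
  have := h₁.epi_g
  let ψ := h₁.exact.desc (φ ≫ S₂.g) (by rw [reassoc_of% hx, S₂.zero, comp_zero])
  have hψ : S₁.g ≫ ψ = φ ≫ S₂.g := h₁.exact.g_desc _ _
  have hnat := ShortComplex.ShortExact.extClass_naturality h₁ h₂
    { τ₁ := a, τ₂ := φ, τ₃ := ψ, comm₁₂ := hx.symm, comm₂₃ := hψ.symm }
  dsimp only at hnat
  -- The chosen `φ` induces some `ψ` on the quotients, perhaps not `c`. The difference kills the
  -- class of `S₂`, hence lifts to the middle term and can be used to correct `φ`.
  obtain ⟨θ, hy⟩ := exists_lift_of_comp_extClass h₂ (c - ψ) (by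
    rw [sub_eq_add_neg, Ext.mk₀_add, Ext.mk₀_neg, Ext.add_comp, Ext.neg_comp, ← h, ← hnat,
      add_neg_cancel])
  refine ⟨φ + S₁.g ≫ θ, ?_, ?_⟩
  · rw [Preadditive.comp_add, hx, S₁.zero_assoc, zero_comp, add_zero]
  · rw [Preadditive.add_comp, Category.assoc, hy, ← hψ, ← Preadditive.comp_add, add_sub_cancel]

/-- Surjectivity of `Ext¹(X, -)` on an epimorphism whose kernel has vanishing `Ext²`. -/
theorem ext_one_postcomp_surjective {S : ShortComplex C} (hS : S.ShortExact) {X : C}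
    (h : ∀ x : Ext X S.X₁ 2, x = 0) :
    Function.Surjective ((Ext.mk₀ S.g).postcomp X (add_zero 1)) := fun y =>
  Ext.covariant_sequence_exact₃ X hS y (n₁ := 2) rfl (h _)

/-- Surjectivity of `Ext¹(-, Y)` on a monomorphism whose cokernel has vanishing `Ext²`. -/
theorem ext_one_precomp_surjective {S : ShortComplex C} (hS : S.ShortExact) {Y : C}
    (h : ∀ x : Ext S.X₃ Y 2, x = 0) :
    Function.Surjective ((Ext.mk₀ S.f).precomp Y (zero_add 1)) := fun y =>
  Ext.contravariant_sequence_exact₁ hS Y y (n₁ := 2) rfl (h _)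

end ExtGeneralities

end IHall

namespace IHall

/-! ### Counting with exact sequences -/

theorem card_ker_mul_card_range {G H : Type*} [AddGroup G] [AddGroup H] (f : G →+ H) :
    Nat.card f.ker * Nat.card f.range = Nat.card G := by
  rw [← Nat.card_congr (QuotientAddGroup.quotientKerEquivRange f).toEquiv, mul_comm,
    ← AddSubgroup.card_eq_card_quotient_mul_card_addSubgroup]

/-- The alternating product of the orders in an exact sequence
`0 → A₁ → A₂ → A₃ → A₄ → Ker f₅ → 0`. -/
theorem card_eq_of_exact {A₁ A₂ A₃ A₄ A₅ A₆ : Type*} [AddCommGroup A₁] [AddCommGroup A₂]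
    [AddCommGroup A₃] [AddCommGroup A₄] [AddCommGroup A₅] [AddCommGroup A₆]
    (f₁ : A₁ →+ A₂) (f₂ : A₂ →+ A₃) (f₃ : A₃ →+ A₄) (f₄ : A₄ →+ A₅) (f₅ : A₅ →+ A₆)
    (h₁ : Function.Injective f₁) (h₂ : Function.Exact f₁ f₂) (h₃ : Function.Exact f₂ f₃)
    (h₄ : Function.Exact f₃ f₄) (h₅ : Function.Exact f₄ f₅) :
    Nat.card A₁ * Nat.card A₃ * Nat.card f₅.ker = Nat.card A₂ * Nat.card A₄ := by
  rw [← card_ker_mul_card_range f₂, ← card_ker_mul_card_range f₃, ← card_ker_mul_card_range f₄,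
    AddMonoidHom.exact_iff.1 h₂, AddMonoidHom.exact_iff.1 h₃, AddMonoidHom.exact_iff.1 h₄,
    AddMonoidHom.exact_iff.1 h₅, Nat.card_congr (AddMonoidHom.ofInjective h₁).toEquiv]
  ring

theorem card_fiber_eq_card_ker {G H : Type*} [AddGroup G] [AddGroup H] (f : G →+ H) (x : G) :
    Nat.card {y // f y = f x} = Nat.card f.ker :=
  Nat.card_congr
    { toFun := fun y => ⟨y.1 - x, by simp [AddMonoidHom.mem_ker, y.2]⟩
      invFun := fun y => ⟨y.1 + x, by simp [(AddMonoidHom.mem_ker).1 y.2]⟩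
      left_inv := fun y => by simp
      right_inv := fun y => by simp }

theorem card_hom_ne_zero {C : Type*} [Category C] (X Y : C) [Finite (X ⟶ Y)]
    [Nonempty (X ⟶ Y)] : (Nat.card (X ⟶ Y) : ℚ) ≠ 0 := by
  exact_mod_cast Nat.card_pos.ne'

/-- The arithmetic behind multiplicativity of `chi`: `r` is the order of the kernel of a surjection
between Ext¹ groups of orders `e₂` and `e₃`, `h₂` and `h₃` are the orders of the Hom groups, and `c`
is `chi` for the remaining term. -/
theorem div_eq_mul_div_of_fibre {r h₂ h₃ e₂ e₃ c : ℚ} (hh₂ : h₂ ≠ 0) (hh₃ : h₃ ≠ 0)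
    (he₂ : e₂ ≠ 0) (he₃ : e₃ ≠ 0) (hc : c ≠ 0) (h : r / h₂ = c⁻¹ / h₃) (h' : r * e₃ = e₂) :
    h₂ / e₂ = c * (h₃ / e₃) := by
  field_simp at h ⊢
  linear_combination c * h₃ * h' - e₃ * h

/-! ### The multiplicative Euler form -/

section EulerCount

variable {C : Type u} [Category.{v} C] [Abelian C] [HasExt.{w} C]

/-- The multiplicative Euler form `|Hom(X, Y)| / |Ext¹(X, Y)|`. -/
def chi (X Y : C) : ℚ := (Nat.card (X ⟶ Y) : ℚ) / (Nat.card (Ext X Y 1) : ℚ)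

theorem card_ext_zero (X Y : C) : Nat.card (Ext X Y 0) = Nat.card (X ⟶ Y) :=
  Nat.card_congr Ext.homEquiv₀

/-- The long exact sequence from Hom(X, S₁) on, cut at the kernel of Ext¹(X, S₂) ⟶ Ext¹(X, S₃), so
that no vanishing of Ext² is required. -/
theorem card_postcomp_ker (X : C) {S : ShortComplex C} (hS : S.ShortExact) :
    Nat.card (X ⟶ S.X₁) * Nat.card (X ⟶ S.X₃) *
        Nat.card ((Ext.mk₀ S.g).postcomp X (add_zero 1)).ker =
      Nat.card (X ⟶ S.X₂) * Nat.card (Ext X S.X₁ 1) := by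
  simp only [← card_ext_zero]
  have := hS.mono_f
  refine card_eq_of_exact ((Ext.mk₀ S.f).postcomp X (add_zero 0))
    ((Ext.mk₀ S.g).postcomp X (add_zero 0)) (hS.extClass.postcomp X (zero_add 1))
    ((Ext.mk₀ S.f).postcomp X (add_zero 1)) _
    (Ext.postcomp_mk₀_injective_of_mono X S.f) ?_ ?_ ?_ ?_
  · exact fun y => ⟨fun h => Ext.covariant_sequence_exact₂ X hS y h,
      by rintro ⟨x, rfl⟩; simp⟩
  · exact fun y => ⟨fun h => Ext.covariant_sequence_exact₃ X hS y (zero_add 1) h,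
      by rintro ⟨x, rfl⟩; simp⟩
  · exact fun y => ⟨fun h => Ext.covariant_sequence_exact₁ X hS y h (zero_add 1),
      by rintro ⟨x, rfl⟩; simp⟩
  · exact fun y => ⟨fun h => Ext.covariant_sequence_exact₂ X hS y h,
      by rintro ⟨x, rfl⟩; simp⟩

theorem card_precomp_ker (Y : C) {S : ShortComplex C} (hS : S.ShortExact) :
    Nat.card (S.X₃ ⟶ Y) * Nat.card (S.X₁ ⟶ Y) *
        Nat.card ((Ext.mk₀ S.f).precomp Y (zero_add 1)).ker =
      Nat.card (S.X₂ ⟶ Y) * Nat.card (Ext S.X₃ Y 1) := by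
  simp only [← card_ext_zero]
  have := hS.epi_g
  refine card_eq_of_exact ((Ext.mk₀ S.g).precomp Y (zero_add 0))
    ((Ext.mk₀ S.f).precomp Y (zero_add 0)) (hS.extClass.precomp Y (add_zero 1))
    ((Ext.mk₀ S.g).precomp Y (zero_add 1)) _
    (Ext.precomp_mk₀_injective_of_epi Y S.g) ?_ ?_ ?_ ?_
  · exact fun y => ⟨fun h => Ext.contravariant_sequence_exact₂ hS Y y h,
      by rintro ⟨x, rfl⟩; simp⟩
  · exact fun y => ⟨fun h => Ext.contravariant_sequence_exact₁ hS Y y (add_zero 1) h,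
      by rintro ⟨x, rfl⟩; simp⟩
  · exact fun y => ⟨fun h => Ext.contravariant_sequence_exact₃ hS Y y h (add_zero 1),
      by rintro ⟨x, rfl⟩; simp⟩
  · exact fun y => ⟨fun h => Ext.contravariant_sequence_exact₂ hS Y y h,
      by rintro ⟨x, rfl⟩; simp⟩

theorem card_ext_ne_zero (X Y : C) [Finite (Ext X Y 1)] : (Nat.card (Ext X Y 1) : ℚ) ≠ 0 := by
  exact_mod_cast Nat.card_pos.ne'

variable [∀ X Y : C, Finite (X ⟶ Y)] [∀ X Y : C, Finite (Ext X Y 1)]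

theorem chi_ne_zero (X Y : C) : chi X Y ≠ 0 :=
  div_ne_zero (card_hom_ne_zero X Y) (card_ext_ne_zero X Y)

/-- The order of the fibres of `Ext¹(X, S₂) → Ext¹(X, S₃)`. -/
theorem card_postcomp_ker_div (X : C) {S : ShortComplex C} (hS : S.ShortExact) :
    (Nat.card ((Ext.mk₀ S.g).postcomp X (add_zero 1)).ker : ℚ) / Nat.card (X ⟶ S.X₂) =
      (chi X S.X₁)⁻¹ / Nat.card (X ⟶ S.X₃) := by
  have h : (_ : ℚ) = _ := congrArg Nat.cast (card_postcomp_ker X hS)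
  push_cast at h
  have := card_hom_ne_zero X S.X₁
  have := card_hom_ne_zero X S.X₂
  have := card_hom_ne_zero X S.X₃
  have := card_ext_ne_zero X S.X₁
  rw [chi]
  field_simp
  linear_combination h

/-- The order of the fibres of `Ext¹(S₂, Y) → Ext¹(S₁, Y)`. -/
theorem card_precomp_ker_div (Y : C) {S : ShortComplex C} (hS : S.ShortExact) :
    (Nat.card ((Ext.mk₀ S.f).precomp Y (zero_add 1)).ker : ℚ) / Nat.card (S.X₂ ⟶ Y) =
      (chi S.X₃ Y)⁻¹ / Nat.card (S.X₁ ⟶ Y) := by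
  have h : (_ : ℚ) = _ := congrArg Nat.cast (card_precomp_ker Y hS)
  push_cast at h
  have := card_hom_ne_zero S.X₁ Y
  have := card_hom_ne_zero S.X₂ Y
  have := card_hom_ne_zero S.X₃ Y
  have := card_ext_ne_zero S.X₃ Y
  rw [chi]
  field_simp
  linear_combination h

/-- Vanishing of Ext²(X, S₁) makes the last map of the six-term sequence surjective, so the order of
its kernel is a quotient of orders of Ext¹ groups. -/
theorem chi_right_mul (X : C) {S : ShortComplex C} (hS : S.ShortExact)
    (h : ∀ x : Ext X S.X₁ 2, x = 0) : chi X S.X₂ = chi X S.X₁ * chi X S.X₃ := by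
  have h₁ := card_postcomp_ker_div X hS
  have h₂ := card_ker_mul_card_range ((Ext.mk₀ S.g).postcomp X (add_zero 1))
  rw [AddMonoidHom.range_eq_top_of_surjective _ (ext_one_postcomp_surjective hS h),
    AddSubgroup.card_top] at h₂
  have h₃ : (_ : ℚ) = _ := congrArg Nat.cast h₂
  push_cast at h₃
  rw [chi, chi.eq_def X S.X₃]
  exact div_eq_mul_div_of_fibre (card_hom_ne_zero X S.X₂) (card_hom_ne_zero X S.X₃)
    (card_ext_ne_zero X S.X₂) (card_ext_ne_zero X S.X₃) (chi_ne_zero X S.X₁) h₁ h₃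

theorem chi_left_mul (Y : C) {S : ShortComplex C} (hS : S.ShortExact)
    (h : ∀ x : Ext S.X₃ Y 2, x = 0) : chi S.X₂ Y = chi S.X₁ Y * chi S.X₃ Y := by
  have h₁ := card_precomp_ker_div Y hS
  have h₂ := card_ker_mul_card_range ((Ext.mk₀ S.f).precomp Y (zero_add 1))
  rw [AddMonoidHom.range_eq_top_of_surjective _ (ext_one_precomp_surjective hS h),
    AddSubgroup.card_top] at h₂
  have h₃ : (_ : ℚ) = _ := congrArg Nat.cast h₂
  push_cast at h₃
  rw [mul_comm, chi, chi.eq_def S.X₁ Y]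
  exact div_eq_mul_div_of_fibre (card_hom_ne_zero S.X₂ Y) (card_hom_ne_zero S.X₁ Y)
    (card_ext_ne_zero S.X₂ Y) (card_ext_ne_zero S.X₁ Y) (chi_ne_zero S.X₃ Y) h₁ h₃

end EulerCount

end IHall

namespace IHall

/-! ### The Euler form on the Grothendieck group -/

section Grothendieck

variable {A : Type u} [Category.{v} A] [Abelian A]

theorem K0.cls_eq_zero {X : A} (h : IsZero X) : K0.cls X = 0 := by
  have hS : (ShortComplex.mk (0 : X ⟶ X) (0 : X ⟶ X) (by simp)).ShortExact :=
    { exact := ShortComplex.exact_of_isZero_X₂ _ h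
      mono_f := ⟨fun _ _ _ => h.eq_of_tgt _ _⟩
      epi_g := ⟨fun _ _ _ => h.eq_of_src _ _⟩ }
  simpa using K0.cls_of_shortExact hS

theorem K0.cls_congr {X Y : A} (e : X ≅ Y) : K0.cls X = K0.cls Y := by
  have hS : (ShortComplex.mk e.hom (0 : Y ⟶ 0) (by simp)).ShortExact :=
    { exact := (ShortComplex.exact_iff_epi _ rfl).2 (inferInstanceAs (Epi e.hom))
      mono_f := inferInstance
      epi_g := ⟨fun _ _ _ => (isZero_zero A).eq_of_src _ _⟩ }
  have := K0.cls_of_shortExact hS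
  simpa [K0.cls_eq_zero (isZero_zero A)] using this.symm

/-- Additive functions on objects extend to the Grothendieck group. -/
def K0.lift {G : Type*} [AddCommGroup G] (f : A → G)
    (hf : ∀ S : ShortComplex A, S.ShortExact → f S.X₂ = f S.X₁ + f S.X₃) : K0 A →+ G :=
  QuotientAddGroup.lift _ (FreeAbelianGroup.lift f) (by
    refine (AddSubgroup.closure_le _).2 ?_
    rintro _ ⟨S, hS, rfl⟩
    simp [AddMonoidHom.mem_ker, hf S hS])

@[simp] theorem K0.lift_cls {G : Type*} [AddCommGroup G] (f : A → G)
    (hf : ∀ S : ShortComplex A, S.ShortExact → f S.X₂ = f S.X₁ + f S.X₃) (X : A) :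
    K0.lift f hf (K0.cls X) = f X := by
  exact (QuotientAddGroup.lift_mk _ _ _).trans (FreeAbelianGroup.lift_apply_of _ _)

theorem K0.hom_ext {G : Type*} [AddCommGroup G] {f g : K0 A →+ G}
    (h : ∀ X, f (K0.cls X) = g (K0.cls X)) : f = g := by
  refine AddMonoidHom.ext fun α => ?_
  obtain ⟨X, Y, rfl⟩ := K0.exists_eq_sub α
  simp [h]

theorem K0.eq_of_forall_cls {G : Type*} [AddCommGroup G] {f g : K0 A →+ G}
    (h : ∀ X, f (K0.cls X) = g (K0.cls X)) (α : K0 A) : f α = g α := by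
  rw [K0.hom_ext h]

variable (A) in
/-- Hereditary abelian categories with finite `Hom` and `Ext¹`. -/
class FiniteHereditary [HasExt.{w} A] : Prop where
  finite_hom (X Y : A) : Finite (X ⟶ Y)
  finite_ext (X Y : A) : Finite (Ext X Y 1)
  ext_two (X Y : A) (x : Ext X Y 2) : x = 0

attribute [instance] FiniteHereditary.finite_hom FiniteHereditary.finite_ext

variable {k : Type u'} [Field k] [Linear k A]

/-- The action of the involution on the Grothendieck group. -/
def K0.rho (ρ : Involution k A) : K0 A →+ K0 A :=
  K0.lift (fun X => K0.cls (ρ.functor.obj X)) fun _ hS =>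
    K0.cls_of_shortExact (hS.map_of_exact ρ.functor)

@[simp] theorem K0.rho_cls (ρ : Involution k A) (X : A) :
    K0.rho ρ (K0.cls X) = K0.cls (ρ.functor.obj X) :=
  K0.lift_cls _ _ X

@[simp] theorem K0.rho_rho (ρ : Involution k A) (α : K0 A) : K0.rho ρ (K0.rho ρ α) = α :=
  K0.eq_of_forall_cls (f := (K0.rho ρ).comp (K0.rho ρ)) (g := AddMonoidHom.id _)
    (fun X => by simpa using K0.cls_congr (ρ.sq.app X)) α

variable [HasExt.{w} A]

theorem card_ext_congr {X X' Y Y' : A} (e : X ≅ X') (e' : Y ≅ Y') :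
    Nat.card (Ext X Y 1) = Nat.card (Ext X' Y' 1) := 
  Nat.card_congr
    { toFun := fun x => (Ext.mk₀ e.inv).comp (x.comp (Ext.mk₀ e'.hom) (add_zero 1)) (zero_add 1)
      invFun := fun x => (Ext.mk₀ e.hom).comp (x.comp (Ext.mk₀ e'.inv) (add_zero 1)) (zero_add 1)
      left_inv := fun x => by simp
      right_inv := fun x => by simp }

variable [Finite k] [FiniteHereditary A]

theorem two_le_card (k : Type u') [Field k] [Finite k] : 1 < (Nat.card k : ℚ) := by
  exact_mod_cast Finite.one_lt_card

variable (k) in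
-- As n ↦ qⁿ is injective, additivity and invariance of the Euler form can be deduced from counts of
-- group orders.
theorem chi_eq_zpow (X Y : A) : chi X Y = (Nat.card k : ℚ) ^ euler k X Y := by
  have hq : (Nat.card k : ℚ) ≠ 0 := by linarith [two_le_card k]
  rw [chi, euler, zpow_sub₀ hq, zpow_natCast, zpow_natCast,
    Module.natCard_eq_pow_finrank (K := k) (V := X ⟶ Y),
    Module.natCard_eq_pow_finrank (K := k) (V := Ext X Y 1)]
  push_cast
  rfl

theorem zpow_card_injective (k : Type u') [Field k] [Finite k] :
    Function.Injective fun n : ℤ => (Nat.card k : ℚ) ^ n :=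
  zpow_right_injective₀ (by linarith [two_le_card k]) (two_le_card k).ne'

variable (k) in
theorem euler_right_add (X : A) {S : ShortComplex A} (hS : S.ShortExact) :
    euler k X S.X₂ = euler k X S.X₁ + euler k X S.X₃ := by
  apply zpow_card_injective k
  dsimp only
  rw [zpow_add₀ (by linarith [two_le_card k]), ← chi_eq_zpow, ← chi_eq_zpow, ← chi_eq_zpow,
    chi_right_mul X hS (FiniteHereditary.ext_two _ _)]

variable (k) in
theorem euler_left_add (Y : A) {S : ShortComplex A} (hS : S.ShortExact) :
    euler k S.X₂ Y = euler k S.X₁ Y + euler k S.X₃ Y := by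
  apply zpow_card_injective k
  dsimp only
  rw [zpow_add₀ (by linarith [two_le_card k]), ← chi_eq_zpow, ← chi_eq_zpow, ← chi_eq_zpow,
    chi_left_mul Y hS (FiniteHereditary.ext_two _ _)]

variable (k) in
variable (A) in
/-- The Euler form on the Grothendieck group. -/
def eulerK : K0 A →+ K0 A →+ ℤ :=
  K0.lift (fun X => K0.lift (fun Y => euler k X Y) fun _ hS => euler_right_add k X hS)
    fun S hS => K0.hom_ext fun Y => by simp [euler_left_add k Y hS]

@[simp] theorem eulerK_cls (X Y : A) : eulerK A k (K0.cls X) (K0.cls Y) = euler k X Y := by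
  simp [eulerK]

omit [Finite k] in
-- An exact fully faithful functor is injective on Ext¹: a splitting of the image sequence comes
-- from a splitting of the original. The inequality suffices, since applying it twice and using ϱ² ≅
-- Id gives equality.
theorem card_ext_le_rho (ρ : Involution k A) (X Y : A) :
    Nat.card (Ext X Y 1) ≤ Nat.card (Ext (ρ.functor.obj X) (ρ.functor.obj Y) 1) := by
  refine Nat.card_le_card_of_injective (ρ.functor.mapExtAddHom X Y 1) ?_
  rw [injective_iff_map_eq_zero]
  intro x hx
  obtain ⟨E, i, p, z, hS, rfl⟩ := exists_extClass_eq x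
  rw [Functor.mapExtAddHom_apply, Ext.mapExactFunctor_extClass] at hx
  obtain ⟨r, hr⟩ := exists_retraction_of_extClass_eq_zero _ hx
  obtain ⟨r, rfl⟩ := ρ.functor.map_surjective (X := E) (Y := Y) r
  exact extClass_eq_zero_of_retraction hS r (ρ.functor.map_injective
    ((ρ.functor.map_comp i r).trans (hr.trans (ρ.functor.map_id Y).symm)))

theorem card_ext_rho (ρ : Involution k A) (X Y : A) :
    Nat.card (Ext (ρ.functor.obj X) (ρ.functor.obj Y) 1) = Nat.card (Ext X Y 1) := by
  refine le_antisymm ?_ (card_ext_le_rho ρ X Y)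
  exact (card_ext_le_rho ρ _ _).trans (card_ext_congr (ρ.sq.app X) (ρ.sq.app Y)).le

theorem eulerK_rho_rho (ρ : Involution k A) (α β : K0 A) :
    eulerK A k (K0.rho ρ α) (K0.rho ρ β) = eulerK A k α β := by
  refine DFunLike.congr_fun (K0.eq_of_forall_cls
    (f := ((AddMonoidHom.compHom (M := K0 A) (N := K0 A) (P := ℤ)).flip (K0.rho ρ)).comp
      ((eulerK A k).comp (K0.rho ρ)))
    (g := eulerK A k) (fun X => K0.hom_ext fun Y => ?_) α) β
  change eulerK A k (K0.rho ρ (K0.cls X)) (K0.rho ρ (K0.cls Y)) = _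
  rw [K0.rho_cls, K0.rho_cls, eulerK_cls, eulerK_cls]
  apply zpow_card_injective k
  dsimp only
  rw [← chi_eq_zpow, ← chi_eq_zpow, chi, chi, card_ext_rho,
    Nat.card_congr
      ((Functor.FullyFaithful.ofFullyFaithful ρ.functor).homEquiv (X := X) (Y := Y))]

/-- An isometry of order two is self-adjoint. This identity makes the classes of acyclic complexes
multiply without scalars. -/
theorem eulerK_rho_left (ρ : Involution k A) (α β : K0 A) :
    eulerK A k (K0.rho ρ α) β = eulerK A k α (K0.rho ρ β) := by
  rw [← eulerK_rho_rho ρ, K0.rho_rho]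

end Grothendieck

end IHall

namespace IHall

/-! ### Homology of `ϱ`-complexes -/

section Homology

variable {k : Type u'} [Field k] {A : Type u} [Category.{v} A] [Abelian A] [Linear k A]
  {ρ : Involution k A}

namespace Cpx

/-- The differential `ϱ M ⟶ M`. -/
abbrev b (M : Cpx ρ) : ρ.functor.obj M.X ⟶ M.X := ρ.functor.map M.d ≫ ρ.sq.hom.app M.X

theorem b_comp_d (M : Cpx ρ) : M.b ≫ M.d = 0 := M.sc.zero

/-- The short complex `ϱ M ⟶ M ⟶ ϱ M`. -/
abbrev ss (M : Cpx ρ) : ShortComplex A := ShortComplex.mk M.b M.d M.b_comp_d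

theorem map_b (M : Cpx ρ) : ρ.functor.map M.b = ρ.sq.hom.app M.X ≫ M.d := by
  rw [Functor.map_comp, ρ.map_sq]
  exact ρ.sq.hom.naturality M.d

theorem d_comp_b (M : Cpx ρ) : M.d ≫ M.b = 0 := by
  rw [← Category.assoc, M.d_comp_d, zero_comp]

theorem map_comp_b {M N : Cpx ρ} (f : M ⟶ N) : ρ.functor.map f.f ≫ N.b = M.b ≫ f.f := by
  have h := ρ.sq.hom.naturality f.f
  simp only [Functor.comp_map, Functor.id_map] at h
  rw [b, ← Category.assoc, ← Functor.map_comp, ← f.comm', Functor.map_comp, Category.assoc, h,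
    Category.assoc]

/-- The short complex `M ⟶ ϱ M ⟶ M`. -/
abbrev sc' (M : Cpx ρ) : ShortComplex A := ShortComplex.mk M.d M.b M.d_comp_b

theorem isAcyclic_iff (M : Cpx ρ) : M.IsAcyclic ↔ M.ss.Exact :=
  (ShortComplex.exact_iff_isZero_homology _).symm

theorem IsAcyclic.exact {M : Cpx ρ} (h : M.IsAcyclic) : M.ss.Exact := M.isAcyclic_iff.1 h

/-- Applying ϱ to the exact sequence at M gives the sequence at ϱ M, once ϱ² is identified with the
identity. -/
theorem IsAcyclic.exact' {M : Cpx ρ} (h : M.IsAcyclic) : M.sc'.Exact := by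
  have h₁ : (M.ss.map ρ.functor).Exact := h.exact.map ρ.functor
  refine (ShortComplex.exact_iff_of_iso (ShortComplex.isoMk (ρ.sq.app M.X)
    (Iso.refl (ρ.functor.obj M.X)) (ρ.sq.app M.X) ?_ ?_)).1 h₁
  · exact (M.map_b.symm.trans (Category.comp_id _).symm)
  · exact Category.id_comp _

/-- The morphism of short complexes given by a morphism of `ϱ`-complexes. -/
@[simps] def scMap {M N : Cpx ρ} (f : M ⟶ N) : M.ss ⟶ N.ss where
  τ₁ := ρ.functor.map f.f
  τ₂ := f.f
  τ₃ := ρ.functor.map f.f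
  comm₁₂ := map_comp_b f
  comm₂₃ := f.comm'.symm

theorem scMap_id (M : Cpx ρ) : scMap (𝟙 M) = 𝟙 M.ss := by
  ext <;> simp

theorem scMap_comp {M N L : Cpx ρ} (f : M ⟶ N) (g : N ⟶ L) :
    scMap (f ≫ g) = scMap f ≫ scMap g :=
  ShortComplex.Hom.ext (ρ.functor.map_comp _ _) rfl (ρ.functor.map_comp _ _)

/-- Isomorphic complexes have isomorphic short complexes. -/
def scIso {M N : Cpx ρ} (e : M ≅ N) : M.ss ≅ N.ss where
  hom := scMap e.hom
  inv := scMap e.inv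
  hom_inv_id := by rw [← scMap_comp, e.hom_inv_id, scMap_id]
  inv_hom_id := by rw [← scMap_comp, e.inv_hom_id, scMap_id]

/-- Isomorphic complexes have isomorphic homology. -/
def homologyIso {M N : Cpx ρ} (e : M ≅ N) : M.homology ≅ N.homology :=
  ShortComplex.homologyMapIso (scIso e)

end Cpx

/-! ### Diagram chases in short exact sequences with an acyclic term -/

section ShortExact

variable {S : ShortComplex (Cpx ρ)} (hS : S.ShortExact)

include hS

theorem shortExact_res : (ShortComplex.mk S.f.f S.g.f (by
    rw [← Cpx.comp_f, S.zero, Cpx.zero_f])).ShortExact :=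
  hS.map_of_exact (Cpx.res ρ)

theorem mono_f_f : Mono S.f.f := (shortExact_res hS).mono_f

theorem epi_g_f : Epi S.g.f := (shortExact_res hS).epi_g

theorem exists_lift_sub {T : A} (y : T ⟶ S.X₂.X) (hy : y ≫ S.g.f = 0) :
    ∃ x : T ⟶ S.X₁.X, x ≫ S.f.f = y :=
  have := mono_f_f hS
  ⟨(shortExact_res hS).exact.lift y hy, (shortExact_res hS).exact.lift_f y hy⟩

theorem exists_lift_rho_sub {T : A} (y : T ⟶ ρ.functor.obj S.X₂.X)
    (hy : y ≫ ρ.functor.map S.g.f = 0) :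
    ∃ x : T ⟶ ρ.functor.obj S.X₁.X, x ≫ ρ.functor.map S.f.f = y :=
  have h := (shortExact_res hS).map_of_exact ρ.functor
  have := h.mono_f
  ⟨h.exact.lift y hy, h.exact.lift_f y hy⟩

theorem exists_lift_quot {T : A} (x : T ⟶ S.X₃.X) :
    ∃ (T' : A) (π : T' ⟶ T) (_ : Epi π) (y : T' ⟶ S.X₂.X), π ≫ x = y ≫ S.g.f :=
  have := epi_g_f hS
  surjective_up_to_refinements_of_epi S.g.f x

theorem exists_lift_rho_quot {T : A} (x : T ⟶ ρ.functor.obj S.X₃.X) :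
    ∃ (T' : A) (π : T' ⟶ T) (_ : Epi π) (y : T' ⟶ ρ.functor.obj S.X₂.X),
      π ≫ x = y ≫ ρ.functor.map S.g.f :=
  have : Epi (ρ.functor.map S.g.f) := ((shortExact_res hS).map_of_exact ρ.functor).epi_g
  surjective_up_to_refinements_of_epi (ρ.functor.map S.g.f) x

/-- Cycles lift along an epimorphism of complexes with acyclic kernel. -/
theorem exists_lift_cycle_of_sub (h : S.X₁.IsAcyclic) {T : A} (x : T ⟶ S.X₃.X)
    (hx : x ≫ S.X₃.d = 0) :
    ∃ (T' : A) (π : T' ⟶ T) (_ : Epi π) (y : T' ⟶ S.X₂.X), y ≫ S.X₂.d = 0 ∧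
      π ≫ x = y ≫ S.g.f := by
  obtain ⟨T₁, π₁, _, y, hy⟩ := exists_lift_quot hS x
  -- The differential of a lift `y` of `x` comes from the subcomplex, where it is a cycle, hence the
  -- differential of some `e`; then `y - e` is the required cycle.
  obtain ⟨c, hc⟩ := exists_lift_rho_sub hS (y ≫ S.X₂.d) (by
    rw [Category.assoc, S.g.comm', ← reassoc_of% hy, hx, comp_zero])
  have := mono_f_f hS
  have hc' : c ≫ S.X₁.b = 0 := by
    rw [← cancel_mono S.f.f, Category.assoc, ← Cpx.map_comp_b, reassoc_of% hc, Cpx.d_comp_b,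
      comp_zero, zero_comp]
  obtain ⟨T₂, π₂, _, e, he⟩ := h.exact'.exact_up_to_refinements c hc'
  dsimp at he
  refine ⟨T₂, π₂ ≫ π₁, inferInstance, π₂ ≫ y - e ≫ S.f.f, ?_, ?_⟩
  · rw [Preadditive.sub_comp, Category.assoc, Category.assoc, ← hc, ← S.f.comm',
      ← Category.assoc π₂, he, Category.assoc, sub_self]
  · rw [Preadditive.sub_comp, Category.assoc, Category.assoc, Category.assoc, hy, ← Cpx.comp_f,
      S.zero, Cpx.zero_f, comp_zero, sub_zero]

/-- Cycles lift along an epimorphism to an acyclic complex. -/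
theorem exists_lift_cycle_of_quot (h : S.X₃.IsAcyclic) {T : A} (x : T ⟶ S.X₃.X)
    (hx : x ≫ S.X₃.d = 0) :
    ∃ (T' : A) (π : T' ⟶ T) (_ : Epi π) (y : T' ⟶ S.X₂.X), y ≫ S.X₂.d = 0 ∧
      π ≫ x = y ≫ S.g.f := by
  -- In an acyclic quotient a cycle is a boundary, and the boundary of any lift of its preimage is
  -- automatically a cycle.
  obtain ⟨T₁, π₁, _, y, hy⟩ := h.exact.exact_up_to_refinements x hx
  obtain ⟨T₂, π₂, _, z, hz⟩ := exists_lift_rho_quot hS y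
  refine ⟨T₂, π₂ ≫ π₁, inferInstance, z ≫ S.X₂.b, ?_, ?_⟩
  · rw [Category.assoc, Cpx.b_comp_d, comp_zero]
  · rw [Category.assoc, hy, ← Category.assoc, hz, Category.assoc, Category.assoc,
      ← Cpx.map_comp_b]

/-- The sequence of cycles is exact if cycles lift. -/
theorem shortExact_cycles (h : S.X₁.IsAcyclic ∨ S.X₃.IsAcyclic) :
    (ShortComplex.mk (ShortComplex.cyclesMap (Cpx.scMap S.f))
      (ShortComplex.cyclesMap (Cpx.scMap S.g)) (by
        rw [← ShortComplex.cyclesMap_comp, ← Cpx.scMap_comp, S.zero,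
          ← cancel_mono (ShortComplex.iCycles _)]
        simp)).ShortExact := by
  have := mono_f_f hS
  refine { exact := ?_, mono_f := ?_, epi_g := ?_ }
  · rw [ShortComplex.exact_iff_exact_up_to_refinements]
    intro T x hx
    dsimp at x hx ⊢
    obtain ⟨y, hy⟩ := exists_lift_sub hS (x ≫ S.X₂.ss.iCycles) (by
      have := hx =≫ S.X₃.ss.iCycles
      simpa using this)
    refine ⟨T, 𝟙 T, inferInstance, S.X₁.ss.liftCycles y ?_, ?_⟩
    · have := ((shortExact_res hS).map_of_exact ρ.functor).mono_f
      change Mono (ρ.functor.map S.f.f) at this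
      rw [← cancel_mono (ρ.functor.map S.f.f), zero_comp, Category.assoc]
      change y ≫ S.X₁.d ≫ _ = 0
      rw [S.f.comm', reassoc_of% hy]
      exact (x ≫= S.X₂.ss.iCycles_g).trans comp_zero
    · rw [← cancel_mono (ShortComplex.iCycles _)]
      simp [hy]
  · have : Mono (ShortComplex.cyclesMap (Cpx.scMap S.f) ≫ S.X₂.ss.iCycles) := by
      rw [ShortComplex.cyclesMap_i]
      exact mono_comp _ S.f.f
    exact mono_of_mono _ S.X₂.ss.iCycles
  · rw [epi_iff_surjective_up_to_refinements]
    intro T x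
    have hx : (x ≫ S.X₃.ss.iCycles) ≫ S.X₃.d = 0 := by
      rw [Category.assoc]
      exact (x ≫= S.X₃.ss.iCycles_g).trans comp_zero
    obtain ⟨T', π, hπ, y, hy, hy'⟩ :=
      h.elim (fun h => exists_lift_cycle_of_sub hS h _ hx)
        (fun h => exists_lift_cycle_of_quot hS h _ hx)
    refine ⟨T', π, hπ, S.X₂.ss.liftCycles y hy, ?_⟩
    rw [← cancel_mono (ShortComplex.iCycles _)]
    simpa using hy'

/-- The sequence of cokernels `M / Im` is exact if the last term is acyclic. -/
theorem shortExact_opcycles (h : S.X₃.IsAcyclic) :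
    (ShortComplex.mk (ShortComplex.opcyclesMap (Cpx.scMap S.f))
      (ShortComplex.opcyclesMap (Cpx.scMap S.g)) (by
        rw [← ShortComplex.opcyclesMap_comp, ← Cpx.scMap_comp, S.zero,
          ← cancel_epi (ShortComplex.pOpcycles _)]
        simp)).ShortExact := by
  have := mono_f_f hS
  have := epi_g_f hS
  refine { exact := ?_, mono_f := ?_, epi_g := ?_ }
  · rw [ShortComplex.exact_iff_exact_up_to_refinements]
    intro T x hx
    dsimp at x hx ⊢
    obtain ⟨T₁, π₁, _, y, hy⟩ := surjective_up_to_refinements_of_epi S.X₂.ss.pOpcycles x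
    have h₁ : (y ≫ S.g.f) ≫ S.X₃.ss.pOpcycles = 0 := by
      have := π₁ ≫= hx
      rw [reassoc_of% hy] at this
      simpa using this
    obtain ⟨T₂, π₂, _, z, hz⟩ :=
      (ShortComplex.comp_pOpcycles_eq_zero_iff_up_to_refinements (S := S.X₃.ss) (y ≫ S.g.f)).1 h₁
    obtain ⟨T₃, π₃, _, t, ht⟩ := exists_lift_rho_quot hS z
    obtain ⟨s, hs⟩ := exists_lift_sub hS (π₃ ≫ π₂ ≫ y - t ≫ S.X₂.b) (by
      rw [Preadditive.sub_comp, Category.assoc, Category.assoc, Category.assoc, hz,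
        ← Category.assoc, ht, Category.assoc, ← Cpx.map_comp_b]
      exact sub_self _)
    refine ⟨T₃, π₃ ≫ π₂ ≫ π₁, inferInstance, s ≫ S.X₁.ss.pOpcycles, ?_⟩
    have h₂ : (t ≫ S.X₂.b) ≫ S.X₂.ss.pOpcycles = 0 := by
      rw [Category.assoc]
      exact (t ≫= S.X₂.ss.f_pOpcycles).trans comp_zero
    rw [Category.assoc s, ShortComplex.p_opcyclesMap]
    change _ = s ≫ S.f.f ≫ _
    rw [reassoc_of% hs, Preadditive.sub_comp, h₂, sub_zero]
    simp [hy]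
  · rw [Preadditive.mono_iff_cancel_zero]
    intro T x hx
    dsimp at x hx
    obtain ⟨T₁, π₁, _, y, hy⟩ := surjective_up_to_refinements_of_epi S.X₁.ss.pOpcycles x
    have h₁ : (y ≫ S.f.f) ≫ S.X₂.ss.pOpcycles = 0 := by
      have := π₁ ≫= hx
      rw [reassoc_of% hy] at this
      simpa using this
    obtain ⟨T₂, π₂, _, l, hl⟩ :=
      (ShortComplex.comp_pOpcycles_eq_zero_iff_up_to_refinements (S := S.X₂.ss) (y ≫ S.f.f)).1 h₁
    change _ = l ≫ S.X₂.b at hl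
    change T₂ ⟶ ρ.functor.obj S.X₂.X at l
    have h₂ : (l ≫ ρ.functor.map S.g.f) ≫ S.X₃.b = 0 := by
      rw [Category.assoc, Cpx.map_comp_b, ← Category.assoc, ← hl, Category.assoc, Category.assoc,
        ← Cpx.comp_f, S.zero, Cpx.zero_f, comp_zero, comp_zero]
    -- The image of `l` in the acyclic quotient is itself a differential. Subtracting the
    -- differential of a lift moves `l` into the subcomplex without changing `l ≫ S.X₂.b`, because
    -- `d ≫ b = 0`.
    obtain ⟨T₃, π₃, _, m, hm⟩ := h.exact'.exact_up_to_refinements _ h₂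
    dsimp at hm
    obtain ⟨T₄, π₄, _, l', hl'⟩ := exists_lift_quot hS m
    obtain ⟨s, hs⟩ := exists_lift_rho_sub hS (π₄ ≫ π₃ ≫ l - l' ≫ S.X₂.d) (by
      rw [Preadditive.sub_comp, Category.assoc, Category.assoc, Category.assoc, hm, S.g.comm',
        ← Category.assoc, hl', Category.assoc, sub_self])
    have h₃ : s ≫ S.X₁.b = π₄ ≫ π₃ ≫ π₂ ≫ y := by
      rw [← cancel_mono S.f.f, Category.assoc, ← Cpx.map_comp_b, reassoc_of% hs,
        Preadditive.sub_comp, Category.assoc l', Cpx.d_comp_b, comp_zero, sub_zero]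
      simp only [Category.assoc] at hl ⊢
      rw [hl]
    rw [← cancel_epi π₁, hy, comp_zero, ← cancel_epi π₂, comp_zero, ← cancel_epi π₃, comp_zero,
      ← cancel_epi π₄, comp_zero]
    have h₄ : (s ≫ S.X₁.b) ≫ S.X₁.ss.pOpcycles = 0 := by
      rw [Category.assoc]
      exact (s ≫= S.X₁.ss.f_pOpcycles).trans comp_zero
    rw [h₃] at h₄
    simpa only [Category.assoc] using h₄
  · have : Epi (S.X₂.ss.pOpcycles ≫ ShortComplex.opcyclesMap (Cpx.scMap S.g)) := by
      rw [ShortComplex.p_opcyclesMap]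
      exact epi_comp S.g.f _
    exact epi_of_epi S.X₂.ss.pOpcycles _

/-- An epimorphism of complexes with acyclic kernel induces an isomorphism on homology. -/
theorem nonempty_homologyIso_of_sub (h : S.X₁.IsAcyclic) :
    Nonempty (S.X₂.homology ≅ S.X₃.homology) := by
  have : Epi (ShortComplex.homologyMap (Cpx.scMap S.g)) := by
    rw [ShortComplex.epi_homologyMap_iff_up_to_refinements]
    intro T x hx
    obtain ⟨T', π, hπ, y, hy, hy'⟩ := exists_lift_cycle_of_sub hS h x hx
    exact ⟨T', π, hπ, y, hy, 0, by rw [zero_comp, add_zero]; exact hy'⟩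
  have : Mono (ShortComplex.homologyMap (Cpx.scMap S.g)) := by
    rw [ShortComplex.mono_homologyMap_iff_up_to_refinements]
    intro T (x : T ⟶ S.X₂.X) (hx : x ≫ S.X₂.d = 0) (m : T ⟶ ρ.functor.obj S.X₃.X)
      (hm : x ≫ S.g.f = m ≫ S.X₃.b)
    obtain ⟨T₁, π₁, _, l, hl⟩ := exists_lift_rho_quot hS m
    obtain ⟨c, hc⟩ := exists_lift_sub hS (π₁ ≫ x - l ≫ S.X₂.b) (by
      rw [Preadditive.sub_comp, Category.assoc, Category.assoc, hm, ← Category.assoc, hl,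
        Category.assoc, Cpx.map_comp_b, sub_self])
    have hc' : c ≫ S.X₁.d = 0 := by
      have := ((shortExact_res hS).map_of_exact ρ.functor).mono_f
      change Mono (ρ.functor.map S.f.f) at this
      rw [← cancel_mono (ρ.functor.map S.f.f), zero_comp, Category.assoc, S.f.comm',
        reassoc_of% hc, Preadditive.sub_comp, Category.assoc, hx, Category.assoc, Cpx.b_comp_d,
        comp_zero, comp_zero, sub_zero]
    obtain ⟨T₂, π₂, _, e, he⟩ := h.exact.exact_up_to_refinements c hc'
    change _ = e ≫ S.X₁.b at he
    refine ⟨T₂, π₂ ≫ π₁, inferInstance, π₂ ≫ l + e ≫ ρ.functor.map S.f.f, ?_⟩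
    change _ = _ ≫ S.X₂.b
    rw [Preadditive.add_comp, Category.assoc e, Cpx.map_comp_b, ← Category.assoc e, ← he,
      Category.assoc π₂ c, hc, Preadditive.comp_sub]
    simp only [Category.assoc]
    abel
  have : IsIso (ShortComplex.homologyMap (Cpx.scMap S.g)) := isIso_of_mono_of_epi _
  let e := asIso (ShortComplex.homologyMap (Cpx.scMap S.g))
  exact ⟨e⟩

/-- A monomorphism of complexes with acyclic cokernel induces an isomorphism on homology. -/
theorem nonempty_homologyIso_of_quot (h : S.X₃.IsAcyclic) :
    Nonempty (S.X₁.homology ≅ S.X₂.homology) := by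
  have := mono_f_f hS
  have : Epi (ShortComplex.homologyMap (Cpx.scMap S.f)) := by
    rw [ShortComplex.epi_homologyMap_iff_up_to_refinements]
    intro T (x : T ⟶ S.X₂.X) (hx : x ≫ S.X₂.d = 0)
    obtain ⟨T₁, π₁, _, m, hm⟩ := h.exact.exact_up_to_refinements (x ≫ S.g.f) (by
      change _ ≫ S.X₃.d = 0
      rw [Category.assoc, ← S.g.comm', reassoc_of% hx, zero_comp])
    change _ = m ≫ S.X₃.b at hm
    obtain ⟨T₂, π₂, _, l, hl⟩ := exists_lift_rho_quot hS m
    obtain ⟨c, hc⟩ := exists_lift_sub hS (π₂ ≫ π₁ ≫ x - l ≫ S.X₂.b) (by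
      rw [Preadditive.sub_comp, Category.assoc, Category.assoc, Category.assoc, hm,
        ← Category.assoc, hl, Category.assoc, Cpx.map_comp_b, sub_self])
    refine ⟨T₂, π₂ ≫ π₁, inferInstance, c, ?_, l, ?_⟩
    · have := ((shortExact_res hS).map_of_exact ρ.functor).mono_f
      change Mono (ρ.functor.map S.f.f) at this
      change c ≫ S.X₁.d = 0
      rw [← cancel_mono (ρ.functor.map S.f.f), zero_comp, Category.assoc, S.f.comm',
        reassoc_of% hc, Preadditive.sub_comp, Category.assoc, Category.assoc, hx, Category.assoc,
        Cpx.b_comp_d, comp_zero, comp_zero, comp_zero, sub_zero]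
    · change _ = c ≫ S.f.f + l ≫ S.X₂.b
      rw [hc, Category.assoc]
      abel
  have : Mono (ShortComplex.homologyMap (Cpx.scMap S.f)) := by
    rw [ShortComplex.mono_homologyMap_iff_up_to_refinements]
    intro T (x : T ⟶ S.X₁.X) hx (l : T ⟶ ρ.functor.obj S.X₂.X) (hl : x ≫ S.f.f = l ≫ S.X₂.b)
    have h₂ : (l ≫ ρ.functor.map S.g.f) ≫ S.X₃.b = 0 := by
      rw [Category.assoc, Cpx.map_comp_b, ← Category.assoc, ← hl, Category.assoc,
        ← Cpx.comp_f, S.zero, Cpx.zero_f, comp_zero]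
    -- As for the cokernels: `l` is changed by a differential so that it comes from the subcomplex
    -- and has the same boundary.
    obtain ⟨T₃, π₃, _, m, hm⟩ := h.exact'.exact_up_to_refinements _ h₂
    dsimp at hm
    obtain ⟨T₄, π₄, _, l', hl'⟩ := exists_lift_quot hS m
    obtain ⟨s, hs⟩ := exists_lift_rho_sub hS (π₄ ≫ π₃ ≫ l - l' ≫ S.X₂.d) (by
      rw [Preadditive.sub_comp, Category.assoc, Category.assoc, Category.assoc, hm, S.g.comm',
        ← Category.assoc, hl', Category.assoc, sub_self])
    refine ⟨T₄, π₄ ≫ π₃, inferInstance, s, ?_⟩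
    change _ = s ≫ S.X₁.b
    rw [← cancel_mono S.f.f, Category.assoc s, ← Cpx.map_comp_b, reassoc_of% hs,
      Preadditive.sub_comp, Category.assoc l', Cpx.d_comp_b, comp_zero, sub_zero]
    simp only [Category.assoc]
    rw [hl]
  have : IsIso (ShortComplex.homologyMap (Cpx.scMap S.f)) := isIso_of_mono_of_epi _
  let e := asIso (ShortComplex.homologyMap (Cpx.scMap S.f))
  exact ⟨e⟩

end ShortExact

end Homology

end IHall

namespace IHall

/-! ### Classes of complexes in the Grothendieck group -/

section Classes

variable {k : Type u'} [Field k] {A : Type u} [Category.{v} A] [Abelian A] [Linear k A]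
  {ρ : Involution k A}

theorem K0.cls_image {X Y : A} (f : X ⟶ Y) :
    K0.cls (Limits.image f) = K0.cls X - K0.cls (kernel f) := by
  have hS : (ShortComplex.mk (kernel.ι f) (factorThruImage f) (by
      rw [← cancel_mono (Limits.image.ι f)]; simp)).ShortExact :=
    { exact := by
        rw [ShortComplex.exact_iff_exact_up_to_refinements]
        intro T x hx
        dsimp at x hx ⊢
        have hx' : x ≫ f = 0 := by rw [← Limits.image.fac f, reassoc_of% hx, zero_comp]
        exact ⟨T, 𝟙 T, inferInstance, kernel.lift f x hx', by simp⟩ }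
  rw [K0.cls_of_shortExact hS, add_sub_cancel_left]

namespace Cpx

theorem imCls_eq (M : Cpx ρ) : M.imCls = K0.cls M.X - K0.cls M.ss.cycles := by
  rw [imCls, K0.cls_image, K0.cls_congr M.ss.cyclesIsoKernel]

theorem imCls_congr {M N : Cpx ρ} (e : M ≅ N) : M.imCls = N.imCls := by
  rw [imCls_eq, imCls_eq, K0.cls_congr (ShortComplex.cyclesMapIso (scIso e)),
    K0.cls_congr (show M.X ≅ N.X from (res ρ).mapIso e)]

/-- The boundaries are the image of ϱ(d) followed by ϱ² ≅ Id, so their class is ϱ of the class of Im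
d. Thus homology and image class determine the class of the underlying object. -/
theorem cls_cycles (M : Cpx ρ) :
    K0.cls M.ss.cycles = K0.cls M.homology + K0.rho ρ M.imCls := by
  have hS : (ShortComplex.mk (Limits.image.ι M.ss.toCycles) M.ss.homologyπ (by
      rw [← cancel_epi (factorThruImage M.ss.toCycles)]; simp)).ShortExact :=
    { exact := by
        rw [ShortComplex.exact_iff_exact_up_to_refinements]
        intro T x hx
        dsimp at x hx
        obtain ⟨T', π, hπ, y, hy⟩ :=
          (ShortComplex.comp_homologyπ_eq_zero_iff_up_to_refinements (S := M.ss) x).1 hx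
        exact ⟨T', π, hπ, y ≫ factorThruImage M.ss.toCycles, by simpa using hy⟩ }
  have h := K0.cls_of_shortExact hS
  dsimp only at h
  have e : kernel M.ss.toCycles ≅ ρ.functor.obj (kernel M.d) :=
    (kernelCompMono M.ss.toCycles M.ss.iCycles).symm ≪≫ kernelIsoOfEq M.ss.toCycles_i ≪≫
      kernelCompMono (ρ.functor.map M.d) (ρ.sq.hom.app M.X) ≪≫ (PreservesKernel.iso _ _).symm
  rw [K0.cls_image, K0.cls_congr e, ← K0.rho_cls, ← K0.rho_cls, ← map_sub,
    ← K0.cls_image M.d] at h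
  rw [h, add_comm]
  rfl

/-- The class of the underlying object of a complex. -/
theorem cls_X (M : Cpx ρ) :
    K0.cls M.X = K0.cls M.homology + K0.rho ρ M.imCls + M.imCls := by
  rw [← cls_cycles, imCls_eq, add_sub_cancel]

theorem IsAcyclic.cls_cycles {M : Cpx ρ} (h : M.IsAcyclic) :
    K0.cls M.ss.cycles = K0.rho ρ M.imCls := by
  rw [Cpx.cls_cycles, K0.cls_eq_zero h, zero_add]

theorem cls_opcycles (M : Cpx ρ) :
    K0.cls M.ss.opcycles = K0.cls M.homology + M.imCls := by
  have hS : (ShortComplex.mk (Limits.image.ι M.b) M.ss.pOpcycles (by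
      rw [← cancel_epi (factorThruImage M.b), image.fac_assoc, comp_zero]
      exact M.ss.f_pOpcycles)).ShortExact :=
    { exact := by
        rw [ShortComplex.exact_iff_exact_up_to_refinements]
        intro T x hx
        dsimp at x hx
        obtain ⟨T', π, hπ, y, hy⟩ :=
          (ShortComplex.comp_pOpcycles_eq_zero_iff_up_to_refinements (S := M.ss) x).1 hx
        exact ⟨T', π, hπ, y ≫ factorThruImage M.b, by simpa using hy⟩ }
  have h := K0.cls_of_shortExact hS
  dsimp only at h
  have e : kernel M.b ≅ ρ.functor.obj (kernel M.d) :=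
      kernelCompMono (ρ.functor.map M.d) (ρ.sq.hom.app M.X) ≪≫ (PreservesKernel.iso _ _).symm
  rw [K0.cls_image, K0.cls_congr e, ← K0.rho_cls, ← K0.rho_cls, ← map_sub,
    ← K0.cls_image M.d, cls_X M] at h
  have h' : K0.rho ρ (K0.cls (Limits.image M.d)) = K0.rho ρ M.imCls := rfl
  rw [h', add_right_comm, add_comm _ (K0.rho ρ M.imCls)] at h
  exact (add_left_cancel h).symm

theorem IsAcyclic.cls_opcycles {M : Cpx ρ} (h : M.IsAcyclic) :
    K0.cls M.ss.opcycles = M.imCls := by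
  rw [Cpx.cls_opcycles, K0.cls_eq_zero h, zero_add]

/-! The stalk complexes and the complexes `K_X`. -/

/-- The homology of a stalk complex. -/
def homologyStalk (X : A) : (stalk ρ X).homology ≅ X :=
  ((ShortComplex.HomologyData.ofZeros (stalk ρ X).sc (by
      change ρ.functor.map (0 : X ⟶ ρ.functor.obj X) ≫ ρ.sq.hom.app X = 0
      rw [Functor.map_zero, zero_comp]) rfl).left.homologyIso)

theorem imCls_stalk (X : A) : (stalk ρ X).imCls = 0 := by
  rw [imCls]
  refine K0.cls_eq_zero ?_
  exact IsZero.of_iso (isZero_zero A) (Limits.imageZero (X := X) (Y := ρ.functor.obj X))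

theorem kk_b_eq (X : A) : (kk ρ X).b =
    ρ.functor.map biprod.fst ≫ biprod.inr (X := X) (Y := ρ.functor.obj X) := by
  have h := ρ.sq.hom.naturality (biprod.inr : ρ.functor.obj X ⟶ X ⊞ ρ.functor.obj X)
  simp only [Functor.comp_map, Functor.id_map] at h
  simp only [b, kk, Functor.map_comp, Category.assoc]
  rw [h, ← ρ.map_sq, ← ρ.functor.map_comp_assoc (ρ.sq.inv.app X)]
  simp

theorem kk_isAcyclic (X : A) : (kk ρ X).IsAcyclic := by
  rw [isAcyclic_iff, ShortComplex.exact_iff_exact_up_to_refinements]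
  intro T (x : T ⟶ X ⊞ ρ.functor.obj X) (hx : x ≫ biprod.fst ≫ ρ.sq.inv.app X ≫ _ = 0)
  have h₁ : x ≫ biprod.fst = 0 := by
    rw [← cancel_mono (ρ.sq.inv.app X), ← cancel_mono (ρ.functor.map
      (biprod.inr : ρ.functor.obj X ⟶ X ⊞ ρ.functor.obj X))]
    rw [zero_comp, zero_comp, Category.assoc, Category.assoc]
    exact hx
  have h₂ : x = (x ≫ biprod.snd ≫ ρ.functor.map biprod.inl) ≫
      ρ.functor.map (biprod.fst : X ⊞ ρ.functor.obj X ⟶ X) ≫ (biprod.inr : ρ.functor.obj X ⟶ X ⊞ ρ.functor.obj X) := by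
    rw [Category.assoc, Category.assoc, ← ρ.functor.map_comp_assoc]
    refine biprod.hom_ext _ _ ?_ ?_
    · simpa using h₁
    · simp
  exact ⟨T, 𝟙 T, inferInstance, x ≫ biprod.snd ≫ ρ.functor.map biprod.inl,
    (Category.id_comp x).trans (h₂.trans (_ ≫= (kk_b_eq X).symm))⟩

theorem imCls_kk (X : A) : (kk ρ X).imCls = K0.cls X := by
  have hm : Mono (ρ.sq.inv.app X ≫ ρ.functor.map
      (biprod.inr : ρ.functor.obj X ⟶ X ⊞ ρ.functor.obj X)) := inferInstance
  rw [imCls, K0.cls_image]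
  have e : kernel (kk ρ X).d ≅ ρ.functor.obj X :=
    kernelCompMono (biprod.fst : X ⊞ ρ.functor.obj X ⟶ X) (ρ.sq.inv.app X ≫ ρ.functor.map
      (biprod.inr : ρ.functor.obj X ⟶ X ⊞ ρ.functor.obj X)) ≪≫ kernelBiprodFstIso
  rw [K0.cls_congr e]
  change K0.cls (X ⊞ ρ.functor.obj X) - _ = _
  rw [K0.cls_biprod, add_sub_cancel_right]

/-- The canonical epimorphism from an acyclic complex. -/
def fromKk (M : Cpx ρ) : kk ρ M.X ⟶ M :=
  mkHom (biprod.desc (𝟙 M.X) M.b) (by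
    refine biprod.hom_ext' _ _ ?_ ?_
    · simp only [kk, Category.assoc, biprod.inl_fst_assoc, biprod.inl_desc_assoc]
      rw [← Functor.map_comp, biprod.inr_desc, map_b]
      simp
    · simp only [kk, Category.assoc, biprod.inr_fst_assoc, biprod.inr_desc_assoc, zero_comp]
      rw [← M.b_comp_d, b, Category.assoc])

instance (M : Cpx ρ) : Epi (fromKk M) := by
  have : Epi (biprod.desc (𝟙 M.X) M.b) := epi_of_epi_fac (biprod.inl_desc (𝟙 M.X) M.b)
  have : Epi ((res ρ).map (fromKk M)) := this
  exact (res ρ).epi_of_epi_map this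

/-- The canonical monomorphism to an acyclic complex. -/
def toKk (M : Cpx ρ) : M ⟶ kk ρ (ρ.functor.obj M.X) :=
  mkHom (biprod.lift M.d (ρ.sq.inv.app M.X)) (by
    have h : ρ.functor.map (ρ.sq.inv.app M.X) = ρ.sq.inv.app (ρ.functor.obj M.X) := by
      rw [← cancel_mono (ρ.sq.hom.app (ρ.functor.obj M.X)), ← ρ.map_sq,
        ← Functor.map_comp]
      simp [ρ.map_sq]
    simp only [kk]
    rw [biprod.lift_fst_assoc, biprod.lift_eq, Functor.map_add, Functor.map_comp, Functor.map_comp,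
      Preadditive.comp_add, reassoc_of% M.d_comp_d, zero_comp, zero_add, h])

instance (M : Cpx ρ) : Mono (toKk M) := by
  have : Mono (biprod.lift M.d (ρ.sq.inv.app M.X)) :=
    mono_of_mono_fac (h := ρ.sq.inv.app M.X) (biprod.lift_snd M.d (ρ.sq.inv.app M.X))
  have : Mono ((res ρ).map (toKk M)) := this
  exact (res ρ).mono_of_mono_map this

end Cpx

section ShortExact

variable {S : ShortComplex (Cpx ρ)} (hS : S.ShortExact)

include hS

/-- The class of Im d is that of the object minus that of the cycles. It is additive only where the
sequence of cycles is exact, hence the acyclicity assumption. -/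
theorem imCls_of_shortExact (h : S.X₁.IsAcyclic ∨ S.X₃.IsAcyclic) :
    S.X₂.imCls = S.X₁.imCls + S.X₃.imCls := by
  have h₁ := K0.cls_of_shortExact (shortExact_cycles hS h)
  have h₂ := K0.cls_of_shortExact (shortExact_res hS)
  dsimp only at h₁ h₂
  rw [Cpx.imCls_eq, Cpx.imCls_eq, Cpx.imCls_eq, h₁, h₂]
  abel

theorem cls_X_of_shortExact : K0.cls S.X₂.X = K0.cls S.X₁.X + K0.cls S.X₃.X :=
  K0.cls_of_shortExact (shortExact_res hS)

theorem isAcyclic_X₁ (h₂ : S.X₂.IsAcyclic) (h₃ : S.X₃.IsAcyclic) : S.X₁.IsAcyclic :=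
  (nonempty_homologyIso_of_quot hS h₃).elim fun e => IsZero.of_iso h₂ e

theorem isAcyclic_X₃ (h₁ : S.X₁.IsAcyclic) (h₂ : S.X₂.IsAcyclic) : S.X₃.IsAcyclic :=
  (nonempty_homologyIso_of_sub hS h₁).elim fun e => IsZero.of_iso h₂ e.symm

end ShortExact

end Classes

end IHall

namespace IHall

/-! ### Extensions between stalk complexes and acyclic complexes -/

section StalkExt

variable {k : Type u'} [Field k] {A : Type u} [Category.{v} A] [Abelian A] [Linear k A]
  {ρ : Involution k A}

namespace Cpx

/-- A short complex of `ϱ`-complexes is exact if it is exact in the underlying category. -/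
theorem shortExact_of_res {S : ShortComplex (Cpx ρ)} (h : (S.map (res ρ)).ShortExact) :
    S.ShortExact where
  exact := (ShortComplex.exact_map_iff_of_faithful S (res ρ)).1 h.exact
  mono_f := (res ρ).mono_of_mono_map h.mono_f
  epi_g := (res ρ).epi_of_epi_map h.epi_g

variable (ρ) in
/-- The stalk complex, as a reducible definition. -/
abbrev st (X : A) : Cpx ρ := ⟨X, 0, by simp⟩

variable (ρ) in
/-- The functor sending an object to its stalk complex. -/
abbrev stF : A ⥤ Cpx ρ where
  obj := st ρ
  map f := mkHom (M := st ρ _) (N := st ρ _) f (by simp)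
  map_id _ := rfl
  map_comp _ _ := rfl

instance : (stF ρ).Additive where

theorem shortExact_st {S : ShortComplex A} (hS : S.ShortExact) : (S.map (stF ρ)).ShortExact :=
  shortExact_of_res hS

theorem stF_preservesFinite : PreservesFiniteLimits (stF ρ) ∧ PreservesFiniteColimits (stF ρ) :=
  ((stF ρ).exact_tfae.out 0 3).1 fun _ hS => shortExact_st hS

instance : PreservesFiniteLimits (stF ρ) := stF_preservesFinite.1
instance : PreservesFiniteColimits (stF ρ) := stF_preservesFinite.2

/-- The inclusion of the cycles. -/
def cyclesHom (K : Cpx ρ) : st ρ K.ss.cycles ⟶ K :=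
  mkHom (M := st ρ K.ss.cycles) K.ss.iCycles
    (zero_comp.trans K.ss.iCycles_g.symm)

/-- The projection to the cokernel of the differential. -/
def opcyclesHom (K : Cpx ρ) : K ⟶ st ρ K.ss.opcycles :=
  mkHom (N := st ρ K.ss.opcycles) K.ss.pOpcycles (by
    rw [← cancel_epi (ρ.sq.hom.app K.X), ← Category.assoc, ← map_b, ← Functor.map_comp,
      K.ss.f_pOpcycles, Functor.map_zero, comp_zero, comp_zero])

theorem st_comp_d {S : A} {K : Cpx ρ} (f : st ρ S ⟶ K) : f.f ≫ K.d = 0 := by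
  rw [← f.comm', zero_comp]

theorem b_comp_st {S : A} {K : Cpx ρ} (f : K ⟶ st ρ S) : K.b ≫ f.f = 0 := by
  rw [← map_comp_b f, b, Functor.map_zero, zero_comp, comp_zero]

/-- Morphisms from a stalk complex. -/
def homStEquiv (S : A) (K : Cpx ρ) : (st ρ S ⟶ K) ≃ (S ⟶ K.ss.cycles) where
  toFun f := K.ss.liftCycles f.f (st_comp_d f)
  invFun g := (stF ρ).map g ≫ cyclesHom K
  left_inv f := hom_ext (K.ss.liftCycles_i f.f (st_comp_d f))
  right_inv g := by
    rw [← cancel_mono K.ss.iCycles, ShortComplex.liftCycles_i]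
    rfl

/-- Morphisms to a stalk complex. -/
def stHomEquiv (S : A) (K : Cpx ρ) : (K ⟶ st ρ S) ≃ (K.ss.opcycles ⟶ S) where
  toFun f := K.ss.descOpcycles f.f (b_comp_st f)
  invFun g := opcyclesHom K ≫ (stF ρ).map g
  left_inv f := hom_ext (K.ss.p_descOpcycles f.f (b_comp_st f))
  right_inv g := by
    rw [← cancel_epi K.ss.pOpcycles, ShortComplex.p_descOpcycles]
    rfl

theorem shortExact_comp_iso {S : ShortComplex A} (hS : S.ShortExact) {Y : A} (e : S.X₃ ≅ Y) :
    (ShortComplex.mk S.f (S.g ≫ e.hom) (by simp)).ShortExact :=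
  ShortComplex.shortExact_of_iso (S₁ := S) (ShortComplex.isoMk (Iso.refl _) (Iso.refl _) e) hS

theorem shortExact_iso_comp {S : ShortComplex A} (hS : S.ShortExact) {Y : A} (e : Y ≅ S.X₁) :
    (ShortComplex.mk (e.hom ≫ S.f) S.g (by simp)).ShortExact :=
  ShortComplex.shortExact_of_iso (ShortComplex.isoMk e.symm (Iso.refl _) (Iso.refl _)) hS

/-- A stalk complex is its own cycles, so the sequence of cycles of an extension of a stalk complex
by K is an extension of S by the cycles of K. -/
theorem shortExact_cycles_st {K L : Cpx ρ} {S : A} {i : K ⟶ L} {p : L ⟶ st ρ S} {z : i ≫ p = 0}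
    (hS : (ShortComplex.mk i p z).ShortExact) (h : K.IsAcyclic) :
    ∃ z', (ShortComplex.mk (ShortComplex.cyclesMap (scMap i)) (L.ss.iCycles ≫ p.f)
      z').ShortExact := by
  have : IsIso (st ρ S).ss.iCycles := ShortComplex.isIso_iCycles _ rfl
  have h₁ := shortExact_comp_iso (shortExact_cycles hS (Or.inl h)) (asIso (st ρ S).ss.iCycles)
  have h₂ : ShortComplex.cyclesMap (scMap p) ≫ (st ρ S).ss.iCycles = L.ss.iCycles ≫ p.f :=
    ShortComplex.cyclesMap_i _
  dsimp only [asIso_hom] at h₁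
  rw! [h₂] at h₁
  exact ⟨_, h₁⟩

theorem shortExact_st_opcycles {K L : Cpx ρ} {S : A} {i : st ρ S ⟶ L} {p : L ⟶ K} {z : i ≫ p = 0}
    (hS : (ShortComplex.mk i p z).ShortExact) (h : K.IsAcyclic) :
    ∃ z', (ShortComplex.mk (i.f ≫ L.ss.pOpcycles) (ShortComplex.opcyclesMap (scMap p))
      z').ShortExact := by
  have : IsIso (st ρ S).ss.pOpcycles := ShortComplex.isIso_pOpcycles _ (by
    change ρ.functor.map (0 : S ⟶ _) ≫ _ = 0
    rw [Functor.map_zero, zero_comp])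
  have h₁ := shortExact_iso_comp (shortExact_opcycles hS h) (asIso (st ρ S).ss.pOpcycles)
  have h₂ : (st ρ S).ss.pOpcycles ≫ ShortComplex.opcyclesMap (scMap i) = i.f ≫ L.ss.pOpcycles :=
    ShortComplex.p_opcyclesMap _
  dsimp only [asIso_hom] at h₁
  rw! [h₂] at h₁
  exact ⟨_, h₁⟩

variable [HasExt.{w} A] [HasExt.{w'} (Cpx ρ)]

/-- The comparison of extensions of `S` by the cycles of `K` with extensions of the stalk complex
by `K`. -/
def extSt (S : A) (K : Cpx ρ) : Ext S K.ss.cycles 1 →+ Ext (st ρ S) K 1 :=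
  ((Ext.mk₀ (cyclesHom K)).postcomp (st ρ S) (add_zero 1)).comp ((stF ρ).mapExtAddHom S _ 1)

theorem extSt_apply {S : A} {K : Cpx ρ} (x : Ext S K.ss.cycles 1) :
    extSt S K x = (x.mapExactFunctor (stF ρ)).comp (Ext.mk₀ (cyclesHom K)) (add_zero 1) := rfl

/-- The comparison of extensions of `Q_K` by `S` with extensions of `K` by the stalk complex. -/
def stExt (S : A) (K : Cpx ρ) : Ext K.ss.opcycles S 1 →+ Ext K (st ρ S) 1 :=
  ((Ext.mk₀ (opcyclesHom K)).precomp (st ρ S) (zero_add 1)).comp ((stF ρ).mapExtAddHom _ S 1)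

theorem stExt_apply {S : A} {K : Cpx ρ} (x : Ext K.ss.opcycles S 1) :
    stExt S K x = (Ext.mk₀ (opcyclesHom K)).comp (x.mapExactFunctor (stF ρ)) (zero_add 1) := rfl

/-- If the comparison kills an extension E, then the inclusion of the cycles extends to a map from
the stalk complex of E to K. Such a map lands in the cycles, so it is a retraction. -/
theorem extSt_injective (S : A) (K : Cpx ρ) : Function.Injective (extSt S K) := by
  rw [injective_iff_map_eq_zero]
  intro x hx
  obtain ⟨E, i, p, z, hS, rfl⟩ := exists_extClass_eq x
  rw [extSt_apply, Ext.mapExactFunctor_extClass] at hx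
  obtain ⟨f, hf⟩ := exists_desc_of_extClass_comp _ _ hx
  refine extClass_eq_zero_of_retraction hS (homStEquiv E K f) ?_
  rw [← cancel_mono K.ss.iCycles, Category.assoc, Category.id_comp]
  exact (i ≫= K.ss.liftCycles_i f.f (st_comp_d f)).trans (congrArg Hom.f hf)

/-- Dually, a map from K to a stalk complex factors through the cokernel of ϱ K ⟶ K, which yields a
section. -/
theorem stExt_injective (S : A) (K : Cpx ρ) : Function.Injective (stExt S K) := by
  rw [injective_iff_map_eq_zero]
  intro x hx
  obtain ⟨E, i, p, z, hS, rfl⟩ := exists_extClass_eq x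
  rw [stExt_apply, Ext.mapExactFunctor_extClass] at hx
  obtain ⟨f, hf⟩ : ∃ f : K ⟶ st ρ E, f ≫ (stF ρ).map p = opcyclesHom K :=
    exists_lift_of_comp_extClass (S := (ShortComplex.mk i p z).map (stF ρ)) (shortExact_st hS)
      (opcyclesHom K) hx
  have hf' : f.f ≫ p = K.ss.pOpcycles := congrArg Hom.f hf
  refine extClass_eq_zero_of_section hS (K.ss.descOpcycles f.f (b_comp_st f)) ?_
  dsimp only
  rw [← cancel_epi K.ss.pOpcycles, ← Category.assoc, Category.comp_id, K.ss.p_descOpcycles, hf']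

/-- An extension of a stalk complex by an acyclic K is the pushout of its own sequence of cycles
along the inclusion of the cycles of K. -/
theorem extSt_surjective (S : A) {K : Cpx ρ} (h : K.IsAcyclic) :
    Function.Surjective (extSt S K) := by
  intro y
  obtain ⟨L, i, p, z, hS, rfl⟩ := exists_extClass_eq y
  obtain ⟨z', hZ⟩ := shortExact_cycles_st hS h
  refine ⟨hZ.extClass, ?_⟩
  let φ : (ShortComplex.mk _ _ z').map (stF ρ) ⟶ ShortComplex.mk i p z :=
    { τ₁ := cyclesHom K
      τ₂ := cyclesHom L
      τ₃ := 𝟙 _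
      comm₁₂ := hom_ext (ShortComplex.cyclesMap_i (scMap i)).symm
      comm₂₃ := hom_ext (Category.comp_id _).symm }
  have := ShortComplex.ShortExact.extClass_naturality (shortExact_st hZ) hS φ
  rw [extSt_apply, Ext.mapExactFunctor_extClass]
  exact this.trans (Ext.mk₀_id_comp _)

/-- Dually, the extension is the pullback of its sequence of cokernels `opcycles` along `opcyclesHom
K`. -/
theorem stExt_surjective (S : A) {K : Cpx ρ} (h : K.IsAcyclic) :
    Function.Surjective (stExt S K) := by
  intro y
  obtain ⟨L, i, p, z, hS, rfl⟩ := exists_extClass_eq y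
  obtain ⟨z', hZ⟩ := shortExact_st_opcycles hS h
  refine ⟨hZ.extClass, ?_⟩
  let φ : ShortComplex.mk i p z ⟶ (ShortComplex.mk _ _ z').map (stF ρ) :=
    { τ₁ := 𝟙 _
      τ₂ := opcyclesHom L
      τ₃ := opcyclesHom K
      comm₁₂ := hom_ext (Category.id_comp _)
      comm₂₃ := hom_ext (ShortComplex.p_opcyclesMap (scMap p)) }
  have := ShortComplex.ShortExact.extClass_naturality hS (shortExact_st hZ) φ
  rw [stExt_apply, Ext.mapExactFunctor_extClass]
  exact this.symm.trans (Ext.comp_mk₀_id _)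

theorem extSt_comp {S : A} {K L : Cpx ρ} (f : K ⟶ L) (x : Ext S K.ss.cycles 1) :
    extSt S L (x.comp (Ext.mk₀ (ShortComplex.cyclesMap (scMap f))) (add_zero 1)) =
      (extSt S K x).comp (Ext.mk₀ f) (add_zero 1) := by
  have h : (stF ρ).map (ShortComplex.cyclesMap (scMap f)) ≫ cyclesHom L = cyclesHom K ≫ f :=
    hom_ext (ShortComplex.cyclesMap_i (scMap f))
  rw [extSt_apply, extSt_apply, Ext.mapExactFunctor_comp, Ext.mapExactFunctor_mk₀,
    Ext.comp_assoc_of_second_deg_zero, Ext.comp_assoc_of_second_deg_zero, Ext.mk₀_comp_mk₀,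
    Ext.mk₀_comp_mk₀, h]

theorem comp_stExt {S : A} {K L : Cpx ρ} (f : L ⟶ K) (x : Ext K.ss.opcycles S 1) :
    stExt S L ((Ext.mk₀ (ShortComplex.opcyclesMap (scMap f))).comp x (zero_add 1)) =
      (Ext.mk₀ f).comp (stExt S K x) (zero_add 1) := by
  have h : opcyclesHom L ≫ (stF ρ).map (ShortComplex.opcyclesMap (scMap f)) = f ≫ opcyclesHom K :=
    hom_ext (ShortComplex.p_opcyclesMap (scMap f))
  rw [stExt_apply, stExt_apply, Ext.mapExactFunctor_comp, Ext.mapExactFunctor_mk₀,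
    Ext.mk₀_comp_mk₀_assoc, Ext.mk₀_comp_mk₀_assoc, h]

variable [FiniteHereditary A]

/-- Ext² vanishes in A, so `y` lifts to the cycles of the middle complex. Hence its image among
complexes lifts to the middle term and is killed by the connecting map. -/
theorem extSt_comp_extClass {S : ShortComplex (Cpx ρ)} (hS : S.ShortExact) (h : S.X₁.IsAcyclic)
    (T : A) (y : Ext T S.X₃.ss.cycles 1) :
    (extSt T S.X₃ y).comp hS.extClass (show 1 + 1 = 2 from rfl) = 0 := by
  obtain ⟨y, rfl⟩ := ext_one_postcomp_surjective (shortExact_cycles hS (Or.inl h))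
    (FiniteHereditary.ext_two _ _) y
  refine (congrArg (fun t => Ext.comp t hS.extClass (show 1 + 1 = 2 from rfl))
    (extSt_comp S.g y)).trans ?_
  rw [Ext.comp_assoc (a₂₃ := 1) _ _ _ _ (zero_add 1) (by rfl), hS.comp_extClass, Ext.comp_zero]

theorem extClass_comp_stExt {S : ShortComplex (Cpx ρ)} (hS : S.ShortExact) (h : S.X₃.IsAcyclic)
    (T : A) (y : Ext S.X₁.ss.opcycles T 1) :
    hS.extClass.comp (stExt T S.X₁ y) (show 1 + 1 = 2 from rfl) = 0 := by
  obtain ⟨y, rfl⟩ := ext_one_precomp_surjective (shortExact_opcycles hS h)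
    (FiniteHereditary.ext_two _ _) y
  exact (congrArg (fun t => Ext.comp hS.extClass t (show 1 + 1 = 2 from rfl))
    (comp_stExt S.f y)).trans (hS.extClass_comp_assoc _)

/-- Efface `x` by a monomorphism and enlarge its target to an acyclic complex. The cokernel R is
then acyclic too, so `x` is a connecting image of a class in Ext¹(S, R), which comes from A and
dies. -/
theorem ext_two_st (S : A) {K : Cpx ρ} (h : K.IsAcyclic) (x : Ext (st ρ S) K 2) : x = 0 := by
  obtain ⟨I, i, hi, hx⟩ := exists_mono_comp_eq_zero x
  have hS : (ShortComplex.mk (i ≫ toKk I) (cokernel.π (i ≫ toKk I))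
      (cokernel.condition _)).ShortExact :=
    { exact := ShortComplex.exact_cokernel _ }
  have hR := isAcyclic_X₃ hS h (kk_isAcyclic _)
  obtain ⟨y, rfl⟩ := Ext.covariant_sequence_exact₁ _ hS x (by
    rw [← Ext.mk₀_comp_mk₀, ← Ext.comp_assoc_of_second_deg_zero, hx, Ext.zero_comp]) (n₀ := 1) rfl
  obtain ⟨y, rfl⟩ := extSt_surjective S hR y
  exact extSt_comp_extClass hS h S y

theorem st_ext_two (S : A) {K : Cpx ρ} (h : K.IsAcyclic) (x : Ext K (st ρ S) 2) : x = 0 := by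
  obtain ⟨P, p, hp, hx⟩ := exists_epi_comp_eq_zero (by simp) x
  have hS : (ShortComplex.mk (kernel.ι (fromKk P ≫ p)) (fromKk P ≫ p)
      (kernel.condition _)).ShortExact :=
    { exact := ShortComplex.exact_kernel _ }
  have hR := isAcyclic_X₁ hS (kk_isAcyclic _) h
  obtain ⟨y, rfl⟩ := Ext.contravariant_sequence_exact₃ hS _ x (by
    rw [← Ext.mk₀_comp_mk₀_assoc, hx, Ext.comp_zero]) (n₀ := 1) rfl
  obtain ⟨y, rfl⟩ := stExt_surjective S hR y
  exact extClass_comp_stExt hS h S y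

end Cpx

end StalkExt

end IHall

namespace IHall

/-! ### Euler characteristics of complexes relative to acyclic complexes -/

theorem finite_of_exact {X Y Z : Type*} [AddGroup X] [AddGroup Y] [AddGroup Z] [Finite X]
    [Finite Z] (f : X →+ Y) (g : Y →+ Z) (h : ∀ y, g y = 0 → ∃ x, f x = y) : Finite Y := by
  refine Set.finite_univ_iff.1 (Set.Finite.preimage' (f := g) Set.finite_univ fun z _ => ?_)
  by_cases hz : ∃ y, g y = z
  · obtain ⟨y, rfl⟩ := hz
    refine (Set.finite_range fun x => f x + y).subset fun y' hy' => ?_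
    obtain ⟨x, hx⟩ := h (y' - y) (by rw [map_sub, sub_eq_zero]; exact hy')
    exact ⟨x, by simp [hx]⟩
  · exact Set.Finite.subset Set.finite_empty fun y hy => hz ⟨y, hy⟩

section AcyclicExt

variable {k : Type u'} [Field k] {A : Type u} [Category.{v} A] [Abelian A] [Linear k A]
  {ρ : Involution k A}

namespace Cpx

/-- The projection of a complex to its coimage. -/
def coimHom (N : Cpx ρ) : N ⟶ st ρ (cokernel N.ss.iCycles) :=
  mkHom (N := st ρ (cokernel N.ss.iCycles)) (cokernel.π N.ss.iCycles) (by
    have h : N.b ≫ cokernel.π N.ss.iCycles = 0 := by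
      have h' : N.ss.toCycles ≫ N.ss.iCycles = N.b := N.ss.toCycles_i
      rw [← h', Category.assoc, cokernel.condition, comp_zero]
    rw [← cancel_epi (ρ.sq.hom.app N.X), ← Category.assoc, ← map_b, ← Functor.map_comp, h,
      Functor.map_zero, comp_zero, comp_zero])

theorem shortExact_iCycles (N : Cpx ρ) : (ShortComplex.mk N.ss.iCycles (cokernel.π N.ss.iCycles)
    (cokernel.condition _)).ShortExact :=
  { exact := ShortComplex.exact_cokernel _ }

/-- Every complex is an extension of one stalk complex by another, so questions about Ext against an
acyclic complex reduce to stalk complexes. -/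
theorem shortExact_coimHom (N : Cpx ρ) : (ShortComplex.mk (cyclesHom N) (coimHom N)
    (hom_ext (cokernel.condition _))).ShortExact :=
  shortExact_of_res N.shortExact_iCycles

variable [HasExt.{w} A] [HasExt.{w'} (Cpx ρ)] [FiniteHereditary A]

theorem ext_two_right {K : Cpx ρ} (h : K.IsAcyclic) (N : Cpx ρ) (x : Ext N K 2) : x = 0 := by
  obtain ⟨y, rfl⟩ := Ext.contravariant_sequence_exact₂ N.shortExact_coimHom K x
    (ext_two_st _ h _)
  rw [ext_two_st _ h y, Ext.comp_zero]

theorem ext_two_left {K : Cpx ρ} (h : K.IsAcyclic) (N : Cpx ρ) (x : Ext K N 2) : x = 0 := by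
  obtain ⟨y, rfl⟩ := Ext.covariant_sequence_exact₂ K N.shortExact_coimHom x
    (st_ext_two _ h _)
  rw [st_ext_two _ h y, Ext.zero_comp]

instance (M N : Cpx ρ) : Finite (M ⟶ N) :=
  Finite.of_injective (fun f : M ⟶ N => f.f) fun _ _ => hom_ext

theorem finite_ext_st (S : A) {K : Cpx ρ} (h : K.IsAcyclic) : Finite (Ext (st ρ S) K 1) :=
  Finite.of_surjective _ (extSt_surjective S h)

theorem finite_ext_right (N : Cpx ρ) {K : Cpx ρ} (h : K.IsAcyclic) : Finite (Ext N K 1) := by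
  have := finite_ext_st N.ss.cycles h
  have := finite_ext_st (cokernel N.ss.iCycles) h
  exact finite_of_exact ((Ext.mk₀ (coimHom N)).precomp K (zero_add 1))
    ((Ext.mk₀ (cyclesHom N)).precomp K (zero_add 1))
    fun y hy => Ext.contravariant_sequence_exact₂ N.shortExact_coimHom K y hy

/-- Embedding M in an acyclic complex squeezes Ext¹(N, M) between a Hom group and an Ext¹ group with
acyclic second argument, both finite. -/
instance finite_ext_one (N M : Cpx ρ) : Finite (Ext N M 1) := by
  have hS : (ShortComplex.mk (toKk M) (cokernel.π (toKk M)) (cokernel.condition _)).ShortExact :=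
    { exact := ShortComplex.exact_cokernel _ }
  have := finite_ext_right N (kk_isAcyclic (ρ := ρ) (ρ.functor.obj M.X))
  have : Finite (Ext N (cokernel (toKk M)) 0) := Finite.of_equiv _ Ext.homEquiv₀.symm
  exact finite_of_exact (hS.extClass.postcomp N (zero_add 1))
    ((Ext.mk₀ (toKk M)).postcomp N (add_zero 1))
    fun y hy => Ext.covariant_sequence_exact₁ N hS y hy rfl

omit [FiniteHereditary A] in
theorem chi_st (S : A) {K : Cpx ρ} (h : K.IsAcyclic) : chi (st ρ S) K = chi S K.ss.cycles := by
  rw [chi, chi, Nat.card_congr (homStEquiv S K),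
    Nat.card_congr (Equiv.ofBijective _ ⟨extSt_injective S K, extSt_surjective S h⟩)]

omit [FiniteHereditary A] in
theorem st_chi (S : A) {K : Cpx ρ} (h : K.IsAcyclic) : chi K (st ρ S) = chi K.ss.opcycles S := by
  rw [chi, chi, Nat.card_congr (stHomEquiv S K),
    Nat.card_congr (Equiv.ofBijective _ ⟨stExt_injective S K, stExt_surjective S h⟩)]

/-- Both sides are multiplicative along the sequence cycles, N, coimage: on complexes because Ext²
into K vanishes, in A because A is hereditary. -/
theorem chi_right (N : Cpx ρ) {K : Cpx ρ} (h : K.IsAcyclic) : chi N K = chi N.X K.ss.cycles := by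
  have h₁ := chi_left_mul K N.shortExact_coimHom (ext_two_st _ h)
  have h₂ := chi_left_mul K.ss.cycles N.shortExact_iCycles (FiniteHereditary.ext_two _ _)
  dsimp only at h₁ h₂
  rw [h₁, h₂, chi_st _ h, chi_st _ h]

theorem chi_left (N : Cpx ρ) {K : Cpx ρ} (h : K.IsAcyclic) : chi K N = chi K.ss.opcycles N.X := by
  have h₁ := chi_right_mul K N.shortExact_coimHom (st_ext_two _ h)
  have h₂ := chi_right_mul K.ss.opcycles N.shortExact_iCycles (FiniteHereditary.ext_two _ _)
  dsimp only at h₁ h₂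
  rw [h₁, h₂, st_chi _ h, st_chi _ h]

variable [Finite k]

theorem chi_right_eq_zpow (N : Cpx ρ) {K : Cpx ρ} (h : K.IsAcyclic) :
    chi N K = (Nat.card k : ℚ) ^ eulerK A k (K0.cls N.X) (K0.rho ρ K.imCls) := by
  rw [chi_right N h, chi_eq_zpow k, ← eulerK_cls, h.cls_cycles]

theorem chi_left_eq_zpow (N : Cpx ρ) {K : Cpx ρ} (h : K.IsAcyclic) :
    chi K N = (Nat.card k : ℚ) ^ eulerK A k K.imCls (K0.cls N.X) := by
  rw [chi_left N h, chi_eq_zpow k, ← eulerK_cls, h.cls_opcycles]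

end Cpx

end AcyclicExt

end IHall

namespace IHall

/-! ### Extensions with given middle term -/

section MiddleTerms

variable {k : Type u'} [Field k] {A : Type u} [Category.{v} A] [Abelian A] [Linear k A]
  {ρ : Involution k A}

namespace Cpx

@[ext] theorem SES.ext' {M N L : Cpx ρ} {s t : SES M N L} (hi : s.i = t.i) (hp : s.p = t.p) :
    s = t := by
  cases s; cases t; cases hi; cases hp; rfl

/-- The short complex of an extension. -/
abbrev SES.sc {M N L : Cpx ρ} (s : SES M N L) : ShortComplex (Cpx ρ) :=
  ShortComplex.mk s.i s.p (hom_ext s.zero)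

theorem SES.sc_shortExact {M N L : Cpx ρ} (s : SES M N L) : s.sc.ShortExact :=
  shortExact_of_res s.shortExact

instance {M N L : Cpx ρ} (s : SES M N L) : Mono s.i := s.sc_shortExact.mono_f
instance {M N L : Cpx ρ} (s : SES M N L) : Epi s.p := s.sc_shortExact.epi_g

/-- The extension given by a short exact sequence. -/
def SES.ofShortExact {M N L : Cpx ρ} {i : N ⟶ L} {p : L ⟶ M} {z : i ≫ p = 0}
    (hS : (ShortComplex.mk i p z).ShortExact) : SES M N L where
  i := i
  p := p
  zero := congrArg Hom.f z
  shortExact := shortExact_res hS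

@[simp] theorem SES.ofShortExact_i {M N L : Cpx ρ} {i : N ⟶ L} {p : L ⟶ M} {z : i ≫ p = 0}
    (hS : (ShortComplex.mk i p z).ShortExact) : (SES.ofShortExact hS).i = i := rfl
@[simp] theorem SES.ofShortExact_p {M N L : Cpx ρ} {i : N ⟶ L} {p : L ⟶ M} {z : i ≫ p = 0}
    (hS : (ShortComplex.mk i p z).ShortExact) : (SES.ofShortExact hS).p = p := rfl

/-- Transport of extensions along isomorphisms. -/
def SES.congr {M N L M' N' L' : Cpx ρ} (a : M ≅ M') (b : N ≅ N') (l : L ≅ L') :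
    SES M N L ≃ SES M' N' L' where
  toFun s := SES.ofShortExact (i := b.inv ≫ s.i ≫ l.hom) (p := l.inv ≫ s.p ≫ a.hom)
    (z := by have := s.sc.zero; dsimp at this; simp [reassoc_of% this])
    (ShortComplex.shortExact_of_iso (S₁ := s.sc) (ShortComplex.isoMk b l a) s.sc_shortExact)
  invFun s := SES.ofShortExact (i := b.hom ≫ s.i ≫ l.inv) (p := l.hom ≫ s.p ≫ a.inv)
    (z := by have := s.sc.zero; dsimp at this; simp [reassoc_of% this])
    (ShortComplex.shortExact_of_iso (S₁ := s.sc) (ShortComplex.isoMk b.symm l.symm a.symm)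
      s.sc_shortExact)
  left_inv s := by ext1 <;> simp
  right_inv s := by ext1 <;> simp

theorem card_SES_congr {M N L M' N' L' : Cpx ρ} (a : M ≅ M') (b : N ≅ N') (l : L ≅ L') :
    Nat.card (SES M N L) = Nat.card (SES M' N' L') := Nat.card_congr (SES.congr a b l)

variable [HasExt.{w'} (Cpx ρ)]

/-- The class of an extension. -/
abbrev SES.cls {M N L : Cpx ρ} (s : SES M N L) : Ext M N 1 := s.sc_shortExact.extClass

/-- Derived Ext¹ agrees with Yoneda equivalence: equal classes give a morphism that is the identity
on both ends, invertible by the five lemma. -/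
theorem SES.cls_eq_iff {M N L L' : Cpx ρ} (s : SES M N L) (t : SES M N L') :
    s.cls = t.cls ↔ ∃ φ : L ≅ L', s.i ≫ φ.hom = t.i ∧ φ.hom ≫ t.p = s.p := by
  constructor
  · intro h
    obtain ⟨φ, h₁, h₂⟩ := exists_hom_of_extClass s.sc_shortExact t.sc_shortExact (𝟙 _) (𝟙 _)
      (by rw [Ext.comp_mk₀_id, Ext.mk₀_id_comp]; exact h)
    dsimp at φ h₁ h₂
    rw [Category.id_comp] at h₁
    rw [Category.comp_id] at h₂
    let f : s.sc ⟶ t.sc :=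
      { τ₁ := 𝟙 _, τ₂ := φ, τ₃ := 𝟙 _, comm₁₂ := by simp [h₁], comm₂₃ := by simp [h₂] }
    have : IsIso f.τ₁ := inferInstanceAs (IsIso (𝟙 N))
    have : IsIso f.τ₃ := inferInstanceAs (IsIso (𝟙 M))
    have : IsIso φ := ShortComplex.isIso₂_of_shortExact_of_isIso₁₃ f s.sc_shortExact
      t.sc_shortExact
    exact ⟨asIso φ, h₁, h₂⟩
  · rintro ⟨φ, h₁, h₂⟩
    let f : s.sc ⟶ t.sc :=
      { τ₁ := 𝟙 _, τ₂ := φ.hom, τ₃ := 𝟙 _, comm₁₂ := by simp [h₁], comm₂₃ := by simp [h₂] }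
    have := ShortComplex.ShortExact.extClass_naturality s.sc_shortExact t.sc_shortExact f
    exact (Ext.comp_mk₀_id _).symm.trans (this.trans (Ext.mk₀_id_comp _))

/-- The middle term of an extension class. -/
def mid {M N : Cpx ρ} (ξ : Ext M N 1) : Cpx ρ := (exists_extClass_eq ξ).choose

/-- A short exact sequence representing an extension class. -/
def midSES {M N : Cpx ρ} (ξ : Ext M N 1) : SES M N (mid ξ) :=
  SES.ofShortExact (exists_extClass_eq ξ).choose_spec.choose_spec.choose_spec.choose_spec.choose

theorem midSES_cls {M N : Cpx ρ} (ξ : Ext M N 1) : (midSES ξ).cls = ξ :=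
  (exists_extClass_eq ξ).choose_spec.choose_spec.choose_spec.choose_spec.choose_spec

theorem SES.nonempty_iso_mid {M N L : Cpx ρ} (s : SES M N L) : Nonempty (L ≅ mid s.cls) :=
  let ⟨φ, _⟩ := (s.cls_eq_iff (midSES s.cls)).1 (midSES_cls _).symm
  ⟨φ⟩

/-- Moves the Hall product from Yoneda classes to the groups `Ext`, where long exact sequences are
available. -/
theorem card_extMid (M N L : Cpx ρ) :
    Nat.card (ExtMid M N L) = Nat.card {ξ : Ext M N 1 // Nonempty (mid ξ ≅ L)} := by
  let f : ExtMid M N L → {ξ : Ext M N 1 // Nonempty (mid ξ ≅ L)} :=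
    Quotient.lift (fun s => ⟨s.cls, s.nonempty_iso_mid.map Iso.symm⟩)
      fun s t h => Subtype.ext ((s.cls_eq_iff t).2 h)
  refine Nat.card_congr (Equiv.ofBijective f ⟨?_, ?_⟩)
  · rintro ⟨s⟩ ⟨t⟩ h
    exact Quotient.sound ((s.cls_eq_iff t).1 (congrArg Subtype.val h))
  · rintro ⟨ξ, ⟨e⟩⟩
    refine ⟨Quotient.mk _ (SES.congr (Iso.refl M) (Iso.refl N) e (midSES ξ)), Subtype.ext ?_⟩
    refine Eq.trans ?_ (midSES_cls ξ)
    refine (SES.cls_eq_iff _ _).2 ⟨e.symm, ?_, ?_⟩ <;> simp [SES.congr]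

end Cpx

end MiddleTerms

end IHall

namespace IHall

/-! ### Structure constants of the Hall algebra -/

section StructureConstants

variable {k : Type u'} [Field k] {A : Type u} [Category.{v} A] [Abelian A] [Linear k A]
  {ρ : Involution k A}

attribute [local instance] Fintype.ofFinite

namespace Cpx

/-- The automorphism `1 + i g p` of the middle term of an extension. -/
def SES.shear {M N L : Cpx ρ} (s : SES M N L) (g : M ⟶ N) : L ≅ L where
  hom := 𝟙 L + s.p ≫ g ≫ s.i
  inv := 𝟙 L - s.p ≫ g ≫ s.i
  hom_inv_id := by
    have := s.sc.zero
    dsimp at this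
    simp [Preadditive.add_comp, Preadditive.comp_sub, reassoc_of% this]
  inv_hom_id := by
    have := s.sc.zero
    dsimp at this
    simp [Preadditive.sub_comp, Preadditive.comp_add, reassoc_of% this]

/-- The sets `SES(M, N, L) × Hom(M, N)` and `Ext¹(M, N)_L × Aut(L)` have the same size. -/
theorem card_extMid_mul_card_aut (M N L : Cpx ρ) :
    Nat.card (ExtMid M N L) * Nat.card (L ≅ L) = Nat.card (SES M N L) * Nat.card (M ⟶ N) := by
  -- `φ s` carries the chosen representative of the class of `s` to `s`. The bijection records the
  -- class and the automorphism `φ s` followed by a shear.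
  have hφ (s : SES M N L) : ∃ φ : L ≅ L, (Quotient.mk (sesSetoid M N L) s).out.i ≫ φ.hom = s.i ∧
      φ.hom ≫ s.p = (Quotient.mk (sesSetoid M N L) s).out.p := Quotient.mk_out s
  choose φ hi hp using hφ
  rw [← Nat.card_prod, ← Nat.card_prod]
  symm
  refine Nat.card_congr (Equiv.ofBijective
    (fun x : SES M N L × (M ⟶ N) => ((Quotient.mk (sesSetoid M N L) x.1 : ExtMid M N L),
      φ x.1 ≪≫ x.1.shear x.2)) ⟨?_, ?_⟩)
  · rintro ⟨s, g⟩ ⟨t, h⟩ hst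
    have h₁ : Quotient.mk (sesSetoid M N L) s = Quotient.mk (sesSetoid M N L) t :=
      congrArg Prod.fst hst
    have h₂ : φ s ≪≫ s.shear g = φ t ≪≫ t.shear h := congrArg Prod.snd hst
    have zs := s.sc.zero
    have zt := t.sc.zero
    dsimp at zs zt
    have h₃ : (Quotient.mk (sesSetoid M N L) s).out = (Quotient.mk (sesSetoid M N L) t).out :=
      congrArg Quotient.out h₁
    -- A shear fixes both maps of the extension, so they are recovered from the representative and
    -- the recorded automorphism.
    have e₁ : s = t := by
      refine SES.ext' ?_ ?_
      · have := congrArg (fun e => (Quotient.mk (sesSetoid M N L) s).out.i ≫ e.hom) h₂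
        conv_rhs at this => rw [h₃]
        simpa [SES.shear, hi s, hi t, reassoc_of% (hi s), reassoc_of% (hi t), reassoc_of% zs,
          reassoc_of% zt] using this
      · have := congrArg (fun e => e.inv ≫ (Quotient.mk (sesSetoid M N L) s).out.p) h₂
        conv_rhs at this => rw [h₃]
        rw [← hp s, ← hp t] at this
        simpa [SES.shear, Preadditive.sub_comp, zs, zt] using this
    subst e₁
    have e₂ : s.p ≫ g ≫ s.i = s.p ≫ h ≫ s.i := by
      have := congrArg Iso.hom h₂
      simpa [SES.shear] using this
    rw [cancel_epi, cancel_mono] at e₂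
    rw [e₂]
  · rintro ⟨c, ψ⟩
    let r : SES M N L := Quotient.out (s := sesSetoid M N L) c
    let s : SES M N L := SES.congr (Iso.refl M) (Iso.refl N) ψ r
    have hsi : r.i ≫ ψ.hom = s.i := by simp [s, SES.congr]
    have hsp : ψ.hom ≫ s.p = r.p := by simp [s, SES.congr]
    have hc : Quotient.mk (sesSetoid M N L) s = c := by
      rw [← Quotient.out_eq (s := sesSetoid M N L) c]
      exact Quotient.sound ⟨ψ.symm, by simp [← hsi, r], by simp [← hsp, r]⟩
    have hi' : r.i ≫ (φ s).hom = s.i := by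
      have := hi s
      rwa [hc] at this
    have hp' : (φ s).hom ≫ s.p = r.p := by
      have := hp s
      rwa [hc] at this
    -- An automorphism of L compatible with both maps of `s` differs from the identity by a map
    -- factoring through `s.p` and `s.i`, so it is a shear.
    have h₁ : s.i ≫ ((φ s).inv ≫ ψ.hom - 𝟙 L) = 0 := by
      have h₀ : s.i ≫ (φ s).inv = r.i := by rw [← hi']; simp
      rw [Preadditive.comp_sub, reassoc_of% h₀, hsi, Category.comp_id, sub_self]
    obtain ⟨x, hx⟩ := (CokernelCofork.IsColimit.desc' s.sc_shortExact.gIsCokernel _ h₁)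
    change s.p ≫ x = _ at hx
    have h₂ : x ≫ s.p = 0 := by
      rw [← cancel_epi s.p, reassoc_of% hx, Preadditive.sub_comp, Category.assoc, hsp, ← hp']
      simp
    obtain ⟨g, hg⟩ := (KernelFork.IsLimit.lift' s.sc_shortExact.fIsKernel _ h₂)
    change g ≫ s.i = x at hg
    refine ⟨(s, g), Prod.ext hc (Iso.ext ?_)⟩
    simp [SES.shear, hg, hx]

variable [HasExt.{w} A] [FiniteHereditary A]

instance (M N : Cpx ρ) : Finite (M ≅ N) :=
  Finite.of_injective (fun s => s.hom) fun _ _ h => Iso.ext h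

theorem card_aut_ne_zero (L : Cpx ρ) : (Nat.card (L ≅ L) : QV k) ≠ 0 := by
  have : Nonempty (L ≅ L) := ⟨Iso.refl L⟩
  exact_mod_cast Nat.card_pos.ne'

theorem card_hom_ne_zero' (M N : Cpx ρ) : (Nat.card (M ⟶ N) : QV k) ≠ 0 := by
  exact_mod_cast Nat.card_pos.ne'

end Cpx

/-- The basis vectors of the Hall algebra span. -/
theorem hall_induction {p : Hall ρ → Prop} (h0 : p 0) (hadd : ∀ x y, p x → p y → p (x + y))
    (hmk : ∀ (c : QV k) (M : Cpx ρ), p (c • Hall.mk M)) (x : Hall ρ) : p x := by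
  induction x using Finsupp.induction_linear with
  | zero => exact h0
  | add x y hx hy => exact hadd x y hx hy
  | single L c =>
    induction L using Quotient.inductionOn with
    | h M => simpa [Hall.mk] using hmk c M

variable [HasExt.{w} A] [FiniteHereditary A]

theorem card_extMid_out [HasExt.{w'} (Cpx ρ)] [DecidableEq (IsoCl (Cpx ρ))] (M N : Cpx ρ)
    (L : IsoCl (Cpx ρ)) : Nat.card (Cpx.ExtMid M N L.out) =
      (Finset.univ.filter fun ξ : Ext M N 1 => Quotient.mk _ (Cpx.mid ξ) = L).card := by
  classical
  rw [Cpx.card_extMid, Nat.card_eq_fintype_card, Fintype.card_subtype]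
  congr 1
  ext ξ
  simp only [Finset.mem_filter, Finset.mem_univ, true_and]
  conv_rhs => rw [← Quotient.out_eq L]
  exact (Quotient.eq (r := isIsomorphicSetoid (Cpx ρ))).symm

/-- A sum over extension classes instead of isomorphism classes of middle terms, so that it can be
regrouped along homomorphisms of Ext groups. -/
theorem hallProd_eq_sum [HasExt.{w'} (Cpx ρ)] (M N : Cpx ρ) :
    hallProd M N = ∑ ξ : Ext M N 1,
      Finsupp.single (Quotient.mk _ (Cpx.mid ξ)) (Nat.card (M ⟶ N) : QV k)⁻¹ := by
  classical
  rw [hallProd, finsum_eq_sum_of_support_subset (s := Finset.univ.image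
    fun ξ : Ext M N 1 => (Quotient.mk _ (Cpx.mid ξ) : IsoCl (Cpx ρ)))]
  · rw [← Finset.sum_fiberwise_of_maps_to (t := Finset.univ.image
      fun ξ : Ext M N 1 => (Quotient.mk _ (Cpx.mid ξ) : IsoCl (Cpx ρ)))
      (g := fun ξ => Quotient.mk _ (Cpx.mid ξ)) (fun ξ _ => Finset.mem_image_of_mem _ (by simp))]
    refine Finset.sum_congr rfl fun L _ => ?_
    rw [Finset.sum_congr rfl (g := fun _ => Finsupp.single L (Nat.card (M ⟶ N) : QV k)⁻¹)
      fun ξ hξ => by rw [(Finset.mem_filter.1 hξ).2], Finset.sum_const, card_extMid_out,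
      div_eq_mul_inv, ← nsmul_eq_mul, Finsupp.smul_single]
  · intro L hL
    rw [Function.mem_support] at hL
    have h' : Nat.card (Cpx.ExtMid M N L.out) ≠ 0 := fun h0 => hL (by simp [h0])
    rw [card_extMid_out, Finset.card_ne_zero] at h'
    obtain ⟨ξ, hξ⟩ := h'
    simp only [Finset.coe_image, Finset.coe_univ, Set.image_univ, Set.mem_range]
    exact ⟨ξ, (Finset.mem_filter.1 hξ).2⟩

/-- The structure constants of the Hall algebra. -/
theorem hallProd_apply (M N : Cpx ρ) (L : IsoCl (Cpx ρ)) :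
    hallProd M N L = Nat.card (Cpx.SES M N L.out) / (Nat.card (L.out ≅ L.out) : QV k) := by
  classical
  let := HasExt.standard (Cpx ρ)
  -- Riedtmann's formula: |Ext¹(M, N)_L| / |Hom(M, N)| becomes the number of short exact sequences
  -- divided by |Aut L|.
  have h' : (_ : QV k) = _ := congrArg Nat.cast (Cpx.card_extMid_mul_card_aut M N L.out)
  push_cast at h'
  have h : hallProd M N L = Nat.card (Cpx.ExtMid M N L.out) / (Nat.card (M ⟶ N) : QV k) := by
    rw [hallProd_eq_sum, Finsupp.finsetSum_apply, card_extMid_out]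
    simp [Finsupp.single_apply, Finset.sum_ite, div_eq_mul_inv]
  rw [h, div_eq_div_iff (Cpx.card_hom_ne_zero' M N) (Cpx.card_aut_ne_zero L.out), h']

theorem hallProd_congr {M N M' N' : Cpx ρ} (a : M ≅ M') (b : N ≅ N') :
    hallProd M N = hallProd M' N' := by
  ext L
  rw [hallProd_apply, hallProd_apply, Cpx.card_SES_congr a b (Iso.refl _)]

theorem euler_congr {X X' Y Y' : A} (e : X ≅ X') (e' : Y ≅ Y') [Finite k] :
    euler k X Y = euler k X' Y' := by
  rw [← eulerK_cls, ← eulerK_cls, K0.cls_congr e, K0.cls_congr e']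

theorem nonempty_out_iso {C : Type*} [Category C] (M : C) :
    Nonempty ((Quotient.mk (isIsomorphicSetoid C) M).out ≅ M) :=
  Quotient.mk_out (s := isIsomorphicSetoid C) M

variable [Finite k]

theorem hallMul_mk (M N : Cpx ρ) :
    hallMul ρ (Hall.mk M) (Hall.mk N) = (vv k ^ euler k M.X N.X) • hallProd M N := by
  obtain ⟨a⟩ := nonempty_out_iso M
  obtain ⟨b⟩ := nonempty_out_iso N
  have h := euler_congr (k := k) ((Cpx.res ρ).mapIso a) ((Cpx.res ρ).mapIso b)
  simp only [Cpx.res_obj] at h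
  rw [← hallProd_congr a b, ← h]
  simp [hallMul, Hall.mk]

end StructureConstants

end IHall

namespace IHall

/-! ### Associativity of the Hall algebra -/

section Kernels

variable {C : Type*} [Category C] [Abelian C]

theorem exists_iso_X₁ {S S' : ShortComplex C} (hS : S.ShortExact) (hS' : S'.ShortExact)
    (e : S.X₂ ≅ S'.X₂) (c : S.X₃ ≅ S'.X₃) (h : S.g ≫ c.hom = e.hom ≫ S'.g) :
    ∃ a : S.X₁ ≅ S'.X₁, a.hom ≫ S'.f = S.f ≫ e.hom := by
  have := hS.mono_f
  have := hS'.mono_f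
  have h₁ : (S.f ≫ e.hom) ≫ S'.g = 0 := by rw [Category.assoc, ← h, S.zero_assoc, zero_comp]
  have h₂ : (S'.f ≫ e.inv) ≫ S.g = 0 := by
    rw [← cancel_mono c.hom, Category.assoc, Category.assoc, h, Iso.inv_hom_id_assoc, S'.zero,
      zero_comp]
  refine ⟨⟨hS'.exact.lift _ h₁, hS.exact.lift _ h₂, ?_, ?_⟩, hS'.exact.lift_f _ h₁⟩
  · rw [← cancel_mono S.f, Category.assoc, hS.exact.lift_f, hS'.exact.lift_f_assoc]
    simp
  · rw [← cancel_mono S'.f, Category.assoc, hS'.exact.lift_f, hS.exact.lift_f_assoc]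
    simp

theorem exists_iso_X₃ {S S' : ShortComplex C} (hS : S.ShortExact) (hS' : S'.ShortExact)
    (a : S.X₁ ≅ S'.X₁) (e : S.X₂ ≅ S'.X₂) (h : a.hom ≫ S'.f = S.f ≫ e.hom) :
    ∃ c : S.X₃ ≅ S'.X₃, S.g ≫ c.hom = e.hom ≫ S'.g := by
  have := hS.epi_g
  have := hS'.epi_g
  have h₁ : S.f ≫ e.hom ≫ S'.g = 0 := by rw [← Category.assoc, ← h, Category.assoc, S'.zero,
    comp_zero]
  have h₂ : S'.f ≫ e.inv ≫ S.g = 0 := by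
    rw [← cancel_epi a.hom, reassoc_of% h, Iso.hom_inv_id_assoc, S.zero, comp_zero]
  refine ⟨⟨hS.exact.desc _ h₁, hS'.exact.desc _ h₂, ?_, ?_⟩, hS.exact.g_desc _ h₁⟩
  · rw [← cancel_epi S.g, hS.exact.g_desc_assoc, Category.assoc, hS'.exact.g_desc]
    simp
  · rw [← cancel_epi S'.g, hS'.exact.g_desc_assoc, Category.assoc, hS.exact.g_desc]
    simp

variable (S : ShortComplex C)

theorem shortExact_pOpcycles [Mono S.f] :
    (ShortComplex.mk S.f S.pOpcycles S.f_pOpcycles).ShortExact where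
  exact := ShortComplex.exact_of_g_is_cokernel _ S.opcyclesIsCokernel
  mono_f := ‹_›
  epi_g := inferInstanceAs (Epi S.pOpcycles)

theorem shortExact_cycles_of_epi [Epi S.g] :
    (ShortComplex.mk S.iCycles S.g S.iCycles_g).ShortExact where
  exact := ShortComplex.exact_of_f_is_kernel _ S.cyclesIsKernel
  mono_f := inferInstanceAs (Mono S.iCycles)
  epi_g := ‹_›

theorem shortExact_homologyι [Epi S.g] :
    (ShortComplex.mk S.homologyι S.fromOpcycles S.homologyι_comp_fromOpcycles).ShortExact where
  exact := ShortComplex.exact_of_f_is_kernel _ S.homologyIsKernel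
  mono_f := inferInstanceAs (Mono S.homologyι)
  epi_g := epi_of_epi_fac S.p_fromOpcycles

theorem shortExact_homologyπ [Mono S.f] :
    (ShortComplex.mk S.toCycles S.homologyπ S.toCycles_comp_homologyπ).ShortExact where
  exact := ShortComplex.exact_of_g_is_cokernel _ S.homologyIsCokernel
  mono_f := mono_of_mono_fac S.toCycles_i
  epi_g := inferInstanceAs (Epi S.homologyπ)

end Kernels

section Associativity

variable {k : Type u'} [Field k] {A : Type u} [Category.{v} A] [Abelian A] [Linear k A]
  {ρ : Involution k A}

attribute [local instance] Fintype.ofFinite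

namespace Cpx

/-- Pairs of a monomorphism `Z ⟶ L` and an epimorphism `L ⟶ X` with composition zero. -/
structure Flag (X Z L : Cpx ρ) where
  i : Z ⟶ L
  p : L ⟶ X
  zero : i ≫ p = 0
  mono : Mono i
  epi : Epi p

namespace Flag

attribute [instance] Flag.mono Flag.epi

variable {X Z L : Cpx ρ}

/-- The short complex of a flag. -/
abbrev sc (f : Flag X Z L) : ShortComplex (Cpx ρ) := ShortComplex.mk f.i f.p f.zero

/-- The parametrization of pairs of extensions by flags. -/
def toLeft {Y T : Cpx ρ} (x : Σ f : Flag X Z L, (f.sc.opcycles ≅ T) × (Y ≅ f.sc.homology)) :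
    SES X Y T × SES T Z L :=
  (SES.congr (Iso.refl X) x.2.2.symm x.2.1
    (SES.ofShortExact (shortExact_homologyι x.1.sc)),
  SES.congr x.2.1 (Iso.refl Z) (Iso.refl L)
    (SES.ofShortExact (shortExact_pOpcycles x.1.sc)))

/-- The parametrization of pairs of extensions by flags. -/
def toRight {Y T : Cpx ρ} (x : Σ f : Flag X Z L, (f.sc.cycles ≅ T) × (Y ≅ f.sc.homology)) :
    SES Y Z T × SES X T L :=
  (SES.congr x.2.2.symm (Iso.refl Z) x.2.1
    (SES.ofShortExact (shortExact_homologyπ x.1.sc)),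
  SES.congr (Iso.refl X) x.2.1 (Iso.refl L)
    (SES.ofShortExact (shortExact_cycles_of_epi x.1.sc)))

/-- From the flag Z ⟶ L ⟶ X one recovers T as the cokernel of Z ⟶ L and Y as the homology at L. For
the other bracketing T is the kernel of L ⟶ X, and Y is again the homology. The shared index set of
flags is what makes the product associative. -/
theorem toLeft_bijective {Y T : Cpx ρ} :
    Function.Bijective (toLeft (X := X) (Z := Z) (L := L) (Y := Y) (T := T)) := by
  constructor
  · rintro ⟨f, e, θ⟩ ⟨f', e', θ'⟩ h
    have h₁ := congrArg (fun y => y.2.i) h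
    have h₂ := congrArg (fun y => y.2.p ≫ y.1.p) h
    have h₃ := congrArg (fun y => y.2.p) h
    have h₄ := congrArg (fun y => y.1.i) h
    simp only [toLeft, SES.congr, Equiv.coe_fn_mk, SES.ofShortExact_i, SES.ofShortExact_p,
      Iso.refl_hom, Iso.refl_inv, Iso.symm_inv, Category.id_comp, Category.comp_id,
      Category.assoc, Iso.hom_inv_id_assoc, ShortComplex.p_fromOpcycles] at h₁ h₂ h₃ h₄
    obtain ⟨i, p, z, hm, he⟩ := f
    obtain ⟨i', p', z', hm', he'⟩ := f'
    dsimp only at h₁ h₂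
    subst h₁ h₂
    have e₁ : e = e' := Iso.ext ((cancel_epi (ShortComplex.pOpcycles _)).1 h₃)
    subst e₁
    have e₂ : θ = θ' := by
      refine Iso.ext ?_
      rw [← cancel_mono (ShortComplex.homologyι _), ← cancel_mono e.hom]
      simpa only [Category.assoc] using h₄
    rw [e₂]
  · rintro ⟨s, t⟩
    let f : Flag X Z L := ⟨t.i, t.p ≫ s.p, by
      have := t.sc.zero
      dsimp at this
      rw [reassoc_of% this, zero_comp], inferInstance, epi_comp _ _⟩
    obtain ⟨e, he⟩ := exists_iso_X₃ (shortExact_pOpcycles f.sc) t.sc_shortExact (Iso.refl _)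
      (Iso.refl _) (by simp [f])
    dsimp at e he
    rw [Category.id_comp] at he
    have he' : f.sc.fromOpcycles = e.hom ≫ s.p := by
      rw [← cancel_epi f.sc.pOpcycles, reassoc_of% he, f.sc.p_fromOpcycles]
    obtain ⟨θ, hθ⟩ := exists_iso_X₁ s.sc_shortExact (shortExact_homologyι f.sc) e.symm
      (Iso.refl _) (by simp [he'])
    dsimp at θ hθ
    refine ⟨⟨f, e, θ⟩, Prod.ext (SES.ext' ?_ ?_) (SES.ext' ?_ ?_)⟩
    · simp [toLeft, SES.congr, reassoc_of% hθ]
    · simp [toLeft, SES.congr, he']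
    · simp [toLeft, SES.congr, f]
    · simp [toLeft, SES.congr, he]

theorem toRight_bijective {Y T : Cpx ρ} :
    Function.Bijective (toRight (X := X) (Z := Z) (L := L) (Y := Y) (T := T)) := by
  constructor
  · rintro ⟨f, e, θ⟩ ⟨f', e', θ'⟩ h
    have h₁ := congrArg (fun y => y.1.i ≫ y.2.i) h
    have h₂ := congrArg (fun y => y.2.p) h
    have h₃ := congrArg (fun y => y.2.i) h
    have h₄ := congrArg (fun y => y.1.p) h
    simp only [toRight, SES.congr, Equiv.coe_fn_mk, SES.ofShortExact_i, SES.ofShortExact_p,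
      Iso.refl_hom, Iso.refl_inv, Iso.symm_hom, Category.id_comp, Category.comp_id,
      Category.assoc, Iso.hom_inv_id_assoc, ShortComplex.toCycles_i] at h₁ h₂ h₃ h₄
    obtain ⟨i, p, z, hm, he⟩ := f
    obtain ⟨i', p', z', hm', he'⟩ := f'
    dsimp only at h₁ h₂
    subst h₁ h₂
    have e₁ : e = e' := Iso.ext_inv ((cancel_mono (ShortComplex.iCycles _)).1 h₃)
    subst e₁
    have e₂ : θ = θ' := by
      refine Iso.ext_inv ?_
      rw [← cancel_epi (ShortComplex.homologyπ _), ← cancel_epi e.inv]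
      exact h₄
    rw [e₂]
  · rintro ⟨s, t⟩
    let f : Flag X Z L := ⟨s.i ≫ t.i, t.p, by
      have := t.sc.zero
      dsimp at this
      rw [Category.assoc, this, comp_zero], mono_comp _ _, inferInstance⟩
    obtain ⟨e, he⟩ := exists_iso_X₁ (shortExact_cycles_of_epi f.sc) t.sc_shortExact (Iso.refl _)
      (Iso.refl _) (by simp [f])
    dsimp at e he
    rw [Category.comp_id] at he
    have he' : f.sc.toCycles = s.i ≫ e.inv := by
      rw [← cancel_mono f.sc.iCycles, f.sc.toCycles_i, ← he, Category.assoc,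
        Iso.inv_hom_id_assoc]
    obtain ⟨θ, hθ⟩ := exists_iso_X₃ s.sc_shortExact (shortExact_homologyπ f.sc) (Iso.refl _)
      e.symm (by simp [he'])
    dsimp at θ hθ
    refine ⟨⟨f, e, θ⟩, Prod.ext (SES.ext' ?_ ?_) (SES.ext' ?_ ?_)⟩
    · simp [toRight, SES.congr, he']
    · simp [toRight, SES.congr, ← reassoc_of% hθ]
    · simp [toRight, SES.congr, ← he]
    · simp [toRight, SES.congr, f]

variable [HasExt.{w} A] [FiniteHereditary A]

instance : Finite (Flag X Z L) :=
  Finite.of_injective (fun f => (f.i, f.p)) fun f f' h => by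
    cases f; cases f'; cases h; rfl

theorem card_left (Y T : Cpx ρ) : Nat.card (SES X Y T) * Nat.card (SES T Z L) =
    ∑ f : Flag X Z L, Nat.card (f.sc.opcycles ≅ T) * Nat.card (Y ≅ f.sc.homology) := by
  rw [← Nat.card_prod, ← Nat.card_congr (Equiv.ofBijective _ toLeft_bijective), Nat.card_sigma]
  simp only [Nat.card_prod]

theorem card_right (Y T : Cpx ρ) : Nat.card (SES Y Z T) * Nat.card (SES X T L) =
    ∑ f : Flag X Z L, Nat.card (f.sc.cycles ≅ T) * Nat.card (Y ≅ f.sc.homology) := by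
  rw [← Nat.card_prod, ← Nat.card_congr (Equiv.ofBijective _ toRight_bijective), Nat.card_sigma]
  simp only [Nat.card_prod]

end Flag

variable [HasExt.{w} A] [FiniteHereditary A]

/-- The isomorphisms from O to a representative form a torsor under its automorphisms for one class
and the empty set for all others. -/
theorem sum_card_iso (O : Cpx ρ) (T : Finset (IsoCl (Cpx ρ))) (h : Quotient.mk _ O ∈ T) :
    ∑ X ∈ T, (Nat.card (O ≅ X.out) : QV k) / Nat.card (X.out ≅ X.out) = 1 := by
  obtain ⟨e⟩ := nonempty_out_iso O
  rw [Finset.sum_eq_single_of_mem _ h]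
  · rw [Nat.card_congr (show (O ≅ (Quotient.mk (isIsomorphicSetoid _) O).out) ≃
      ((Quotient.mk (isIsomorphicSetoid _) O).out ≅ (Quotient.mk (isIsomorphicSetoid _) O).out) from
      { toFun := fun f => e ≪≫ f
        invFun := fun f => e.symm ≪≫ f
        left_inv := fun f => by simp
        right_inv := fun f => by simp })]
    exact div_self (card_aut_ne_zero _)
  · intro X _ hX
    have : IsEmpty (O ≅ X.out) := ⟨fun f => hX (by
      rw [← Quotient.out_eq X]
      exact (Quotient.sound (s := isIsomorphicSetoid (Cpx ρ)) ⟨f⟩).symm)⟩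
    simp

end Cpx

theorem hall_eq_sum (x : Hall ρ) : x = ∑ T ∈ x.support, x T • Hall.mk T.out := by
  conv_lhs => rw [← Finsupp.sum_single x]
  refine Finset.sum_congr rfl fun T _ => ?_
  rw [Hall.mk, Quotient.out_eq, Finsupp.smul_single, smul_eq_mul, mul_one]

variable [HasExt.{w} A] [FiniteHereditary A]

theorem sum_hallProd_left (X Y Z : Cpx ρ) (L : IsoCl (Cpx ρ)) :
    ∑ T ∈ (hallProd X Y).support, hallProd X Y T * hallProd T.out Z L =
      (∑ f : Cpx.Flag X Z L.out, (Nat.card (Y ≅ f.sc.homology) : QV k)) /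
        Nat.card (L.out ≅ L.out) := by
  classical
  -- The range of summation is enlarged to contain the cokernel of every flag; the added terms
  -- vanish, and the sum over T can then be carried out for each flag.
  let U := (hallProd X Y).support ∪
    Finset.univ.image fun f : Cpx.Flag X Z L.out => (Quotient.mk _ f.sc.opcycles : IsoCl (Cpx ρ))
  rw [Finset.sum_subset (s₂ := U) Finset.subset_union_left (fun T _ hT => by
    rw [Finsupp.notMem_support_iff.1 hT, zero_mul])]
  have h (T : IsoCl (Cpx ρ)) : hallProd X Y T * hallProd T.out Z L =
      ∑ f : Cpx.Flag X Z L.out, ((Nat.card (f.sc.opcycles ≅ T.out) : QV k) /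
        Nat.card (T.out ≅ T.out)) * (Nat.card (Y ≅ f.sc.homology) / Nat.card (L.out ≅ L.out)) := by
    have := congrArg (Nat.cast (R := QV k)) (Cpx.Flag.card_left (X := X) (Z := Z) (L := L.out) Y
      T.out)
    push_cast at this
    rw [hallProd_apply, hallProd_apply, div_mul_div_comm, this, Finset.sum_div]
    exact Finset.sum_congr rfl fun f _ => (div_mul_div_comm _ _ _ _).symm
  rw [Finset.sum_congr rfl fun T _ => h T, Finset.sum_comm, Finset.sum_div]
  refine Finset.sum_congr rfl fun f _ => ?_
  rw [← Finset.sum_mul, Cpx.sum_card_iso, one_mul]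
  exact Finset.mem_union_right _ (Finset.mem_image_of_mem _ (Finset.mem_univ f))

theorem sum_hallProd_right (X Y Z : Cpx ρ) (L : IsoCl (Cpx ρ)) :
    ∑ T ∈ (hallProd Y Z).support, hallProd Y Z T * hallProd X T.out L =
      (∑ f : Cpx.Flag X Z L.out, (Nat.card (Y ≅ f.sc.homology) : QV k)) /
        Nat.card (L.out ≅ L.out) := by
  classical
  let U := (hallProd Y Z).support ∪
    Finset.univ.image fun f : Cpx.Flag X Z L.out => (Quotient.mk _ f.sc.cycles : IsoCl (Cpx ρ))
  rw [Finset.sum_subset (s₂ := U) Finset.subset_union_left (fun T _ hT => by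
    rw [Finsupp.notMem_support_iff.1 hT, zero_mul])]
  have h (T : IsoCl (Cpx ρ)) : hallProd Y Z T * hallProd X T.out L =
      ∑ f : Cpx.Flag X Z L.out, ((Nat.card (f.sc.cycles ≅ T.out) : QV k) /
        Nat.card (T.out ≅ T.out)) * (Nat.card (Y ≅ f.sc.homology) / Nat.card (L.out ≅ L.out)) := by
    have := congrArg (Nat.cast (R := QV k)) (Cpx.Flag.card_right (X := X) (Z := Z) (L := L.out) Y
      T.out)
    push_cast at this
    rw [hallProd_apply, hallProd_apply, div_mul_div_comm, this, Finset.sum_div]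
    exact Finset.sum_congr rfl fun f _ => (div_mul_div_comm _ _ _ _).symm
  rw [Finset.sum_congr rfl fun T _ => h T, Finset.sum_comm, Finset.sum_div]
  refine Finset.sum_congr rfl fun f _ => ?_
  rw [← Finset.sum_mul, Cpx.sum_card_iso, one_mul]
  exact Finset.mem_union_right _ (Finset.mem_image_of_mem _ (Finset.mem_univ f))

/-- The product is graded by the class of the underlying object, so the Euler twist of an iterated
product is a single scalar. -/
theorem cls_out_of_mem_support {X Y : Cpx ρ} {T : IsoCl (Cpx ρ)}
    (hT : T ∈ (hallProd X Y).support) : K0.cls T.out.X = K0.cls X.X + K0.cls Y.X := by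
  rw [Finsupp.mem_support_iff, hallProd_apply] at hT
  have : Nat.card (Cpx.SES X Y T.out) ≠ 0 := fun h => hT (by rw [h, Nat.cast_zero, zero_div])
  obtain ⟨s⟩ := (Nat.card_ne_zero.1 this).1
  rw [cls_X_of_shortExact s.sc_shortExact, add_comm]

variable [Finite k]

theorem hallMul_hallProd_mk (X Y Z : Cpx ρ) : hallMul ρ (hallProd X Y) (Hall.mk Z) =
    vv k ^ (euler k X.X Z.X + euler k Y.X Z.X) •
      ∑ T ∈ (hallProd X Y).support, hallProd X Y T • hallProd T.out Z := by
  conv_lhs => rw [hall_eq_sum (hallProd X Y)]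
  rw [LinearMap.map_sum₂, Finset.smul_sum]
  refine Finset.sum_congr rfl fun T hT => ?_
  rw [LinearMap.map_smul₂, hallMul_mk, ← eulerK_cls, cls_out_of_mem_support hT, map_add,
    AddMonoidHom.add_apply, eulerK_cls, eulerK_cls, smul_comm]

theorem hallMul_mk_hallProd (X Y Z : Cpx ρ) : hallMul ρ (Hall.mk X) (hallProd Y Z) =
    vv k ^ (euler k X.X Y.X + euler k X.X Z.X) •
      ∑ T ∈ (hallProd Y Z).support, hallProd Y Z T • hallProd X T.out := by
  conv_lhs => rw [hall_eq_sum (hallProd Y Z)]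
  rw [map_sum, Finset.smul_sum]
  refine Finset.sum_congr rfl fun T hT => ?_
  rw [map_smul, hallMul_mk, ← eulerK_cls, cls_out_of_mem_support hT, map_add, eulerK_cls,
    eulerK_cls, smul_comm]

theorem vv_ne_zero (k : Type u') [Field k] [Finite k] : vv k ≠ 0 := by
  intro h
  have h' : Real.sqrt (Nat.card k : ℝ) = 0 := congrArg Subtype.val h
  rw [Real.sqrt_eq_zero (by positivity)] at h'
  exact Nat.card_pos.ne' (by exact_mod_cast h' : Nat.card k = 0)

theorem hallMul_assoc_mk (X Y Z : Cpx ρ) :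
    hallMul ρ (hallMul ρ (Hall.mk X) (Hall.mk Y)) (Hall.mk Z) =
      hallMul ρ (Hall.mk X) (hallMul ρ (Hall.mk Y) (Hall.mk Z)) := by
  rw [hallMul_mk, hallMul_mk, LinearMap.map_smul₂, map_smul, hallMul_hallProd_mk,
    hallMul_mk_hallProd, smul_smul, smul_smul, ← zpow_add₀ (vv_ne_zero k),
    ← zpow_add₀ (vv_ne_zero k)]
  congr 1
  · congr 1
    abel
  · ext L
    have h₁ := sum_hallProd_left X Y Z L
    have h₂ := sum_hallProd_right X Y Z L
    simp only [Finsupp.finsetSum_apply, Finsupp.smul_apply, smul_eq_mul]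
    rw [h₁, h₂]

/-- The twisted Hall algebra is associative. -/
theorem hallMul_assoc (x y z : Hall ρ) :
    hallMul ρ (hallMul ρ x y) z = hallMul ρ x (hallMul ρ y z) := by
  induction x using hall_induction with
  | h0 => simp only [LinearMap.map_zero₂]
  | hadd x x' hx hx' => simp only [LinearMap.map_add₂, hx, hx']
  | hmk c X =>
    simp only [LinearMap.map_smul₂]
    congr 1
    induction y using hall_induction with
    | h0 => rw [(hallMul ρ _).map_zero, LinearMap.map_zero₂, map_zero]
    | hadd y y' hy hy' =>
      rw [(hallMul ρ _).map_add, LinearMap.map_add₂, LinearMap.map_add₂, hy, hy',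
        (hallMul ρ _).map_add]
    | hmk c Y =>
      rw [(hallMul ρ _).map_smul, LinearMap.map_smul₂, LinearMap.map_smul₂,
        (hallMul ρ _).map_smul]
      congr 1
      induction z using hall_induction with
      | h0 => simp only [map_zero]
      | hadd z z' hz hz' => simp only [map_add, hz, hz']
      | hmk c Z =>
        simp only [map_smul]
        rw [hallMul_assoc_mk]

end Associativity

end IHall

namespace IHall

/-! ### Products with acyclic complexes modulo homology and image -/

/-! ### Snake lemmas for morphisms of short exact sequences invertible at one end -/

section Snake

variable {C : Type*} [Category C] [Abelian C]

/-- With an isomorphism on quotients and the epimorphism `T.g` on subobjects, the snake lemma makes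
`φ` epi with kernel `T.X₁`. The isomorphisms `b` and `c` match end terms that need not be literally
equal. -/
theorem shortExact_of_epi_τ₁ {S S' T : ShortComplex C} (hS : S.ShortExact) (hS' : S'.ShortExact)
    (hT : T.ShortExact) (b : T.X₂ ≅ S.X₁) (c : T.X₃ ≅ S'.X₁) (φ : S.X₂ ⟶ S'.X₂) (e : S.X₃ ≅ S'.X₃)
    (h₁ : S.f ≫ φ = b.inv ≫ T.g ≫ c.hom ≫ S'.f) (h₂ : φ ≫ S'.g = S.g ≫ e.hom) :
    ∃ z, (ShortComplex.mk (T.f ≫ b.hom ≫ S.f) φ z).ShortExact := by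
  have := hS.mono_f
  have := hS'.mono_f
  have := hT.mono_f
  have := hS.epi_g
  have := hT.epi_g
  have z : (T.f ≫ b.hom ≫ S.f) ≫ φ = 0 := by
    rw [Category.assoc, Category.assoc, h₁, Iso.hom_inv_id_assoc, T.zero_assoc, zero_comp]
  refine ⟨z, { exact := ?_, mono_f := mono_comp _ _, epi_g := ?_ }⟩
  · rw [ShortComplex.exact_iff_exact_up_to_refinements]
    intro Y x hx
    dsimp at x hx ⊢
    have h₃ : x ≫ S.g = 0 := by
      rw [← cancel_mono e.hom, Category.assoc, ← h₂, reassoc_of% hx, zero_comp, zero_comp]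
    have h₄ : (hS.exact.lift x h₃ ≫ b.inv) ≫ T.g = 0 := by
      rw [← cancel_mono c.hom, ← cancel_mono S'.f]
      simp only [Category.assoc, zero_comp]
      rw [← h₁, hS.exact.lift_f_assoc, hx]
    exact ⟨Y, 𝟙 Y, inferInstance, hT.exact.lift _ h₄, by
      rw [hT.exact.lift_f_assoc, Category.id_comp]
      simp⟩
  · refine Preadditive.epi_of_cancel_zero _ fun {Y} x hx => ?_
    dsimp at x hx
    have h₃ : S'.f ≫ x = 0 := by
      rw [← cancel_epi c.hom, ← cancel_epi T.g, ← cancel_epi b.inv]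
      simp only [comp_zero]
      have := S.f ≫= hx
      rw [reassoc_of% h₁, comp_zero] at this
      exact this
    have := hS'.epi_g
    rw [← hS'.exact.g_desc x h₃] at hx ⊢
    rw [reassoc_of% h₂] at hx
    rw [← comp_zero (f := S.g ≫ e.hom), Category.assoc, cancel_epi, cancel_epi] at hx
    rw [hx, comp_zero]

theorem shortExact_of_mono_τ₃ {S S' T : ShortComplex C} (hS : S.ShortExact) (hS' : S'.ShortExact)
    (hT : T.ShortExact) (b : T.X₁ ≅ S.X₃) (c : T.X₂ ≅ S'.X₃) (φ : S.X₂ ⟶ S'.X₂) (e : S.X₁ ≅ S'.X₁)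
    (h₁ : S.f ≫ φ = e.hom ≫ S'.f) (h₂ : φ ≫ S'.g = S.g ≫ b.inv ≫ T.f ≫ c.hom) :
    ∃ z, (ShortComplex.mk φ (S'.g ≫ c.inv ≫ T.g) z).ShortExact := by
  have := hS.mono_f
  have := hS'.mono_f
  have := hT.mono_f
  have := hS'.epi_g
  have := hT.epi_g
  have z : φ ≫ S'.g ≫ c.inv ≫ T.g = 0 := by
    rw [reassoc_of% h₂, Iso.hom_inv_id_assoc, T.zero, comp_zero, comp_zero]
  refine ⟨z, { exact := ?_, mono_f := ?_, epi_g := epi_comp _ _ }⟩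
  · rw [ShortComplex.exact_iff_exact_up_to_refinements]
    intro Y x hx
    dsimp at x hx ⊢
    have h₃ : (x ≫ S'.g ≫ c.inv) ≫ T.g = 0 := by simpa using hx
    have := hS.epi_g
    obtain ⟨Y', π, hπ, y, hy⟩ := surjective_up_to_refinements_of_epi S.g
      (hT.exact.lift _ h₃ ≫ b.hom)
    have h₄ : (π ≫ x - y ≫ φ) ≫ S'.g = 0 := by
      rw [Preadditive.sub_comp, Category.assoc, Category.assoc, h₂, ← reassoc_of% hy,
        Iso.hom_inv_id_assoc, hT.exact.lift_f_assoc]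
      simp
    refine ⟨Y', π, hπ, y + hS'.exact.lift _ h₄ ≫ e.inv ≫ S.f, ?_⟩
    rw [Preadditive.add_comp, Category.assoc, Category.assoc, h₁, Iso.inv_hom_id_assoc,
      hS'.exact.lift_f]
    abel
  · refine Preadditive.mono_of_cancel_zero _ fun {Y} x hx => ?_
    dsimp at x hx
    have h₃ : x ≫ S.g = 0 := by
      rw [← cancel_mono b.inv, ← cancel_mono T.f, ← cancel_mono c.hom]
      simp only [zero_comp, Category.assoc]
      rw [← h₂, reassoc_of% hx, zero_comp]
    rw [← hS.exact.lift_f x h₃] at hx ⊢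
    rw [Category.assoc, h₁, ← zero_comp (f := e.hom ≫ S'.f), cancel_mono] at hx
    rw [hx, zero_comp]

end Snake

/-- All fibres of a surjective homomorphism have the order of its kernel. -/
theorem sum_comp_surjective {G H V : Type*} [AddGroup G] [AddGroup H] [Fintype G] [Fintype H]
    [AddCommMonoid V] (f : G →+ H) (hf : Function.Surjective f) (F : H → V) :
    ∑ g, F (f g) = Nat.card f.ker • ∑ h, F h := by
  classical
  rw [← Finset.sum_fiberwise (g := f), Finset.smul_sum]
  refine Finset.sum_congr rfl fun h _ => ?_
  obtain ⟨x, rfl⟩ := hf h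
  rw [Finset.sum_congr rfl (g := fun _ => F (f x)) fun y hy => by rw [(Finset.mem_filter.1 hy).2],
    Finset.sum_const, ← card_fiber_eq_card_ker f x, Nat.card_eq_fintype_card, Fintype.card_subtype]

/-! ### Hall products seen through homology and image class -/

section Data

variable {k : Type u'} [Field k] {A : Type u} [Category.{v} A] [Abelian A] [Linear k A]
  {ρ : Involution k A}

attribute [local instance] Fintype.ofFinite

/-- The homology and the class of the image of a complex. -/
def Cpx.data (M : Cpx ρ) : IsoCl A × K0 A := (Quotient.mk _ M.homology, M.imCls)

theorem Cpx.data_congr {M N : Cpx ρ} (e : M ≅ N) : M.data = N.data :=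
  Prod.ext (Quotient.sound (s := isIsomorphicSetoid A) ⟨homologyIso e⟩) (imCls_congr e)

theorem Cpx.data_of_sub {S : ShortComplex (Cpx ρ)} (hS : S.ShortExact) (h : S.X₁.IsAcyclic) :
    S.X₂.data = (S.X₃.data.1, S.X₃.data.2 + S.X₁.imCls) :=
  Prod.ext (Quotient.sound (s := isIsomorphicSetoid A) (nonempty_homologyIso_of_sub hS h))
    ((imCls_of_shortExact hS (Or.inl h)).trans (add_comm _ _))

theorem Cpx.data_of_quot {S : ShortComplex (Cpx ρ)} (hS : S.ShortExact) (h : S.X₃.IsAcyclic) :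
    S.X₂.data = (S.X₁.data.1, S.X₁.data.2 + S.X₃.imCls) :=
  Prod.ext (Quotient.sound (s := isIsomorphicSetoid A)
    ((nonempty_homologyIso_of_quot hS h).map Iso.symm)) (imCls_of_shortExact hS (Or.inr h))

variable (k A) in
/-- The vector space with basis the pairs of an isomorphism class of objects and an element of the
Grothendieck group. -/
abbrev Dat : Type _ := (IsoCl A × K0 A) →₀ QV k

/-- The translation by an element of the Grothendieck group. -/
def shift (β : K0 A) : Dat k A →ₗ[QV k] Dat k A :=
  Finsupp.lmapDomain (QV k) (QV k) fun x => (x.1, x.2 + β)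

omit [Field k] [Linear k A] in
@[simp] theorem shift_single (β : K0 A) (x : IsoCl A × K0 A) (c : QV k) :
    shift β (Finsupp.single x c) = Finsupp.single (x.1, x.2 + β) c :=
  Finsupp.mapDomain_single

theorem shift_shift (β γ : K0 A) (x : Dat k A) : shift β (shift γ x) = shift (γ + β) x := by
  induction x using Finsupp.induction_linear with
  | zero => simp only [map_zero]
  | add x y hx hy => simp only [map_add, hx, hy]
  | single x c => rw [shift_single, shift_single, shift_single, add_assoc]

theorem shift_zero (x : Dat k A) : shift 0 x = x := by
  induction x using Finsupp.induction_linear with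
  | zero => simp only [map_zero]
  | add x y hx hy => simp only [map_add, hx, hy]
  | single x c => rw [shift_single, add_zero]

/-- The linear map that only remembers the homology and the class of the image. -/
def tau (ρ : Involution k A) : Hall ρ →ₗ[QV k] Dat k A :=
  Finsupp.lmapDomain (QV k) (QV k) (Quotient.lift Cpx.data fun _ _ ⟨e⟩ => Cpx.data_congr e)

theorem tau_single (M : Cpx ρ) (c : QV k) :
    tau ρ (Finsupp.single (Quotient.mk _ M) c) = Finsupp.single M.data c :=
  Finsupp.mapDomain_single

theorem tau_mk (M : Cpx ρ) : tau ρ (Hall.mk M) = Finsupp.single M.data 1 := tau_single M 1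

theorem vv_sq (k : Type u') [Field k] : vv k ^ 2 = (Nat.card k : QV k) :=
  Subtype.ext (Real.sq_sqrt (by positivity))

variable [HasExt.{w} A] [FiniteHereditary A]

theorem tau_hallProd [HasExt.{w'} (Cpx ρ)] (M N : Cpx ρ) :
    tau ρ (hallProd M N) = ∑ ξ : Ext M N 1,
      Finsupp.single (Cpx.mid ξ).data (Nat.card (M ⟶ N) : QV k)⁻¹ := by
  rw [hallProd_eq_sum, map_sum]
  exact Finset.sum_congr rfl fun ξ _ => tau_single _ _

variable [Finite k]

omit [Finite k] in
theorem zpow_card_inv (n : ℤ) : ((((Nat.card k : ℚ) ^ n)⁻¹ : ℚ) : QV k) = vv k ^ (-2 * n) := by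
  push_cast
  rw [neg_mul, zpow_neg, zpow_mul, ← vv_sq]
  norm_cast

/-- Pushing forward along `S.g` is onto on Ext¹, since Ext² into the acyclic kernel vanishes. The
middle term of ξ maps onto that of its image with the same kernel, which only translates the pair.
The fibre size gives the factor `chi`⁻¹, a power of q = `vv`². -/
theorem tau_hallProd_sub (N : Cpx ρ) {S : ShortComplex (Cpx ρ)} (hS : S.ShortExact)
    (h : S.X₁.IsAcyclic) : tau ρ (hallProd N S.X₂) =
      vv k ^ (-2 * eulerK A k (K0.cls N.X) (K0.rho ρ S.X₁.imCls)) •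
        shift S.X₁.imCls (tau ρ (hallProd N S.X₃)) := by
  let := HasExt.standard (Cpx ρ)
  let f := (Ext.mk₀ S.g).postcomp N (add_zero 1)
  have hf : Function.Surjective f := ext_one_postcomp_surjective hS (Cpx.ext_two_right h N)
  have hd (ξ : Ext N S.X₂ 1) : (Cpx.mid ξ).data =
      ((Cpx.mid (f ξ)).data.1, (Cpx.mid (f ξ)).data.2 + S.X₁.imCls) := by
    obtain ⟨φ, h₁, h₂⟩ := exists_hom_of_extClass (Cpx.midSES ξ).sc_shortExact
      (Cpx.midSES (f ξ)).sc_shortExact S.g (𝟙 N) (by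
        rw [Ext.mk₀_id_comp]
        refine Eq.trans ?_ (Cpx.midSES_cls _).symm
        exact congrArg (fun t => Ext.comp t (Ext.mk₀ S.g) (add_zero 1)) (Cpx.midSES_cls ξ))
    obtain ⟨z, hz⟩ := shortExact_of_epi_τ₁ (Cpx.midSES ξ).sc_shortExact
      (Cpx.midSES (f ξ)).sc_shortExact hS (Iso.refl _) (Iso.refl _) φ (Iso.refl _)
      (by simpa using h₁) (by simpa using h₂)
    exact Cpx.data_of_sub hz h
  have hc := congrArg (Rat.cast (K := QV k)) (card_postcomp_ker_div N hS)
  rw [Cpx.chi_right_eq_zpow N h, div_eq_mul_inv, div_eq_mul_inv, Rat.cast_mul, Rat.cast_mul,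
    zpow_card_inv, Rat.cast_inv, Rat.cast_inv, Rat.cast_natCast, Rat.cast_natCast,
    Rat.cast_natCast] at hc
  rw [tau_hallProd, tau_hallProd, Finset.sum_congr rfl fun ξ _ => by rw [hd ξ],
    sum_comp_surjective f hf fun ξ => Finsupp.single ((Cpx.mid ξ).data.1,
      (Cpx.mid ξ).data.2 + S.X₁.imCls) (Nat.card (N ⟶ S.X₂) : QV k)⁻¹, map_sum, Finset.smul_sum,
    Finset.smul_sum]
  refine Finset.sum_congr rfl fun ξ _ => ?_
  rw [shift_single, Finsupp.smul_single, Finsupp.smul_single, smul_eq_mul, nsmul_eq_mul]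
  exact congrArg _ hc

theorem tau_hallProd_quot (M : Cpx ρ) {S : ShortComplex (Cpx ρ)} (hS : S.ShortExact)
    (h : S.X₃.IsAcyclic) : tau ρ (hallProd S.X₂ M) =
      vv k ^ (-2 * eulerK A k S.X₃.imCls (K0.cls M.X)) •
        shift S.X₃.imCls (tau ρ (hallProd S.X₁ M)) := by
  let := HasExt.standard (Cpx ρ)
  let f := (Ext.mk₀ S.f).precomp M (zero_add 1)
  have hf : Function.Surjective f := ext_one_precomp_surjective hS (Cpx.ext_two_left h M)
  have hd (ξ : Ext S.X₂ M 1) : (Cpx.mid ξ).data =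
      ((Cpx.mid (f ξ)).data.1, (Cpx.mid (f ξ)).data.2 + S.X₃.imCls) := by
    obtain ⟨φ, h₁, h₂⟩ := exists_hom_of_extClass (Cpx.midSES (f ξ)).sc_shortExact
      (Cpx.midSES ξ).sc_shortExact (𝟙 M) S.f (by
        rw [Ext.comp_mk₀_id]
        refine (Cpx.midSES_cls _).trans ?_
        exact congrArg (fun t => Ext.comp (Ext.mk₀ S.f) t (zero_add 1)) (Cpx.midSES_cls ξ).symm)
    obtain ⟨z, hz⟩ := shortExact_of_mono_τ₃ (Cpx.midSES (f ξ)).sc_shortExact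
      (Cpx.midSES ξ).sc_shortExact hS (Iso.refl _) (Iso.refl _) φ (Iso.refl _)
      (by simpa using h₁) (by simpa using h₂)
    exact Cpx.data_of_quot hz h
  have hc := congrArg (Rat.cast (K := QV k)) (card_precomp_ker_div M hS)
  rw [Cpx.chi_left_eq_zpow M h, div_eq_mul_inv, div_eq_mul_inv, Rat.cast_mul, Rat.cast_mul,
    zpow_card_inv, Rat.cast_inv, Rat.cast_inv, Rat.cast_natCast, Rat.cast_natCast,
    Rat.cast_natCast] at hc
  rw [tau_hallProd, tau_hallProd, Finset.sum_congr rfl fun ξ _ => by rw [hd ξ],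
    sum_comp_surjective f hf fun ξ => Finsupp.single ((Cpx.mid ξ).data.1,
      (Cpx.mid ξ).data.2 + S.X₃.imCls) (Nat.card (S.X₂ ⟶ M) : QV k)⁻¹, map_sum, Finset.smul_sum,
    Finset.smul_sum]
  refine Finset.sum_congr rfl fun ξ _ => ?_
  rw [shift_single, Finsupp.smul_single, Finsupp.smul_single, smul_eq_mul, nsmul_eq_mul]
  exact congrArg _ hc

end Data

end IHall

namespace IHall

/-! ### Resolving a complex by its homology -/

section Roofs

variable {k : Type u'} [Field k] {A : Type u} [Category.{v} A] [Abelian A] [Linear k A]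
  {ρ : Involution k A}

theorem Involution.map_sq_inv (ρ : Involution k A) (X : A) :
    ρ.functor.map (ρ.sq.inv.app X) = ρ.sq.inv.app (ρ.functor.obj X) := by
  rw [← cancel_mono (ρ.sq.hom.app (ρ.functor.obj X)), ← ρ.map_sq, ← Functor.map_comp]
  simp [ρ.map_sq]

theorem shortExact_factorThruImage {X Y : A} (f : X ⟶ Y) :
    (ShortComplex.mk (kernel.ι f) (factorThruImage f) (by
      rw [← cancel_mono (Limits.image.ι f)]; simp)).ShortExact where
  exact := by
    rw [ShortComplex.exact_iff_exact_up_to_refinements]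
    intro T x hx
    dsimp at x hx ⊢
    have hx' : x ≫ f = 0 := by rw [← Limits.image.fac f, reassoc_of% hx, zero_comp]
    exact ⟨T, 𝟙 T, inferInstance, kernel.lift f x hx', by simp⟩

namespace Cpx

theorem shortExact_image_toCycles (M : Cpx ρ) :
    (ShortComplex.mk (Limits.image.ι M.ss.toCycles) M.ss.homologyπ (by
      rw [← cancel_epi (factorThruImage M.ss.toCycles)]; simp)).ShortExact where
  exact := by
    rw [ShortComplex.exact_iff_exact_up_to_refinements]
    intro T x hx
    dsimp at x hx
    obtain ⟨T', π, hπ, y, hy⟩ :=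
      (ShortComplex.comp_homologyπ_eq_zero_iff_up_to_refinements (S := M.ss) x).1 hx
    exact ⟨T', π, hπ, y ≫ factorThruImage M.ss.toCycles, by simpa using hy⟩

theorem shortExact_image_fromOpcycles (M : Cpx ρ) :
    (ShortComplex.mk M.ss.homologyι (factorThruImage M.ss.fromOpcycles) (by
      rw [← cancel_mono (Limits.image.ι M.ss.fromOpcycles)]; simp)).ShortExact where
  exact := by
    rw [ShortComplex.exact_iff_exact_up_to_refinements]
    intro T x hx
    dsimp at x hx
    have hx' : x ≫ M.ss.fromOpcycles = 0 := by
      rw [← Limits.image.fac M.ss.fromOpcycles, reassoc_of% hx, zero_comp]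
    exact ⟨T, 𝟙 T, inferInstance, M.ss.homologyIsKernel.lift (KernelFork.ofι x hx'), by
      rw [Category.id_comp]
      exact (M.ss.homologyIsKernel.fac (KernelFork.ofι x hx') WalkingParallelPair.zero).symm⟩

variable [HasExt.{w} A] [FiniteHereditary A]

/-- An extension of the homology by `ϱ M` that covers the cycles. -/
theorem exists_cover_cycles (M : Cpx ρ) : ∃ (E : A) (i : ρ.functor.obj M.X ⟶ E)
    (p : E ⟶ M.ss.homology) (z : i ≫ p = 0) (_ : (ShortComplex.mk i p z).ShortExact)
    (ε : E ⟶ M.ss.cycles), Epi ε ∧ i ≫ ε = M.ss.toCycles ∧ ε ≫ M.ss.homologyπ = p := by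
  -- Heredity enters here: the extension of the homology by the boundaries lifts along the
  -- epimorphism from ϱ M onto the boundaries.
  obtain ⟨y, hy⟩ := ext_one_postcomp_surjective (shortExact_factorThruImage M.ss.toCycles)
    (FiniteHereditary.ext_two M.ss.homology _) M.shortExact_image_toCycles.extClass
  obtain ⟨E, i, p, z, hS, rfl⟩ := exists_extClass_eq y
  obtain ⟨ε, h₁, h₂⟩ := exists_hom_of_extClass hS M.shortExact_image_toCycles
    (factorThruImage M.ss.toCycles) (𝟙 _) (by rw [Ext.mk₀_id_comp]; exact hy)
  dsimp at ε h₁ h₂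
  obtain ⟨_, hz⟩ := shortExact_of_epi_τ₁ hS M.shortExact_image_toCycles
    (shortExact_factorThruImage M.ss.toCycles) (Iso.refl _) (Iso.refl _) ε (Iso.refl _)
    (by simpa using h₁) (by simpa using h₂)
  exact ⟨E, i, p, z, hS, ε, hz.epi_g, by simpa using h₁, by simpa using h₂⟩

/-- An extension of `ϱ M` by the homology that contains the cokernel of the differential. -/
theorem exists_hull_opcycles (M : Cpx ρ) : ∃ (E : A) (i : M.ss.homology ⟶ E)
    (p : E ⟶ ρ.functor.obj M.X) (z : i ≫ p = 0) (_ : (ShortComplex.mk i p z).ShortExact)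
    (ε : M.ss.opcycles ⟶ E), Mono ε ∧ M.ss.homologyι ≫ ε = i ∧ ε ≫ p = M.ss.fromOpcycles := by
  have hT : (ShortComplex.mk (Limits.image.ι M.ss.fromOpcycles)
      (cokernel.π (Limits.image.ι M.ss.fromOpcycles)) (cokernel.condition _)).ShortExact :=
    { exact := ShortComplex.exact_cokernel _ }
  -- Dually, the extension of Im(d) by the homology extends along the inclusion of the image in ϱ M.
  obtain ⟨y, hy⟩ := ext_one_precomp_surjective hT
    (FiniteHereditary.ext_two _ M.ss.homology) M.shortExact_image_fromOpcycles.extClass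
  obtain ⟨E, i, p, z, hS, rfl⟩ := exists_extClass_eq y
  obtain ⟨ε, h₁, h₂⟩ := exists_hom_of_extClass M.shortExact_image_fromOpcycles hS
    (𝟙 _) (Limits.image.ι M.ss.fromOpcycles) (by rw [Ext.comp_mk₀_id]; exact hy.symm)
  dsimp at ε h₁ h₂
  obtain ⟨_, hz⟩ := shortExact_of_mono_τ₃ M.shortExact_image_fromOpcycles hS
    hT (Iso.refl _) (Iso.refl _) ε (Iso.refl _)
    (by simpa using h₁) (by simpa using h₂)
  exact ⟨E, i, p, z, hS, ε, hz.mono_f, by simpa using h₁, by simpa using h₂⟩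

omit [HasExt.{w} A] [FiniteHereditary A]

/-- The complex `X ⊕ Y` whose differential is given by a morphism `X ⟶ ϱ Y`. -/
abbrev cone {X Y : A} (s : X ⟶ ρ.functor.obj Y) : Cpx ρ where
  X := X ⊞ Y
  d := biprod.fst ≫ s ≫ ρ.functor.map biprod.inr
  d_comp_d := by
    simp only [Functor.map_comp, Category.assoc]
    rw [← ρ.functor.map_comp_assoc biprod.inr biprod.fst]
    simp

/-- Morphisms of cones. -/
def coneMap {X Y X' Y' : A} {s : X ⟶ ρ.functor.obj Y} {s' : X' ⟶ ρ.functor.obj Y'} (f : X ⟶ X')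
    (g : Y ⟶ Y') (h : s ≫ ρ.functor.map g = f ≫ s') : cone s ⟶ cone s' :=
  mkHom (M := cone s) (N := cone s') (biprod.map f g) (by
    dsimp only [cone]
    rw [Category.assoc, Category.assoc, ← Functor.map_comp, biprod.inr_map, Functor.map_comp,
      reassoc_of% h, biprod.map_fst_assoc])

/-- The canonical acyclic complex as a cone. -/
abbrev cone₀ (ρ : Involution k A) (X : A) : Cpx ρ := cone (ρ := ρ) (ρ.sq.inv.app X)

theorem isAcyclic_cone₀ (X : A) : (cone₀ ρ X).IsAcyclic := kk_isAcyclic X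

/-- All factors of `d` after ε are mono, so Ker d = Ker ε. This lies in Ker p = ϱ M, hence in ϱ of
the cycles of M, and `b` covers these because ϱ(ε) is epi. -/
theorem isAcyclic_of_cover {M : Cpx ρ} {E : A} {j : ρ.functor.obj M.X ⟶ E}
    {p : E ⟶ M.ss.homology} {z : j ≫ p = 0} (hS : (ShortComplex.mk j p z).ShortExact)
    {ε : E ⟶ M.ss.cycles} (hε : Epi ε) (h₁ : j ≫ ε = M.ss.toCycles) (h₂ : ε ≫ M.ss.homologyπ = p)
    {K : Cpx ρ} (e : K.X ≅ E)
    (hd : K.d = -(e.hom ≫ ε ≫ M.ss.iCycles ≫ ρ.sq.inv.app M.X ≫ ρ.functor.map j ≫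
      ρ.functor.map e.inv)) : K.IsAcyclic := by
  have hj : Mono j := hS.mono_f
  have hb : K.b = -(ρ.functor.map e.hom ≫ ρ.functor.map ε ≫ ρ.functor.map M.ss.iCycles ≫ j ≫
      e.inv) := by
    have := ρ.sq.hom.naturality (j ≫ e.inv)
    simp only [Functor.comp_map, Functor.id_map, Functor.map_comp, Category.assoc] at this
    rw [b, hd]
    simp only [Functor.map_neg, Functor.map_comp, Category.assoc, Preadditive.neg_comp]
    rw [this, ρ.map_sq_inv]
    simp
  rw [isAcyclic_iff, ShortComplex.exact_iff_exact_up_to_refinements]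
  intro T (x : T ⟶ K.X) (hx : x ≫ K.d = 0)
  have h₃ : (x ≫ e.hom) ≫ ε = 0 := by
    rw [hd, Preadditive.comp_neg, neg_eq_zero] at hx
    simp only [← Category.assoc] at hx
    rw [← cancel_mono M.ss.iCycles, ← cancel_mono (ρ.sq.inv.app M.X),
      ← cancel_mono (ρ.functor.map j), ← cancel_mono (ρ.functor.map e.inv), hx]
    simp only [zero_comp]
  have hxp : (x ≫ e.hom) ≫ p = 0 := by rw [← h₂, ← Category.assoc, h₃, zero_comp]
  obtain ⟨y, hy⟩ : ∃ y, y ≫ j = x ≫ e.hom := ⟨hS.exact.lift _ hxp, hS.exact.lift_f _ _⟩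
  have hyb : y ≫ M.b = 0 := by
    have h₄ : M.b = j ≫ ε ≫ M.ss.iCycles := by rw [← Category.assoc, h₁]; exact M.ss.toCycles_i.symm
    rw [h₄, reassoc_of% hy, ← Category.assoc, ← Category.assoc, h₃, zero_comp]
  have hyd : y ≫ ρ.functor.map M.d = 0 := by
    rw [← cancel_mono (ρ.sq.hom.app M.X), zero_comp, Category.assoc, hyb]
  have hZ := (ShortComplex.exact_of_f_is_kernel (ShortComplex.mk M.ss.iCycles M.ss.g
    M.ss.iCycles_g) M.ss.cyclesIsKernel).map ρ.functor
  have : Mono ((ShortComplex.mk M.ss.iCycles M.ss.g M.ss.iCycles_g).map ρ.functor).f :=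
    inferInstanceAs (Mono (ρ.functor.map M.ss.iCycles))
  obtain ⟨y', hy'⟩ : ∃ y' : T ⟶ ρ.functor.obj M.ss.cycles, y' ≫ ρ.functor.map M.ss.iCycles = y :=
    ⟨hZ.lift y hyd, hZ.lift_f y hyd⟩
  obtain ⟨T', π, hπ, t, ht⟩ := surjective_up_to_refinements_of_epi
    (ρ.functor.map e.hom ≫ ρ.functor.map ε) y'
  refine ⟨T', π, hπ, -t, ?_⟩
  change _ = (-t) ≫ K.b
  rw [hb, Preadditive.neg_comp_neg]
  simp only [← Category.assoc] at ht ⊢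
  rw [← ht, Category.assoc π y', hy', Category.assoc π, hy]
  simp

/-- Dual situation: a cycle maps under `p` to a boundary of ϱ M. Subtracting the corresponding
element of M leaves something in the homology, which is a class in `opcycles` and so comes from M as
well; `b` reaches all of M modulo boundaries. -/
theorem isAcyclic_of_hull {M : Cpx ρ} {E : A} {j : M.ss.homology ⟶ E}
    {p : E ⟶ ρ.functor.obj M.X} {z : j ≫ p = 0} (hS : (ShortComplex.mk j p z).ShortExact)
    {ε : M.ss.opcycles ⟶ E} (hε : Mono ε) (h₁ : M.ss.homologyι ≫ ε = j)
    (h₂ : ε ≫ p = M.ss.fromOpcycles) {K : Cpx ρ} (e : K.X ≅ E)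
    (hd : K.d = -(e.hom ≫ p ≫ ρ.functor.map M.ss.pOpcycles ≫ ρ.functor.map ε ≫
      ρ.functor.map e.inv)) : K.IsAcyclic := by
  have hp : Epi p := hS.epi_g
  obtain ⟨q, hq⟩ : ∃ q : ρ.functor.obj K.X ⟶ M.X,
    q = ρ.functor.map e.hom ≫ ρ.functor.map p ≫ ρ.sq.hom.app M.X := ⟨_, rfl⟩
  have : Epi q := by
    rw [hq]
    infer_instance
  have hb : K.b = -(q ≫ M.ss.pOpcycles ≫ ε ≫ e.inv) := by
    have := ρ.sq.hom.naturality (M.ss.pOpcycles ≫ ε ≫ e.inv)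
    simp only [Functor.comp_map, Functor.id_map, Functor.map_comp, Category.assoc] at this
    rw [b, hd, hq]
    simp only [Functor.map_neg, Functor.map_comp, Category.assoc, Preadditive.neg_comp]
    rw [this]
  rw [isAcyclic_iff, ShortComplex.exact_iff_exact_up_to_refinements]
  intro T (x : T ⟶ K.X) (hx : x ≫ K.d = 0)
  have h₃ : (x ≫ e.hom ≫ p) ≫ ρ.functor.map M.ss.pOpcycles = 0 := by
    rw [hd, Preadditive.comp_neg, neg_eq_zero] at hx
    simp only [← Category.assoc] at hx ⊢
    rw [← cancel_mono (ρ.functor.map ε), ← cancel_mono (ρ.functor.map e.inv), hx]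
    simp only [zero_comp]
  have hO := (ShortComplex.exact_of_g_is_cokernel (ShortComplex.mk M.ss.f M.ss.pOpcycles
    M.ss.f_pOpcycles) M.ss.opcyclesIsCokernel).map ρ.functor
  obtain ⟨T₁, π₁, _, y, hy⟩ := hO.exact_up_to_refinements (x ≫ e.hom ≫ p) h₃
  change T₁ ⟶ ρ.functor.obj (ρ.functor.obj M.X) at y
  change _ = y ≫ ρ.functor.map M.b at hy
  obtain ⟨y', hy'⟩ : ∃ y' : T₁ ⟶ M.X, y' = y ≫ ρ.sq.hom.app M.X := ⟨_, rfl⟩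
  have hyp : y ≫ ρ.functor.map M.b = (y' ≫ M.ss.pOpcycles ≫ ε) ≫ p := by
    rw [Category.assoc, Category.assoc, h₂, M.ss.p_fromOpcycles, map_b, hy', Category.assoc]
  have hxp : (π₁ ≫ x ≫ e.hom - y' ≫ M.ss.pOpcycles ≫ ε) ≫ p = 0 := by
    rw [Preadditive.sub_comp, ← hyp, ← hy]
    simp only [Category.assoc]
    exact sub_self _
  obtain ⟨h, hh⟩ : ∃ h, h ≫ j = π₁ ≫ x ≫ e.hom - y' ≫ M.ss.pOpcycles ≫ ε :=
    have := hS.mono_f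
    ⟨hS.exact.lift _ hxp, hS.exact.lift_f _ _⟩
  obtain ⟨T₂, π₂, _, n, hn⟩ := surjective_up_to_refinements_of_epi M.ss.pOpcycles
    (h ≫ M.ss.homologyι)
  change T₂ ⟶ M.X at n
  obtain ⟨T₃, π₃, _, t, ht⟩ := surjective_up_to_refinements_of_epi q (π₂ ≫ y' + n)
  refine ⟨T₃, π₃ ≫ π₂ ≫ π₁, inferInstance, -t, ?_⟩
  change _ = (-t) ≫ K.b
  have h₅ : π₂ ≫ π₁ ≫ x ≫ e.hom = (π₂ ≫ y' + n) ≫ M.ss.pOpcycles ≫ ε := by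
    have h₆ : π₂ ≫ h ≫ j = n ≫ M.ss.pOpcycles ≫ ε := by
      rw [← h₁, reassoc_of% hn]
    rw [hh, Preadditive.comp_sub, sub_eq_iff_eq_add] at h₆
    rw [h₆, Preadditive.add_comp, add_comm, Category.assoc]
  rw [hb, Preadditive.neg_comp_neg, ← cancel_mono e.hom]
  simp only [Category.assoc, Iso.inv_hom_id, Category.comp_id]
  rw [h₅, ← Category.assoc, ht, Category.assoc]

variable [HasExt.{w} A] [FiniteHereditary A]

/-- A complex with acyclic epimorphisms to `M` and to its homology. -/
theorem exists_roof_sub (M : Cpx ρ) : ∃ (P K K' : Cpx ρ) (i : K ⟶ P) (p : P ⟶ M) (z : i ≫ p = 0)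
    (i' : K' ⟶ P) (p' : P ⟶ st ρ M.ss.homology) (z' : i' ≫ p' = 0), K.IsAcyclic ∧ K'.IsAcyclic ∧
      (ShortComplex.mk i p z).ShortExact ∧ (ShortComplex.mk i' p' z').ShortExact := by
  obtain ⟨E, j, π, z, hS, ε, hε, h₁, h₂⟩ := M.exists_cover_cycles
  have hj : Mono j := hS.mono_f
  have hπ : Epi π := hS.epi_g
  -- The common cover is M ⊕ E with differential M ≅ ϱ² M ⟶ ϱ E. The kernel of the map to M is the
  -- graph of the negative of E ⟶ M, a copy of E; the kernel of the map to the homology is the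
  -- canonical acyclic complex on M ⊕ ϱ M.
  let s : M.X ⟶ ρ.functor.obj E := ρ.sq.inv.app M.X ≫ ρ.functor.map j
  have hs : Mono s := mono_comp _ _
  have hsη : s ≫ ρ.functor.map (ε ≫ M.ss.iCycles) = M.d := by
    have hη : j ≫ ε ≫ M.ss.iCycles = M.b := by rw [← Category.assoc, h₁]; exact M.ss.toCycles_i
    rw [Category.assoc, ← Functor.map_comp, hη, map_b]
    simp
  let p : cone s ⟶ M := mkHom (M := cone s) (biprod.desc (𝟙 M.X) (ε ≫ M.ss.iCycles)) (by
    dsimp only [cone]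
    rw [Category.assoc, Category.assoc, ← Functor.map_comp, biprod.inr_desc, hsη]
    refine biprod.hom_ext' _ _ ?_ ?_
    · simp
    · simp only [biprod.inr_fst_assoc, zero_comp, biprod.inr_desc_assoc, Category.assoc]
      exact ((ε ≫= M.ss.iCycles_g).trans comp_zero).symm)
  let p' : cone s ⟶ st ρ M.ss.homology :=
    mkHom (M := cone s) (N := st ρ M.ss.homology) (biprod.snd ≫ π) (by
      dsimp only [cone, s]
      simp only [Category.assoc, ← Functor.map_comp, biprod.inr_snd_assoc, z]
      simp)
  let i' : cone₀ ρ M.X ⟶ cone s := coneMap (𝟙 M.X) j (Category.id_comp _).symm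
  have hp : Epi p := by
    have : Epi (biprod.desc (𝟙 M.X) (ε ≫ M.ss.iCycles)) :=
      epi_of_epi_fac (biprod.inl_desc (𝟙 M.X) (ε ≫ M.ss.iCycles))
    exact (res ρ).epi_of_epi_map this
  have hp' : Epi p' := by
    have : Epi ((biprod.snd : M.X ⊞ E ⟶ E) ≫ π) := epi_comp _ _
    exact (res ρ).epi_of_epi_map this
  have z' : i' ≫ p' = 0 := hom_ext (by
    change biprod.map (𝟙 M.X) j ≫ biprod.snd ≫ π = 0
    rw [biprod.map_snd_assoc, z, comp_zero])
  have hA : (ShortComplex.mk (biprod.lift (-(ε ≫ M.ss.iCycles)) (𝟙 E))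
      (biprod.desc (𝟙 M.X) (ε ≫ M.ss.iCycles)) (by simp)).ShortExact :=
    ShortComplex.Splitting.shortExact
      { r := biprod.snd
        s := biprod.inl
        f_r := by simp
        s_g := by simp
        id := by
          refine biprod.hom_ext _ _ (biprod.hom_ext' _ _ ?_ ?_) (biprod.hom_ext' _ _ ?_ ?_) <;>
            simp }
  have hηd : (ε ≫ M.ss.iCycles) ≫ M.d = 0 := by
    rw [Category.assoc]
    exact (ε ≫= M.ss.iCycles_g).trans comp_zero
  let K : Cpx ρ := ⟨E, -((ε ≫ M.ss.iCycles) ≫ s), by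
    rw [Functor.map_neg, Preadditive.neg_comp_neg, Functor.map_comp _ _ s, Category.assoc,
      reassoc_of% hsη, ← Category.assoc _ M.d, hηd, zero_comp]⟩
  let i : K ⟶ cone s := mkHom (M := K) (N := cone s) (biprod.lift (-(ε ≫ M.ss.iCycles)) (𝟙 E)) (by
    dsimp only [cone, K]
    rw [biprod.lift_fst_assoc, biprod.lift_eq, Functor.map_add, Functor.map_comp, Functor.map_comp,
      CategoryTheory.Functor.map_id, Category.id_comp, Functor.map_neg, Preadditive.comp_add]
    simp only [Preadditive.neg_comp, Preadditive.comp_neg, neg_neg]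
    rw [Category.assoc _ s, reassoc_of% hsη, ← Category.assoc _ M.d, hηd, zero_comp, zero_add,
      Category.assoc _ s])
  have z₁ : i ≫ p = 0 := hom_ext (by
    change biprod.lift (-(ε ≫ M.ss.iCycles)) (𝟙 E) ≫ biprod.desc (𝟙 M.X) (ε ≫ M.ss.iCycles) = 0
    simp)
  refine ⟨cone s, K, cone₀ ρ M.X, i, p, z₁, i', p', z', ?_,
    isAcyclic_cone₀ _, shortExact_of_res hA, shortExact_of_res ?_⟩
  · exact isAcyclic_of_cover hS hε h₁ h₂ (K := K) (Iso.refl E) (by simp [K, s])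
  · have : Mono (biprod.map (𝟙 M.X) j) := inferInstance
    refine { exact := ?_, mono_f := this, epi_g := (inferInstance : Epi ((res ρ).map p')) }
    rw [ShortComplex.exact_iff_exact_up_to_refinements]
    intro T (x : T ⟶ M.X ⊞ E) (hx : x ≫ biprod.snd ≫ π = 0)
    have hx' : (x ≫ biprod.snd) ≫ π = 0 := by rw [Category.assoc, hx]
    refine ⟨T, 𝟙 T, inferInstance, biprod.lift (x ≫ biprod.fst) (hS.exact.lift _ hx'), ?_⟩
    change 𝟙 T ≫ x = biprod.lift _ _ ≫ biprod.map (𝟙 M.X) j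
    have := hS.exact.lift_f _ hx'
    dsimp only at this
    refine biprod.hom_ext _ _ ?_ ?_
    · simp
    · simp [this]

/-- A complex with acyclic monomorphisms from `M` and from its homology. -/
theorem exists_roof_quot (M : Cpx ρ) : ∃ (Q K K' : Cpx ρ) (i : M ⟶ Q) (p : Q ⟶ K) (z : i ≫ p = 0)
    (i' : st ρ M.ss.homology ⟶ Q) (p' : Q ⟶ K') (z' : i' ≫ p' = 0), K.IsAcyclic ∧ K'.IsAcyclic ∧
      (ShortComplex.mk i p z).ShortExact ∧ (ShortComplex.mk i' p' z').ShortExact := by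
  obtain ⟨E, j, s, z, hS, ε, hε, h₁, h₂⟩ := M.exists_hull_opcycles
  have hj : Mono j := hS.mono_f
  have hs : Epi s := hS.epi_g
  have hη : (M.ss.pOpcycles ≫ ε) ≫ s = M.d := by
    rw [Category.assoc, h₂]
    exact M.ss.p_fromOpcycles
  have hdη : M.d ≫ ρ.functor.map (M.ss.pOpcycles ≫ ε) = 0 := by
    have h : M.d ≫ ρ.functor.map M.ss.pOpcycles = 0 :=
      (opcyclesHom M).comm'.trans comp_zero
    rw [Functor.map_comp, ← Category.assoc, h, zero_comp]
  -- The common hull is E ⊕ M with differential E ⟶ ϱ M. Here M embeds as a graph with cokernel E,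
  -- and the homology embeds in E with cokernel the canonical acyclic complex on ϱ M ⊕ ϱ² M.
  let i : M ⟶ cone s := mkHom (N := cone s) (biprod.lift (M.ss.pOpcycles ≫ ε) (𝟙 M.X)) (by
    dsimp only [cone]
    rw [biprod.lift_fst_assoc, biprod.lift_eq, Functor.map_add,
      Functor.map_comp _ (M.ss.pOpcycles ≫ ε), Category.id_comp, Preadditive.comp_add,
      ← Category.assoc M.d, hdη, zero_comp, zero_add, ← Category.assoc _ s, hη])
  let i' : st ρ M.ss.homology ⟶ cone s :=
    mkHom (M := st ρ M.ss.homology) (N := cone s) (j ≫ biprod.inl) (by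
      dsimp only [cone]
      rw [Category.assoc, biprod.inl_fst_assoc, reassoc_of% z, zero_comp, zero_comp])
  let p' : cone s ⟶ cone₀ ρ (ρ.functor.obj M.X) :=
    coneMap (Y' := ρ.functor.obj (ρ.functor.obj M.X)) s (ρ.sq.inv.app M.X)
      (by rw [ρ.map_sq_inv])
  let K : Cpx ρ := ⟨E, -(s ≫ ρ.functor.map (M.ss.pOpcycles ≫ ε)), by
    rw [Functor.map_neg, Preadditive.neg_comp_neg, Functor.map_comp _ s, Category.assoc,
      ← Functor.map_comp_assoc, hη, ← Functor.map_comp, hdη, Functor.map_zero, comp_zero]⟩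
  let p : cone s ⟶ K := mkHom (M := cone s) (N := K)
    (biprod.desc (𝟙 E) (-(M.ss.pOpcycles ≫ ε))) (by
    dsimp only [cone, K]
    rw [Category.assoc, Category.assoc, ← Functor.map_comp, biprod.inr_desc]
    refine biprod.hom_ext' _ _ ?_ ?_
    · rw [biprod.inl_fst_assoc, biprod.inl_desc_assoc, Category.id_comp, Functor.map_neg,
        Preadditive.comp_neg]
    · rw [biprod.inr_fst_assoc, biprod.inr_desc_assoc, zero_comp, Preadditive.neg_comp_neg,
        ← Category.assoc _ s, hη, hdη])
  have hA : (ShortComplex.mk (biprod.lift (M.ss.pOpcycles ≫ ε) (𝟙 M.X))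
      (biprod.desc (𝟙 E) (-(M.ss.pOpcycles ≫ ε))) (by simp)).ShortExact :=
    ShortComplex.Splitting.shortExact
      { r := biprod.snd
        s := biprod.inl
        f_r := by simp
        s_g := by simp
        id := by
          refine biprod.hom_ext _ _ (biprod.hom_ext' _ _ ?_ ?_) (biprod.hom_ext' _ _ ?_ ?_) <;>
            simp }
  have z₁ : i ≫ p = 0 := hom_ext (by
    change biprod.lift (M.ss.pOpcycles ≫ ε) (𝟙 M.X) ≫
      biprod.desc (𝟙 E) (-(M.ss.pOpcycles ≫ ε)) = 0
    simp)
  have z' : i' ≫ p' = 0 := hom_ext (by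
    change (j ≫ biprod.inl) ≫ biprod.map s (ρ.sq.inv.app M.X) = 0
    rw [Category.assoc, biprod.inl_map, reassoc_of% z, zero_comp])
  refine ⟨cone s, K, cone₀ ρ (ρ.functor.obj M.X), i, p, z₁, i', p', z', ?_,
    isAcyclic_cone₀ _, shortExact_of_res hA, shortExact_of_res ?_⟩
  · exact isAcyclic_of_hull hS hε h₁ h₂ (K := K) (Iso.refl E) (by simp [K])
  · have hm : Mono (j ≫ (biprod.inl : E ⟶ E ⊞ M.X)) := mono_comp _ _
    have he : Epi (biprod.map s (ρ.sq.inv.app M.X)) := inferInstance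
    refine { exact := ?_, mono_f := hm, epi_g := he }
    rw [ShortComplex.exact_iff_exact_up_to_refinements]
    intro T (x : T ⟶ E ⊞ M.X) (hx : x ≫ biprod.map s (ρ.sq.inv.app M.X) = 0)
    have hx₁ : (x ≫ biprod.fst) ≫ s = 0 := by
      have := hx =≫ biprod.fst
      rwa [Category.assoc, biprod.map_fst, zero_comp, ← Category.assoc] at this
    have hx₂ : x ≫ biprod.snd = 0 := by
      have := hx =≫ biprod.snd
      rw [Category.assoc, biprod.map_snd, zero_comp, ← Category.assoc] at this
      rwa [← cancel_mono (ρ.sq.inv.app M.X), zero_comp]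
    refine ⟨T, 𝟙 T, inferInstance, hS.exact.lift _ hx₁, ?_⟩
    change 𝟙 T ≫ x = hS.exact.lift _ hx₁ ≫ j ≫ biprod.inl
    have := hS.exact.lift_f _ hx₁
    dsimp only at this
    rw [reassoc_of% this]
    refine biprod.hom_ext _ _ ?_ ?_
    · simp
    · simp [hx₂]

end Cpx

attribute [local instance] Fintype.ofFinite

theorem smul_shift_inj {a : QV k} (ha : a ≠ 0) (β : K0 A) {x y : Dat k A}
    (h : a • shift β x = a • shift β y) : x = y := by
  have := congrArg (shift (-β)) ((smul_right_injective _ ha) h)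
  rwa [shift_shift, shift_shift, add_neg_cancel, shift_zero, shift_zero] at this

variable [HasExt.{w} A] [FiniteHereditary A] [Finite k]

/-- The product with a complex on the right only depends on its homology and image. -/
theorem tau_hallProd_right (N M : Cpx ρ) : tau ρ (hallProd N M) =
    vv k ^ (-2 * eulerK A k (K0.cls N.X) (K0.rho ρ M.imCls)) •
      shift M.imCls (tau ρ (hallProd N (Cpx.st ρ M.homology))) := by
  obtain ⟨P, K, K', i, p, z, i', p', z', hK, hK', hS, hS'⟩ := M.exists_roof_sub
  have h₁ := tau_hallProd_sub N hS hK
  have h₂ := tau_hallProd_sub N hS' hK'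
  have h₃ := imCls_of_shortExact hS (Or.inl hK)
  have h₄ := (imCls_of_shortExact hS' (Or.inl hK')).symm
  dsimp only at h₁ h₂ h₃ h₄
  have h₅ : (Cpx.st ρ M.ss.homology).imCls = 0 := Cpx.imCls_stalk _
  rw [h₅, add_zero, h₃] at h₄
  -- The product with the roof P is computed in two ways. The image class of K' is that of K plus
  -- that of M, so the contribution of K cancels.
  refine smul_shift_inj (zpow_ne_zero _ (vv_ne_zero k)) K.imCls (h₁.symm.trans (h₂.trans ?_))
  rw [h₄, map_smul, smul_smul, shift_shift, ← zpow_add₀ (vv_ne_zero k), map_add, map_add,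
    add_comm M.imCls, mul_add]
  rfl

/-- The product with a complex on the left only depends on its homology and image. -/
theorem tau_hallProd_left (N M : Cpx ρ) : tau ρ (hallProd N M) =
    vv k ^ (-2 * eulerK A k N.imCls (K0.cls M.X)) •
      shift N.imCls (tau ρ (hallProd (Cpx.st ρ N.homology) M)) := by
  obtain ⟨P, K, K', i, p, z, i', p', z', hK, hK', hS, hS'⟩ := N.exists_roof_quot
  have h₁ := tau_hallProd_quot M hS hK
  have h₂ := tau_hallProd_quot M hS' hK'
  have h₃ := imCls_of_shortExact hS (Or.inr hK)
  have h₄ := (imCls_of_shortExact hS' (Or.inr hK')).symm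
  dsimp only at h₁ h₂ h₃ h₄
  have h₅ : (Cpx.st ρ N.ss.homology).imCls = 0 := Cpx.imCls_stalk _
  rw [h₅, zero_add, h₃] at h₄
  refine smul_shift_inj (zpow_ne_zero _ (vv_ne_zero k)) K.imCls (h₁.symm.trans (h₂.trans ?_))
  rw [h₄, map_smul, smul_smul, shift_shift, ← zpow_add₀ (vv_ne_zero k), map_add,
    AddMonoidHom.add_apply, mul_add, add_comm (-2 * eulerK A k N.imCls (K0.cls M.X))]
  rfl

end Roofs

end IHall

namespace IHall

/-! ### Generalities on bilinear maps and localizations -/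

section Bilinear

variable {F : Type*} [CommRing F] {I J V : Type*} [AddCommGroup V] [Module F V]

/-- The bilinear map with given values on basis vectors. -/
def bilin (f : I → J → V) : (I →₀ F) →ₗ[F] (J →₀ F) →ₗ[F] V :=
  Finsupp.lsum F fun i => LinearMap.toSpanSingleton F _ <|
    Finsupp.lsum F fun j => LinearMap.toSpanSingleton F V (f i j)

theorem bilin_single (f : I → J → V) (i : I) (j : J) :
    bilin f (Finsupp.single i (1 : F)) (Finsupp.single j (1 : F)) = f i j := by
  simp [bilin]

/-- A weighted permutation of the basis vectors is bijective. -/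
theorem bijective_of_single {F : Type*} [Field F] (T : (I →₀ F) →ₗ[F] (I →₀ F)) (σ : Equiv.Perm I)
    (c : I → F) (hc : ∀ i, c i ≠ 0)
    (h : ∀ i, T (Finsupp.single i 1) = Finsupp.single (σ i) (c i)) : IsUnit T := by
  let U : (I →₀ F) →ₗ[F] (I →₀ F) :=
    Finsupp.lsum F fun i => LinearMap.toSpanSingleton F _ (Finsupp.single (σ.symm i)
      (c (σ.symm i))⁻¹)
  have hU (i : I) : U (Finsupp.single i 1) = Finsupp.single (σ.symm i) (c (σ.symm i))⁻¹ := by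
    simp [U]
  have e (i : I) (a : F) : (Finsupp.single i a : I →₀ F) = a • Finsupp.single i 1 := by simp
  refine ⟨⟨T, U, ?_, ?_⟩, rfl⟩
  · refine Finsupp.lhom_ext' fun i => LinearMap.ext_ring ?_
    change T (U (Finsupp.single i 1)) = Finsupp.single i 1
    rw [hU, e, map_smul, h, Equiv.apply_symm_apply, Finsupp.smul_single, smul_eq_mul,
      inv_mul_cancel₀ (hc _)]
  · refine Finsupp.lhom_ext' fun i => LinearMap.ext_ring ?_
    change U (T (Finsupp.single i 1)) = Finsupp.single i 1
    rw [h, e, map_smul, hU, Equiv.symm_apply_apply, Finsupp.smul_single, smul_eq_mul,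
      mul_inv_cancel₀ (hc _)]

theorem map_mul_of_single {E : Type*} [Ring E] [Algebra F E]
    {μ : (I →₀ F) →ₗ[F] (I →₀ F) →ₗ[F] (I →₀ F)} (t : (I →₀ F) →ₗ[F] E)
    (h : ∀ i j, t (μ (Finsupp.single i 1) (Finsupp.single j 1)) =
      t (Finsupp.single i 1) * t (Finsupp.single j 1)) (x y : I →₀ F) :
    t (μ x y) = t x * t y := by
  have : μ.compr₂ t = (LinearMap.mul F E).compl₁₂ t t := by
    refine Finsupp.lhom_ext' fun i => LinearMap.ext_ring ?_
    refine Finsupp.lhom_ext' fun j => LinearMap.ext_ring ?_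
    simpa using h i j
  simpa using LinearMap.congr_fun₂ this x y

end Bilinear

/-! ### Universal property and generation of the localization -/

section Loc

variable {F : Type*} [CommRing F] {R : Type*} [AddCommGroup R] [Module F R]
  {μ : R →ₗ[F] R →ₗ[F] R} {e : R} {S : Set R}

theorem idealSpan_le {G : Set R} {E : Type*} [Ring E] [Algebra F E] (t : R →ₗ[F] E)
    (hmul : ∀ x y, t (μ x y) = t x * t y) (hG : ∀ x ∈ G, t x = 0) :
    idealSpan μ G ≤ LinearMap.ker t :=
  sInf_le ⟨hG, fun x y hy => by
    have hy' : t y = 0 := hy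
    constructor
    · change t (μ x y) = 0
      rw [hmul, hy', mul_zero]
    · change t (μ y x) = 0
      rw [hmul, hy', zero_mul]⟩

theorem subset_idealSpan (μ : R →ₗ[F] R →ₗ[F] R) (G : Set R) {x : R} (hx : x ∈ G) :
    x ∈ idealSpan μ G :=
  Submodule.mem_sInf.2 fun _ hJ => hJ.1 hx

namespace Loc

theorem of_mul (x y : R) : of μ e S (μ x y) = of μ e S x * of μ e S y := by
  rw [of, RingQuot.mkAlgHom_rel F (LocRel.mul x y), map_mul]
  rfl

theorem of_one : of μ e S e = 1 := by
  rw [of, RingQuot.mkAlgHom_rel F LocRel.one, map_one]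

variable (μ e S) in
/-- The canonical map to the localization as a linear map. -/
def ofₗ : R →ₗ[F] Loc μ e S where
  toFun := of μ e S
  map_add' x y := by
    rw [of, RingQuot.mkAlgHom_rel F (LocRel.add x y), map_add]
    rfl
  map_smul' c x := by
    rw [of, RingQuot.mkAlgHom_rel F (LocRel.smul c x), map_smul]
    rfl

variable (μ e) in
/-- The formal inverse of an element of `S`. -/
def inv (s : S) : Loc μ e S := RingQuot.mkAlgHom F (LocRel μ e S) (FreeAlgebra.ι F (Sum.inr s))

theorem of_mul_inv (s : S) : of μ e S s.1 * inv μ e s = 1 := by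
  rw [of, inv, ← map_mul, RingQuot.mkAlgHom_rel F (LocRel.mul_inv s), map_one]

theorem inv_mul_of (s : S) : inv μ e s * of μ e S s.1 = 1 := by
  rw [of, inv, ← map_mul, RingQuot.mkAlgHom_rel F (LocRel.inv_mul s), map_one]

theorem isUnit_of {s : R} (hs : s ∈ S) : IsUnit (of μ e S s) :=
  ⟨⟨_, inv μ e ⟨s, hs⟩, of_mul_inv ⟨s, hs⟩, inv_mul_of ⟨s, hs⟩⟩, rfl⟩

theorem inv_eq (s : S) : inv μ e s = Ring.inverse (of μ e S s.1) := by
  have h := isUnit_of (μ := μ) (e := e) s.2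
  rw [← mul_one (inv μ e s), ← Ring.mul_inverse_cancel _ h, ← mul_assoc, inv_mul_of, one_mul]

/-- The universal property of the localization. -/
theorem exists_lift {E : Type*} [Ring E] [Algebra F E] (t : R →ₗ[F] E)
    (hmul : ∀ x y, t (μ x y) = t x * t y) (hone : t e = 1) (hS : ∀ s ∈ S, IsUnit (t s)) :
    ∃ φ : Loc μ e S →ₐ[F] E, ∀ x, φ (of μ e S x) = t x := by
  let g : FreeAlgebra F (R ⊕ S) →ₐ[F] E :=
    FreeAlgebra.lift F (Sum.elim t fun s => Ring.inverse (t s.1))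
  have hg (x : R) : g (FreeAlgebra.ι F (Sum.inl x)) = t x := by simp [g]
  have hg' (s : S) : g (FreeAlgebra.ι F (Sum.inr s)) = Ring.inverse (t s.1) := by simp [g]
  have h : ∀ ⦃x y⦄, LocRel μ e S x y → g x = g y := by
    rintro _ _ (⟨x, y⟩ | ⟨c, x⟩ | ⟨x, y⟩ | _ | s | s)
    · rw [map_add, hg, hg, hg, map_add]
    · rw [map_smul, hg, hg, map_smul]
    · rw [map_mul, hg, hg, hg, hmul]
    · rw [hg, hone, map_one]
    · rw [map_mul, hg, hg', Ring.mul_inverse_cancel _ (hS _ s.2), map_one]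
    · rw [map_mul, hg, hg', Ring.inverse_mul_cancel _ (hS _ s.2), map_one]
  refine ⟨RingQuot.liftAlgHom F ⟨g, h⟩, fun x => ?_⟩
  rw [of, RingQuot.liftAlgHom_mkAlgHom_apply, hg]

/-- A subspace that contains `1` and is stable under multiplication by generators is everything. -/
theorem eq_top_of_mul_mem (W : Submodule F (Loc μ e S)) (h1 : 1 ∈ W)
    (hof : ∀ x, ∀ w ∈ W, of μ e S x * w ∈ W)
    (hinv : ∀ s ∈ S, ∀ w ∈ W, Ring.inverse (of μ e S s) * w ∈ W) : W = ⊤ := by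
  have h (x : FreeAlgebra F (R ⊕ S)) : ∀ w ∈ W, RingQuot.mkAlgHom F (LocRel μ e S) x * w ∈ W := by
    induction x using FreeAlgebra.induction with
    | grade0 c =>
      intro w hw
      rw [AlgHom.commutes, ← Algebra.smul_def]
      exact W.smul_mem c hw
    | grade1 x =>
      intro w hw
      rcases x with x | s
      · exact hof x w hw
      · have := hinv s.1 s.2 w hw
        rw [← inv_eq] at this
        exact this
    | mul x y hx hy =>
      intro w hw
      rw [map_mul, mul_assoc]
      exact hx _ (hy w hw)
    | add x y hx hy =>
      intro w hw
      rw [map_add, add_mul]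
      exact W.add_mem (hx w hw) (hy w hw)
  rw [eq_top_iff]
  rintro x -
  obtain ⟨y, rfl⟩ := RingQuot.mkAlgHom_surjective F (LocRel μ e S) x
  have := h y 1 h1
  rwa [mul_one] at this

/-- The universal property of the localization of a quotient. -/
theorem exists_lift_quotient {F : Type*} [Field F] {R : Type*} [AddCommGroup R] [Module F R]
    {μ : R →ₗ[F] R →ₗ[F] R} {G : Set R} {e : R} {S : Set (R ⧸ idealSpan μ G)}
    {E : Type*} [Ring E] [Algebra F E] (t : R →ₗ[F] E)
    (hmul : ∀ x y, t (μ x y) = t x * t y) (hG : ∀ x ∈ G, t x = 0) (hone : t e = 1)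
    (hS : ∀ s ∈ S, ∃ (a : F) (x : R), a ≠ 0 ∧ IsUnit (t x) ∧ s = a • Submodule.Quotient.mk x) :
    ∃ φ : Loc (quotMul μ G) (Submodule.Quotient.mk e) S →ₐ[F] E,
      ∀ x, φ (of _ _ _ (Submodule.Quotient.mk x)) = t x := by
  obtain ⟨φ, hφ⟩ := exists_lift (μ := quotMul μ G) (e := Submodule.Quotient.mk e) (S := S)
    ((idealSpan μ G).liftQ t (idealSpan_le t hmul hG)) (by
      intro x y
      obtain ⟨x, rfl⟩ := Submodule.Quotient.mk_surjective _ x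
      obtain ⟨y, rfl⟩ := Submodule.Quotient.mk_surjective _ y
      exact hmul x y) hone (by
      intro s hs
      obtain ⟨a, x, ha, hx, rfl⟩ := hS s hs
      rw [map_smul]
      exact hx.smul (Units.mk0 a ha))
  exact ⟨φ, fun x => hφ _⟩

end Loc

end Loc

end IHall

namespace IHall

/-! ### A representation of the Hall algebra -/

section Unit

variable {k : Type u'} [Field k] {A : Type u} [Category.{v} A] [Abelian A] [Linear k A]
  {ρ : Involution k A}

theorem Hall.mk_congr {M N : Cpx ρ} (e : M ≅ N) : Hall.mk M = Hall.mk N := by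
  rw [Hall.mk, Hall.mk, Quotient.sound (s := isIsomorphicSetoid (Cpx ρ)) ⟨e⟩]

theorem Hall.mk_out (L : IsoCl (Cpx ρ)) : Hall.mk L.out = Finsupp.single L (1 : QV k) := by
  rw [Hall.mk, Quotient.out_eq]

theorem Cpx.data_st (X : A) : (st ρ X).data = (Quotient.mk _ X, 0) :=
  Prod.ext (Quotient.sound (s := isIsomorphicSetoid A) ⟨homologyStalk X⟩) (imCls_stalk X)

theorem Cpx.IsAcyclic.isZero_st {K : Cpx ρ} (h : K.IsAcyclic) : IsZero (st ρ K.homology) :=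
  isZero_of_isZero_X h

theorem ext_eq_zero_of_isZero {C : Type*} [Category C] [Abelian C] [HasExt.{w'} C] {M N : C}
    (h : IsZero M ∨ IsZero N) {n : ℕ} (ξ : Ext M N n) : ξ = 0 := by
  rcases h with h | h
  · rw [← Ext.mk₀_id_comp ξ, h.eq_of_src (𝟙 M) 0, Ext.mk₀_zero, Ext.zero_comp]
  · rw [← Ext.comp_mk₀_id ξ, h.eq_of_src (𝟙 N) 0, Ext.mk₀_zero, Ext.comp_zero]

variable [HasExt.{w} A] [FiniteHereditary A]

attribute [local instance] Fintype.ofFinite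

/-- Both Hom and Ext¹ are trivial, so only the split extension contributes. -/
theorem hallProd_of_isZero {M N L : Cpx ρ} (h : IsZero M ∧ Nonempty (L ≅ N) ∨
    IsZero N ∧ Nonempty (L ≅ M)) : hallProd M N = Hall.mk L := by
  let := HasExt.standard (Cpx ρ)
  have h0 : IsZero M ∨ IsZero N := h.imp And.left And.left
  have hhom : Nat.card (M ⟶ N) = 1 := Nat.card_eq_one_iff_unique.2
    ⟨⟨fun f g => h0.elim (fun h => h.eq_of_src f g) fun h => h.eq_of_tgt f g⟩, ⟨0⟩⟩
  have : Unique (Ext M N 1) := ⟨⟨0⟩, fun ξ => ext_eq_zero_of_isZero h0 ξ⟩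
  have hS := (Cpx.midSES (default : Ext M N 1)).sc_shortExact
  have := hS.mono_f
  have := hS.epi_g
  have e : Nonempty (Cpx.mid (default : Ext M N 1) ≅ L) := by
    rcases h with ⟨h, ⟨a⟩⟩ | ⟨h, ⟨a⟩⟩
    · have := hS.isIso_f_iff.2 h
      exact ⟨(asIso (Cpx.midSES (default : Ext M N 1)).sc.f).symm ≪≫ a.symm⟩
    · have := hS.isIso_g_iff.2 h
      exact ⟨asIso (Cpx.midSES (default : Ext M N 1)).sc.g ≪≫ a.symm⟩
  obtain ⟨e⟩ := e
  rw [hallProd_eq_sum, Fintype.sum_unique, hhom, Nat.cast_one, inv_one]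
  exact Hall.mk_congr e

end Unit

/-! ### The action on pairs of an object and a class in K₀(A) -/

section Representation

/-- Linear maps on `Dat` agree if they agree on basis vectors. -/
theorem Dat.hom_ext {k : Type u'} {A : Type u} [Category.{v} A] [Abelian A]
    {V : Type*} [AddCommGroup V] [Module (QV k) V] {f g : Dat k A →ₗ[QV k] V}
    (h : ∀ (X : A) (α : K0 A), f (Finsupp.single (Quotient.mk _ X, α) 1) =
      g (Finsupp.single (Quotient.mk _ X, α) 1)) : f = g := by
  refine Finsupp.lhom_ext' fun x => LinearMap.ext_ring ?_
  obtain ⟨X, α⟩ := x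
  obtain ⟨X, rfl⟩ := Quotient.exists_rep X
  exact h X α

variable {k : Type u'} [Field k] {A : Type u} [Category.{v} A] [Abelian A] [Linear k A]
  {ρ : Involution k A} [HasExt.{w} A]

section

variable [FiniteHereditary A] [Finite k]

variable (ρ) in
/-- The action of the Hall algebra on pairs of an object and an element of the Grothendieck
group. -/
def act : Hall ρ →ₗ[QV k] Dat k A →ₗ[QV k] Dat k A :=
  -- For M with data (h, α) the class of res M is h + ϱα + α, so the Euler twist together with the
  -- factor of `tau_hallProd_right` leaves ⟨N, h⟩ + ⟨N, α - ϱα⟩. The formula makes sense for every α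
  -- in K₀(A), effective or not.
  bilin fun L x => vv k ^ eulerK A k (K0.cls L.out.X) (x.2 - K0.rho ρ x.2) •
    shift x.2 (tau ρ (hallMul ρ (Hall.mk L.out) (Hall.mk (Cpx.st ρ x.1.out))))

theorem act_mk (N : Cpx ρ) (h : A) (α : K0 A) :
    act ρ (Hall.mk N) (Finsupp.single (Quotient.mk _ h, α) 1) =
      vv k ^ eulerK A k (K0.cls N.X) (α - K0.rho ρ α) •
        shift α (tau ρ (hallMul ρ (Hall.mk N) (Hall.mk (Cpx.st ρ h)))) := by
  obtain ⟨a⟩ := nonempty_out_iso N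
  obtain ⟨b⟩ := nonempty_out_iso h
  refine (bilin_single (F := QV k) (V := Dat k A) _ (Quotient.mk _ N) (Quotient.mk _ h, α)).trans ?_
  dsimp only
  rw [Hall.mk_congr a, show K0.cls (Quotient.mk _ N).out.X = K0.cls N.X from
    K0.cls_congr ((Cpx.res ρ).mapIso a), show Hall.mk (Cpx.st ρ (Quotient.mk _ h).out) =
      Hall.mk (Cpx.st ρ h) from Hall.mk_congr ((Cpx.stF ρ).mapIso b)]

/-- On vectors in the image of `tau` the action is left multiplication. With `act_shift` this
reduces multiplicativity of the action to associativity of the Hall product. -/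
theorem act_tau_mk (N M : Cpx ρ) : act ρ (Hall.mk N) (tau ρ (Hall.mk M)) =
    tau ρ (hallMul ρ (Hall.mk N) (Hall.mk M)) := by
  rw [tau_mk, Cpx.data, act_mk, hallMul_mk, hallMul_mk, map_smul, map_smul, map_smul,
    tau_hallProd_right N M, smul_smul, smul_smul, ← zpow_add₀ (vv_ne_zero k),
    ← zpow_add₀ (vv_ne_zero k), ← eulerK_cls, ← eulerK_cls, Cpx.cls_X M]
  congr 2
  simp only [map_add, map_sub]
  ring

theorem act_tau (N : Cpx ρ) (x : Hall ρ) : act ρ (Hall.mk N) (tau ρ x) =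
    tau ρ (hallMul ρ (Hall.mk N) x) := by
  refine hall_induction (p := fun x => act ρ (Hall.mk N) (tau ρ x) =
    tau ρ (hallMul ρ (Hall.mk N) x)) ?_ ?_ ?_ x
  · simp only [map_zero]
  · intro x y hx hy
    simp only [map_add, hx, hy]
  · intro c M
    simp only [map_smul, act_tau_mk]

theorem act_shift (N : Cpx ρ) (β : K0 A) (y : Dat k A) : act ρ (Hall.mk N) (shift β y) =
    vv k ^ eulerK A k (K0.cls N.X) (β - K0.rho ρ β) • shift β (act ρ (Hall.mk N) y) := by
  induction y using Finsupp.induction_linear with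
  | zero => simp only [map_zero, smul_zero]
  | add x y hx hy => simp only [map_add, smul_add, hx, hy]
  | single x c =>
    obtain ⟨X, α⟩ := x
    obtain ⟨X, rfl⟩ := Quotient.exists_rep X
    rw [← mul_one c, ← smul_eq_mul, ← Finsupp.smul_single, map_smul, map_smul, map_smul, map_smul,
      smul_comm _ c]
    congr 1
    rw [shift_single, act_mk, act_mk, map_smul, shift_shift, smul_smul,
      ← zpow_add₀ (vv_ne_zero k)]
    congr 2
    simp only [map_add, map_sub]
    ring

theorem act_of_cls {x : Hall ρ} {γ : K0 A} (hx : ∀ L ∈ x.support, K0.cls L.out.X = γ) (h : A)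
    (α : K0 A) : act ρ x (Finsupp.single (Quotient.mk _ h, α) 1) =
      vv k ^ eulerK A k γ (α - K0.rho ρ α) •
        shift α (tau ρ (hallMul ρ x (Hall.mk (Cpx.st ρ h)))) := by
  conv => enter [1, 1]; rw [hall_eq_sum x]
  conv => enter [2, 2, 2, 2, 1]; rw [hall_eq_sum x]
  rw [LinearMap.map_sum₂, LinearMap.map_sum₂, map_sum, map_sum, Finset.smul_sum]
  refine Finset.sum_congr rfl fun L hL => ?_
  rw [LinearMap.map_smul₂, LinearMap.map_smul₂, act_mk, hx L hL, map_smul, map_smul, smul_comm]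

theorem act_mul_mk (X Y : Cpx ρ) : act ρ (hallMul ρ (Hall.mk X) (Hall.mk Y)) =
    act ρ (Hall.mk X) ∘ₗ act ρ (Hall.mk Y) := by
  refine Dat.hom_ext fun h α => ?_
  rw [LinearMap.comp_apply, act_mk Y, map_smul, act_shift, act_tau, ← hallMul_assoc, smul_smul,
    ← zpow_add₀ (vv_ne_zero k), act_of_cls (γ := K0.cls X.X + K0.cls Y.X), map_add,
    AddMonoidHom.add_apply, add_comm]
  intro L hL
  rw [hallMul_mk] at hL
  exact cls_out_of_mem_support (Finsupp.support_smul hL)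

theorem act_mul (x y : Hall ρ) : act ρ (hallMul ρ x y) =
    (show Module.End (QV k) (Dat k A) from act ρ x) * act ρ y :=
  map_mul_of_single (E := Module.End (QV k) (Dat k A)) (act ρ) (fun L L' => by
    rw [← Hall.mk_out, ← Hall.mk_out]
    exact act_mul_mk L.out L'.out) x y

/-- Here N enters only through its homology, its image class and the class of its object, which
these determine; hence the ideal acts by zero. -/
theorem act_mk_eq (N : Cpx ρ) (h : A) (α : K0 A) :
    act ρ (Hall.mk N) (Finsupp.single (Quotient.mk _ h, α) 1) =
      vv k ^ (eulerK A k (K0.cls N.X) (α - K0.rho ρ α + K0.cls h)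
        - 2 * eulerK A k N.imCls (K0.cls h)) •
        shift (N.imCls + α) (tau ρ (hallProd (Cpx.st ρ N.homology) (Cpx.st ρ h))) := by
  rw [act_mk, hallMul_mk, map_smul, map_smul, tau_hallProd_left, map_smul, shift_shift, smul_smul,
    smul_smul, ← zpow_add₀ (vv_ne_zero k), ← zpow_add₀ (vv_ne_zero k), ← eulerK_cls]
  congr 2
  rw [map_add]
  ring

theorem act_congr {M N : Cpx ρ} (e : Nonempty (M.homology ≅ N.homology))
    (h : M.imCls = N.imCls) : act ρ (Hall.mk M) = act ρ (Hall.mk N) := by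
  obtain ⟨e⟩ := e
  refine Dat.hom_ext fun X α => ?_
  rw [act_mk_eq, act_mk_eq, h, Cpx.cls_X M, Cpx.cls_X N, h, K0.cls_congr e,
    hallProd_congr ((Cpx.stF ρ).mapIso e) (Iso.refl _)]

theorem act_of_isAcyclic {K : Cpx ρ} (hK : K.IsAcyclic) (h : A) (α : K0 A) :
    act ρ (Hall.mk K) (Finsupp.single (Quotient.mk _ h, α) 1) =
      Finsupp.single (Quotient.mk _ h, α + K.imCls) (vv k ^ (eulerK A k (K0.cls K.X)
        (α - K0.rho ρ α + K0.cls h) - 2 * eulerK A k K.imCls (K0.cls h))) := by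
  rw [act_mk_eq, hallProd_of_isZero (L := Cpx.st ρ h) (Or.inl ⟨hK.isZero_st, ⟨Iso.refl _⟩⟩),
    tau_mk, shift_single, Finsupp.smul_single, smul_eq_mul, mul_one, Cpx.data_st, zero_add,
    add_comm α]

/-- An acyclic complex translates the second coordinate and rescales by powers of `vv`. -/
theorem isUnit_act {K : Cpx ρ} (hK : K.IsAcyclic) :
    IsUnit (M := Module.End (QV k) (Dat k A)) (act ρ (Hall.mk K)) := by
  refine bijective_of_single _ ((Equiv.refl _).prodCongr (Equiv.addRight K.imCls))
    (fun x => vv k ^ (eulerK A k (K0.cls K.X)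
        (x.2 - K0.rho ρ x.2 + K0.cls x.1.out) - 2 * eulerK A k K.imCls (K0.cls x.1.out)))
    (fun x => zpow_ne_zero _ (vv_ne_zero k)) fun x => ?_
  obtain ⟨X, α⟩ := x
  have h := act_of_isAcyclic hK X.out α
  rw [Quotient.out_eq] at h
  exact h

theorem act_one : act ρ (Hall.mk (Cpx.stalk ρ 0)) = LinearMap.id := by
  refine Dat.hom_ext fun X α => ?_
  have h0 : K0.cls (Cpx.stalk ρ 0).X = (0 : K0 A) := K0.cls_eq_zero (isZero_zero A)
  have hac : (Cpx.stalk ρ 0).IsAcyclic := (isZero_zero A).of_iso (Cpx.homologyStalk 0)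
  rw [act_of_isAcyclic hac, h0, Cpx.imCls_stalk]
  simp

theorem act_st_zero (M : A) (α : K0 A) : ∃ c : QV k, c ≠ 0 ∧
    act ρ (Hall.mk (Cpx.st ρ M)) (Finsupp.single (Quotient.mk _ (0 : A), α) 1) =
      Finsupp.single (Quotient.mk _ M, α) c := by
  refine ⟨vv k ^ (eulerK A k (K0.cls M) (α - K0.rho ρ α) + euler k M 0),
    zpow_ne_zero _ (vv_ne_zero k), ?_⟩
  rw [act_mk, hallMul_mk, hallProd_of_isZero (L := Cpx.st ρ M)
    (Or.inr ⟨Cpx.isZero_of_isZero_X (isZero_zero A), ⟨Iso.refl _⟩⟩), map_smul, map_smul, tau_mk,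
    shift_single, smul_smul, ← zpow_add₀ (vv_ne_zero k), Finsupp.smul_single, smul_eq_mul, mul_one,
    Cpx.data_st, zero_add]

variable (ρ) in
/-- The representation of the `ı`Hall algebra induced by `act`. -/
theorem exists_representation : ∃ Φ : IHallAlg ρ →ₐ[QV k] Module.End (QV k) (Dat k A),
    ∀ N : Cpx ρ, Φ (IHallAlg.mk N) = act ρ (Hall.mk N) := by
  obtain ⟨Φ, hΦ⟩ := Loc.exists_lift_quotient (μ := hallMul ρ) (G := idealGens ρ)
    (e := Hall.mk (Cpx.stalk ρ 0)) (S := acyclicSet ρ) (E := Module.End (QV k) (Dat k A)) (act ρ)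
    act_mul (by
      rintro _ ⟨M, N, e, h, rfl⟩
      rw [map_sub, act_congr e h, sub_self]) act_one (by
      rintro _ ⟨a, K, ha, hK, rfl⟩
      exact ⟨a, _, ha, isUnit_act hK, rfl⟩)
  exact ⟨Φ, fun N => hΦ _⟩

end

end Representation

end IHall

namespace IHall

/-! ### The basis and the quantum torus -/

section Generalities

variable {F : Type*} [Field F] {E : Type*} [Ring E] [Algebra F E]

theorem linearIndependent_of_map_eq_single {I : Type*} (f : E →ₗ[F] (I →₀ F)) {b : I → E}
    {c : I → F} (hc : ∀ i, c i ≠ 0) (h : ∀ i, f (b i) = Finsupp.single i (c i)) :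
    LinearIndependent F b := by
  refine LinearIndependent.of_comp f ?_
  rw [show f ∘ b = fun i => Finsupp.single i (c i) from funext h]
  exact Finsupp.linearIndependent_single_of_ne_zero hc

theorem mul_eq_smul_of_inverse {x y z : E} {c : F} (hxz : x * z = 1) (hzx : z * x = 1)
    (h : y * x = c • (x * y)) : z * y = c • (y * z) := by
  calc z * y = z * (y * x) * z := by rw [mul_assoc, mul_assoc, hxz, mul_one]
    _ = c • (y * z) := by
      rw [h, mul_smul_comm, ← mul_assoc, hzx, one_mul, smul_mul_assoc]

theorem inverse_smul {x z : E} {a : F} (ha : a ≠ 0) (hxz : x * z = 1) (hzx : z * x = 1) :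
    Ring.inverse (a • x) = a⁻¹ • z :=
  Ring.inverse_unit (⟨a • x, a⁻¹ • z, by
    rw [smul_mul_smul_comm, mul_inv_cancel₀ ha, one_smul, hxz], by
    rw [smul_mul_smul_comm, inv_mul_cancel₀ ha, one_smul, hzx]⟩ : Eˣ)

theorem exists_comp_lmapDomain {I J V : Type*} [AddCommGroup V] [Module F V] (σ : I → J)
    (f : (I →₀ F) →ₗ[F] V)
    (h : ∀ i j, σ i = σ j → f (Finsupp.single i 1) = f (Finsupp.single j 1)) :
    ∃ g : (J →₀ F) →ₗ[F] V, ∀ x, g (Finsupp.lmapDomain F F σ x) = f x := by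
  classical
  let b (j : J) : V := if h : ∃ i, σ i = j then f (Finsupp.single h.choose 1) else 0
  refine ⟨Finsupp.linearCombination F b, LinearMap.congr_fun (f := Finsupp.linearCombination F b ∘ₗ
    Finsupp.lmapDomain F F σ) (Finsupp.lhom_ext' fun i => LinearMap.ext_ring ?_)⟩
  have hi : ∃ i', σ i' = σ i := ⟨i, rfl⟩
  simp [b, h _ _ hi.choose_spec]

theorem map_single_eq {I J : Type*} {T : (I →₀ F) →ₗ[F] (J →₀ F)} {i : I} {j : J} {b : F}
    (h : T (Finsupp.single i 1) = Finsupp.single j b) (a : F) :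
    T (Finsupp.single i a) = Finsupp.single j (a * b) := by
  rw [← mul_one a, ← smul_eq_mul, ← Finsupp.smul_single, map_smul, h, Finsupp.smul_single,
    smul_eq_mul, smul_eq_mul, mul_one]

theorem map_single_of_map_single {I J : Type*} {T : (I →₀ F) →ₗ[F] (J →₀ F)} {i : I} {j : J}
    {a b : F} (ha : a ≠ 0) (hb : b ≠ 0) (h : T (Finsupp.single i a) = Finsupp.single j b) :
    ∃ c : F, c ≠ 0 ∧ T (Finsupp.single i 1) = Finsupp.single j c := by
  refine ⟨a⁻¹ * b, mul_ne_zero (inv_ne_zero ha) hb, ?_⟩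
  rw [← inv_mul_cancel₀ ha, ← smul_eq_mul, ← Finsupp.smul_single, map_smul, h,
    Finsupp.smul_single, smul_eq_mul]

/-- A linearly independent family closed under products spans a group algebra. -/
theorem exists_equiv_adjoin {G : Type*} [AddCommGroup G] {κ : G → E} (h0 : κ 0 = 1)
    (hadd : ∀ a b, κ (a + b) = κ a * κ b) (hli : LinearIndependent F κ) :
    ∃ φ : AddMonoidAlgebra F G ≃ₐ[F] Algebra.adjoin F (Set.range κ),
      ∀ a, (φ (AddMonoidAlgebra.single a 1) : E) = κ a := by
  let g : Multiplicative G →* E :=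
    { toFun := fun a => κ a.toAdd
      map_one' := h0
      map_mul' := fun a b => hadd _ _ }
  let f : AddMonoidAlgebra F G →ₐ[F] E := AddMonoidAlgebra.lift F E G g
  have hf (a : G) : f (AddMonoidAlgebra.single a 1) = κ a := by
    simp [f, g]
  have hf' (x : AddMonoidAlgebra F G) : f x = Finsupp.linearCombination F κ x.coeff :=
    AddMonoidAlgebra.lift_apply g x
  have hinj : Function.Injective f := by
    intro x y hxy
    rw [hf', hf'] at hxy
    exact AddMonoidAlgebra.coeff_injective (hli hxy)
  have hrange : f.range = Algebra.adjoin F (Set.range κ) := by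
    refine le_antisymm ?_ (Algebra.adjoin_le ?_)
    · rintro _ ⟨x, rfl⟩
      change f x ∈ _
      rw [hf', Finsupp.linearCombination_apply]
      exact Subalgebra.sum_mem _ fun a _ => Subalgebra.smul_mem _
        (Algebra.subset_adjoin (Set.mem_range_self a)) _
    · rintro _ ⟨a, rfl⟩
      exact ⟨_, hf a⟩
  refine ⟨(AlgEquiv.ofInjective f hinj).trans (Subalgebra.equivOfEq _ _ hrange), fun a => ?_⟩
  exact hf a

end Generalities

/-! ### Products with acyclic classes in the `ı`Hall algebra -/

section IHallAlg

variable {k : Type u'} [Field k] {A : Type u} [Category.{v} A] [Abelian A] [Linear k A]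
  {ρ : Involution k A}

theorem Cpx.IsAcyclic.cls_X {K : Cpx ρ} (hK : K.IsAcyclic) :
    K0.cls K.X = K0.rho ρ K.imCls + K.imCls := by
  rw [Cpx.cls_X K, K0.cls_eq_zero hK, zero_add]

theorem Cpx.IsAcyclic.data_eq {K L : Cpx ρ} (hK : K.IsAcyclic) (hL : L.IsAcyclic)
    {d : IsoCl A × K0 A} (hd : d = (L.data.1, K.imCls)) : K.data = d := by
  rw [hd]
  exact Prod.ext (Quotient.sound (s := isIsomorphicSetoid A) ⟨hK.iso hL⟩) rfl

variable [HasExt.{w} A]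

variable (ρ) in
/-- The canonical map from the Hall algebra to the `ı`Hall algebra. -/
def iota : Hall ρ →ₗ[QV k] IHallAlg ρ :=
  Loc.ofₗ _ _ _ ∘ₗ (idealSpan (hallMul ρ) (idealGens ρ)).mkQ

theorem iota_mk (M : Cpx ρ) : iota ρ (Hall.mk M) = IHallAlg.mk M := rfl

theorem iota_mul (x y : Hall ρ) : iota ρ (hallMul ρ x y) = iota ρ x * iota ρ y :=
  Loc.of_mul (μ := quotMul (hallMul ρ) (idealGens ρ)) (Submodule.Quotient.mk x)
    (Submodule.Quotient.mk y)

namespace IHallAlg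

theorem mk_stalk_zero : (mk (Cpx.stalk ρ 0) : IHallAlg ρ) = 1 := Loc.of_one

theorem mk_congr {M N : Cpx ρ} (h : M.data = N.data) : (mk M : IHallAlg ρ) = mk N := by
  refine congrArg (Loc.of _ _ _) ((Submodule.Quotient.eq _).2 (subset_idealSpan _ _ ?_))
  exact ⟨M, N, Quotient.exact (s := isIsomorphicSetoid A) (congrArg Prod.fst h),
    congrArg Prod.snd h, rfl⟩

theorem isUnit_mk {K : Cpx ρ} (hK : K.IsAcyclic) : IsUnit (mk K : IHallAlg ρ) :=
  Loc.isUnit_of ⟨1, K, one_ne_zero, hK, (one_smul _ _).symm⟩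

end IHallAlg

variable (ρ) in
-- Complexes with equal data differ by a generator of the ideal. Hence every identity proved after
-- `tau` holds in the `ı`Hall algebra.
theorem exists_comp_tau_eq_iota :
    ∃ g : Dat k A →ₗ[QV k] IHallAlg ρ, ∀ x, g (tau ρ x) = iota ρ x := by
  refine exists_comp_lmapDomain _ (iota ρ) fun L L' h => ?_
  obtain ⟨M, rfl⟩ := Quotient.exists_rep L
  obtain ⟨N, rfl⟩ := Quotient.exists_rep L'
  exact IHallAlg.mk_congr h

theorem iota_eq_of_tau_eq {x y : Hall ρ} (h : tau ρ x = tau ρ y) : iota ρ x = iota ρ y := by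
  obtain ⟨g, hg⟩ := exists_comp_tau_eq_iota ρ
  rw [← hg, ← hg, h]

variable [FiniteHereditary A] [Finite k]

namespace IHallAlg

/-- With κ the image class of K, the exponent is ⟨N, ϱκ + κ⟩ from the twist minus 2⟨N, ϱκ⟩ from the
count. Any L with the data of N ⊕ K may stand on the right. -/
theorem mk_mul_mk {N K L : Cpx ρ} (hK : K.IsAcyclic)
    (hL : L.data = (N.data.1, N.data.2 + K.imCls)) : (mk N * mk K : IHallAlg ρ) =
      vv k ^ eulerK A k (K0.cls N.X) (K.imCls - K0.rho ρ K.imCls) • mk L := by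
  rw [← iota_mk, ← iota_mk, ← iota_mk, ← iota_mul, ← map_smul, hallMul_mk]
  refine iota_eq_of_tau_eq ?_
  rw [map_smul, map_smul, tau_hallProd_right, hallProd_of_isZero (L := N)
    (Or.inr ⟨hK.isZero_st, ⟨Iso.refl _⟩⟩), tau_mk, tau_mk, shift_single, ← hL, smul_smul,
    ← zpow_add₀ (vv_ne_zero k), ← eulerK_cls, hK.cls_X]
  congr 2
  simp only [map_add, map_sub]
  ring

theorem mk_mul_mk' {N K L : Cpx ρ} (hK : K.IsAcyclic)
    (hL : L.data = (N.data.1, N.data.2 + K.imCls)) : (mk K * mk N : IHallAlg ρ) =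
      vv k ^ eulerK A k (K0.rho ρ K.imCls - K.imCls) (K0.cls N.X) • mk L := by
  rw [← iota_mk, ← iota_mk, ← iota_mk, ← iota_mul, ← map_smul, hallMul_mk]
  refine iota_eq_of_tau_eq ?_
  rw [map_smul, map_smul, tau_hallProd_left, hallProd_of_isZero (L := N)
    (Or.inl ⟨hK.isZero_st, ⟨Iso.refl _⟩⟩), tau_mk, tau_mk, shift_single, ← hL, smul_smul,
    ← zpow_add₀ (vv_ne_zero k), ← eulerK_cls, hK.cls_X]
  congr 2
  simp only [map_add, map_sub, AddMonoidHom.add_apply, AddMonoidHom.sub_apply]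
  ring

/-- The scalar disappears because ⟨ϱκ + κ, κ' - ϱκ'⟩ = 0 when ϱ is self-adjoint and of order two. -/
theorem mk_mul_mk_of_isAcyclic {K K' L : Cpx ρ} (hK : K.IsAcyclic) (hK' : K'.IsAcyclic)
    (hL : L.IsAcyclic) (h : L.imCls = K.imCls + K'.imCls) : (mk K * mk K' : IHallAlg ρ) = mk L := by
  rw [mk_mul_mk hK' (hL.data_eq hK (by rw [h]; rfl)), hK.cls_X]
  have : eulerK A k (K0.rho ρ K.imCls + K.imCls) (K'.imCls - K0.rho ρ K'.imCls) = 0 := by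
    simp only [map_add, map_sub, AddMonoidHom.add_apply, eulerK_rho_left, K0.rho_rho]
    ring
  rw [this, zpow_zero, one_smul]

/-- The class of an acyclic complex commutes with all classes up to a scalar. -/
theorem mk_mul_mk_comm (N : Cpx ρ) {K : Cpx ρ} (hK : K.IsAcyclic) :
    ∃ c : QV k, (mk N * mk K : IHallAlg ρ) = c • (mk K * mk N) := by
  have h : (N ⊞ K).data = (N.data.1, N.data.2 + K.imCls) :=
    Cpx.data_of_quot (ShortComplex.Splitting.ofHasBinaryBiproduct N K).shortExact hK
  refine ⟨vv k ^ (eulerK A k (K0.cls N.X) (K.imCls - K0.rho ρ K.imCls) -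
    eulerK A k (K0.rho ρ K.imCls - K.imCls) (K0.cls N.X)), ?_⟩
  rw [mk_mul_mk hK h, mk_mul_mk' hK h, smul_smul, ← zpow_add₀ (vv_ne_zero k), sub_add_cancel]

end IHallAlg

end IHallAlg

end IHall

namespace IHall

/-! ### The elements [K_α], spanning and independence -/

section Torus

variable {k : Type u'} [Field k] {A : Type u} [Category.{v} A] [Abelian A] [Linear k A]
  {ρ : Involution k A} [HasExt.{w} A]

open IHallAlg

variable (ρ) in
/-- The elements `[M] * [K_α]`. -/
def basisVec (x : IsoCl A × K0 A) : IHallAlg ρ := mk (Cpx.st ρ x.1.out) * kElt ρ x.2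

theorem basisVec_mk (M : A) (α : K0 A) :
    basisVec ρ (Quotient.mk _ M, α) = mk (Cpx.st ρ M) * kElt ρ α := by
  obtain ⟨e⟩ := nonempty_out_iso M
  rw [basisVec, mk_congr (Cpx.data_congr ((Cpx.stF ρ).mapIso e))]

theorem mul_mem_span_basisVec {y : IHallAlg ρ} (h : ∀ (M : A) (α : K0 A),
    y * (mk (Cpx.st ρ M) * kElt ρ α) ∈ Submodule.span (QV k) (Set.range (basisVec ρ)))
    {w : IHallAlg ρ} (hw : w ∈ Submodule.span (QV k) (Set.range (basisVec ρ))) :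
    y * w ∈ Submodule.span (QV k) (Set.range (basisVec ρ)) := by
  induction hw using Submodule.span_induction with
  | mem x hx =>
    obtain ⟨⟨X, α⟩, rfl⟩ := hx
    exact h X.out α
  | zero => rw [mul_zero]; exact Submodule.zero_mem _
  | add x y _ _ hx hy => rw [mul_add]; exact Submodule.add_mem _ hx hy
  | smul c x _ hx => rw [mul_smul_comm]; exact Submodule.smul_mem _ _ hx

variable [FiniteHereditary A] [Finite k]

theorem IHallAlg.commute_of_isAcyclic {K K' : Cpx ρ} (hK : K.IsAcyclic) (hK' : K'.IsAcyclic) :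
    (mk K * mk K' : IHallAlg ρ) = mk K' * mk K := by
  obtain ⟨L, hL, h⟩ : ∃ L : Cpx ρ, L.IsAcyclic ∧ L.imCls = K.imCls + K'.imCls :=
    ⟨Cpx.kk ρ (Limits.image K.d ⊞ Limits.image K'.d), Cpx.kk_isAcyclic _, by
      rw [Cpx.imCls_kk, K0.cls_biprod]
      rfl⟩
  rw [mk_mul_mk_of_isAcyclic hK hK' hL h,
    mk_mul_mk_of_isAcyclic hK' hK hL (by rw [h, add_comm])]

/-- This characterizes [K_α] by its effect on a single acyclic class, free of the choices in its
definition. Independence of choices and additivity in α follow by cancelling a unit. -/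
theorem kElt_mul_mk {α : K0 A} {K L : Cpx ρ} (hK : K.IsAcyclic) (hL : L.IsAcyclic)
    (h : L.imCls = α + K.imCls) : kElt ρ α * mk K = mk L := by
  set X := (K0.exists_eq_sub α).choose with hX
  set Y := (K0.exists_eq_sub α).choose_spec.choose with hY
  have hα : α = K0.cls X - K0.cls Y := (K0.exists_eq_sub α).choose_spec.choose_spec
  have hu := isUnit_mk (ρ := ρ) (Cpx.kk_isAcyclic Y)
  have e : kElt ρ α = mk (Cpx.kk ρ X) * Ring.inverse (mk (Cpx.kk ρ Y)) := rfl
  have hM : (Cpx.kk ρ (X ⊞ Limits.image K.d)).IsAcyclic := Cpx.kk_isAcyclic _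
  have him : (Cpx.kk ρ (X ⊞ Limits.image K.d)).imCls = K0.cls X + K.imCls := by
    rw [Cpx.imCls_kk, K0.cls_biprod]
    rfl
  -- After multiplication by [K_Y] both sides are the class of an acyclic complex whose image class
  -- is that of X plus that of K.
  rw [← hu.mul_left_inj, mul_assoc, commute_of_isAcyclic hK (Cpx.kk_isAcyclic Y), e, mul_assoc,
    ← mul_assoc (Ring.inverse _), Ring.inverse_mul_cancel _ hu, one_mul,
    mk_mul_mk_of_isAcyclic (Cpx.kk_isAcyclic X) hK hM (by rw [him, Cpx.imCls_kk]),
    mk_mul_mk_of_isAcyclic hL (Cpx.kk_isAcyclic Y) hM (by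
      rw [him, h, Cpx.imCls_kk, hα]
      abel)]

theorem kElt_sub (X Y : A) : kElt ρ (K0.cls X - K0.cls Y) =
    mk (Cpx.kk ρ X) * Ring.inverse (mk (Cpx.kk ρ Y)) := by
  have hu := isUnit_mk (ρ := ρ) (Cpx.kk_isAcyclic Y)
  rw [← hu.mul_left_inj, mul_assoc, Ring.inverse_mul_cancel _ hu, mul_one]
  exact kElt_mul_mk (Cpx.kk_isAcyclic Y) (Cpx.kk_isAcyclic X) (by
    rw [Cpx.imCls_kk, Cpx.imCls_kk, sub_add_cancel])

theorem kElt_zero : kElt ρ 0 = 1 := by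
  have hu := isUnit_mk (ρ := ρ) (Cpx.kk_isAcyclic 0)
  rw [← hu.mul_left_inj, one_mul]
  exact kElt_mul_mk (Cpx.kk_isAcyclic 0) (Cpx.kk_isAcyclic 0) (zero_add _).symm

theorem kElt_add (α β : K0 A) : kElt ρ (α + β) = kElt ρ α * kElt ρ β := by
  obtain ⟨X, Y, hα⟩ := K0.exists_eq_sub α
  obtain ⟨X', Y', hβ⟩ := K0.exists_eq_sub β
  -- Tested on Y ⊕ Y', the successive products have the classes of the objects Y ⊕ X' and X ⊕ X', so
  -- each is realized by an acyclic complex.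
  have hu := isUnit_mk (ρ := ρ) (Cpx.kk_isAcyclic (Y ⊞ Y'))
  rw [← hu.mul_left_inj, mul_assoc,
    kElt_mul_mk (α := β) (Cpx.kk_isAcyclic (Y ⊞ Y')) (Cpx.kk_isAcyclic (Y ⊞ X')) (by
      rw [Cpx.imCls_kk, Cpx.imCls_kk, K0.cls_biprod, K0.cls_biprod, hβ]
      abel),
    kElt_mul_mk (α := α + β) (Cpx.kk_isAcyclic (Y ⊞ Y')) (Cpx.kk_isAcyclic (X ⊞ X')) (by
      rw [Cpx.imCls_kk, Cpx.imCls_kk, K0.cls_biprod, K0.cls_biprod, hα, hβ]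
      abel),
    kElt_mul_mk (Cpx.kk_isAcyclic (Y ⊞ X')) (Cpx.kk_isAcyclic (X ⊞ X')) (by
      rw [Cpx.imCls_kk, Cpx.imCls_kk, K0.cls_biprod, K0.cls_biprod, hα]
      abel)]

theorem kElt_imCls {K : Cpx ρ} (hK : K.IsAcyclic) : kElt ρ K.imCls = mk K := by
  have h0 : (Cpx.stalk ρ 0).IsAcyclic := (isZero_zero A).of_iso (Cpx.homologyStalk 0)
  rw [← kElt_mul_mk (α := K.imCls) h0 hK (by rw [Cpx.imCls_stalk, add_zero]), mk_stalk_zero,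
    mul_one]

/-- N has the same data as the product of the stalk complex of H(N) with the canonical acyclic
complex built on Im d, whose image class is that of Im d. -/
theorem mk_eq_smul (N : Cpx ρ) : ∃ c : QV k,
    (mk N : IHallAlg ρ) = c • (mk (Cpx.st ρ N.homology) * kElt ρ N.imCls) := by
  have hK : (Cpx.kk ρ (Limits.image N.d)).IsAcyclic := Cpx.kk_isAcyclic _
  have him : (Cpx.kk ρ (Limits.image N.d)).imCls = N.imCls := Cpx.imCls_kk _
  have h := mk_mul_mk (N := Cpx.st ρ N.homology) (L := N) hK (by
    rw [Cpx.data_st, him, zero_add]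
    rfl)
  refine ⟨(vv k ^ eulerK A k (K0.cls N.homology) (N.imCls - K0.rho ρ N.imCls))⁻¹, ?_⟩
  rw [← him, kElt_imCls hK, h, him, smul_smul, inv_mul_cancel₀ (zpow_ne_zero _ (vv_ne_zero k)),
    one_smul]

theorem mk_mul_kElt_neg {K : Cpx ρ} (hK : K.IsAcyclic) : mk K * kElt ρ (-K.imCls) = 1 := by
  rw [← kElt_imCls hK, ← kElt_add, add_neg_cancel, kElt_zero]

theorem kElt_neg_mul_mk {K : Cpx ρ} (hK : K.IsAcyclic) : kElt ρ (-K.imCls) * mk K = 1 := by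
  rw [← kElt_imCls hK, ← kElt_add, neg_add_cancel, kElt_zero]

theorem iota_mul_kElt_mem (x : Hall ρ) (α : K0 A) :
    iota ρ x * kElt ρ α ∈ Submodule.span (QV k) (Set.range (basisVec ρ)) := by
  refine hall_induction (p := fun x => iota ρ x * kElt ρ α ∈ Submodule.span (QV k)
    (Set.range (basisVec ρ))) ?_ ?_ ?_ x
  · rw [map_zero, zero_mul]
    exact Submodule.zero_mem _
  · intro x y hx hy
    rw [map_add, add_mul]
    exact Submodule.add_mem _ hx hy
  · intro c N
    obtain ⟨a, ha⟩ := mk_eq_smul N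
    rw [map_smul, iota_mk, ha, smul_mul_assoc, smul_mul_assoc, mul_assoc, ← kElt_add, ← basisVec_mk]
    exact Submodule.smul_mem _ _ (Submodule.smul_mem _ _
      (Submodule.subset_span (Set.mem_range_self _)))

variable (ρ) in
theorem span_basisVec : Submodule.span (QV k) (Set.range (basisVec ρ)) = ⊤ := by
  refine Loc.eq_top_of_mul_mem _ ?_ ?_ ?_
  · have : basisVec ρ (Quotient.mk _ 0, 0) = 1 := by
      rw [basisVec_mk, kElt_zero, mul_one]
      exact mk_stalk_zero
    rw [← this]
    exact Submodule.subset_span (Set.mem_range_self _)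
  · intro x w hw
    refine mul_mem_span_basisVec (fun M α => ?_) hw
    obtain ⟨x, rfl⟩ := Submodule.Quotient.mk_surjective _ x
    have h := iota_mul_kElt_mem (hallMul ρ x (Hall.mk (Cpx.st ρ M))) α
    rw [iota_mul, mul_assoc] at h
    exact h
  · rintro _ ⟨a, K, ha, hK, rfl⟩ w hw
    refine mul_mem_span_basisVec (fun M α => ?_) hw
    have h₁ := mk_mul_kElt_neg hK
    have h₂ := kElt_neg_mul_mk hK
    obtain ⟨c, hc⟩ := mk_mul_mk_comm (Cpx.st ρ M) hK
    have hs : Loc.of (quotMul (hallMul ρ) (idealGens ρ)) (HallQuot.mk (Cpx.stalk ρ 0))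
        (acyclicSet ρ) (a • HallQuot.mk K) = a • mk K := (Loc.ofₗ _ _ _).map_smul a _
    -- The inverse of [K] is [K_{-κ}] with κ the image class of K. It commutes with [M] up to a
    -- scalar and is then absorbed into [K_α].
    rw [hs, inverse_smul ha h₁ h₂, smul_mul_assoc, ← mul_assoc,
      mul_eq_smul_of_inverse h₁ h₂ hc, smul_mul_assoc, mul_assoc, ← kElt_add, ← basisVec_mk]
    exact Submodule.smul_mem _ _ (Submodule.smul_mem _ _
      (Submodule.subset_span (Set.mem_range_self _)))

theorem exists_representation_kElt {Φ : IHallAlg ρ →ₐ[QV k] Module.End (QV k) (Dat k A)}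
    (hΦ : ∀ N : Cpx ρ, Φ (mk N) = act ρ (Hall.mk N)) (α : K0 A) :
    ∃ c : QV k, c ≠ 0 ∧ Φ (kElt ρ α) (Finsupp.single (Quotient.mk _ (0 : A), 0) 1) =
      Finsupp.single (Quotient.mk _ (0 : A), α) c := by
  obtain ⟨X, Y, hα⟩ := K0.exists_eq_sub α
  -- Starting from (0, -[Y]), the class [K_Y] leads to the vector (0, 0) and [K_X] to (0, α), up to
  -- nonzero scalars; [K_α] connects these two.
  have h := congrArg (fun f => Φ f (Finsupp.single (Quotient.mk _ (0 : A), -K0.cls Y) 1))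
    (kElt_mul_mk (ρ := ρ) (α := α) (Cpx.kk_isAcyclic Y) (Cpx.kk_isAcyclic X) (by
      rw [Cpx.imCls_kk, Cpx.imCls_kk, hα, sub_add_cancel]))
  rw [map_mul, hΦ, hΦ, Module.End.mul_apply, act_of_isAcyclic (Cpx.kk_isAcyclic Y),
    act_of_isAcyclic (Cpx.kk_isAcyclic X), Cpx.imCls_kk, Cpx.imCls_kk, neg_add_cancel,
    neg_add_eq_sub, ← hα] at h
  exact map_single_of_map_single (zpow_ne_zero _ (vv_ne_zero k)) (zpow_ne_zero _ (vv_ne_zero k)) h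

variable (ρ) in
-- Evaluating the representation on the vector (0, 0) sends the element indexed by (M, α) to a
-- nonzero multiple of the basis vector (M, α).
theorem linearIndependent_basisVec : LinearIndependent (QV k) (basisVec ρ) := by
  obtain ⟨Φ, hΦ⟩ := exists_representation ρ
  have h (x : IsoCl A × K0 A) : ∃ c : QV k, c ≠ 0 ∧
      Φ (basisVec ρ x) (Finsupp.single (Quotient.mk _ (0 : A), 0) 1) = Finsupp.single x c := by
    obtain ⟨X, α⟩ := x
    obtain ⟨X, rfl⟩ := Quotient.exists_rep X
    obtain ⟨a, ha, ha'⟩ := exists_representation_kElt hΦ α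
    obtain ⟨b, hb, hb'⟩ := act_st_zero (ρ := ρ) X α
    rw [basisVec_mk, map_mul, hΦ, Module.End.mul_apply, ha']
    exact ⟨a * b, mul_ne_zero ha hb, map_single_eq hb' a⟩
  choose c hc hc' using h
  exact linearIndependent_of_map_eq_single
    (LinearMap.applyₗ (Finsupp.single (Quotient.mk _ (0 : A), 0) 1) ∘ₗ Φ.toLinearMap) hc hc'

end Torus

end IHall

end

open IHall in
theorem mainTheorem8 {k : Type u'} [Field k] [Finite k] (hk : ringChar k ≠ 2)
    {A : Type u} [Category.{v} A] [Abelian A] [Linear k A] [HasExt.{w} A]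
    (hHom : ∀ X Y : A, Module.Finite k (X ⟶ Y))
    (hExt : ∀ X Y : A, Module.Finite k (Ext X Y 1))
    (hHered : ∀ X : A, HasProjectiveDimensionLE X 1)
    (ρ : Involution k A) :
    -- the elements `[K_α]` are well defined
    (∀ X Y : A, IsUnit (IHallAlg.mk (Cpx.kk ρ Y)) ∧
      kElt ρ (K0.cls X - K0.cls Y) =
        IHallAlg.mk (Cpx.kk ρ X) * Ring.inverse (IHallAlg.mk (Cpx.kk ρ Y))) ∧
    -- the quantum torus is the group algebra of `K₀(A)`
    (∃ φ : AddMonoidAlgebra (QV k) (K0 A) ≃ₐ[QV k] quantumTorus ρ,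
      ∀ α : K0 A, (φ (AddMonoidAlgebra.single α 1) : IHallAlg ρ) = kElt ρ α) ∧
    -- the elements `[M] * [K_α]` form a basis
    (∃ b : Module.Basis (IsoCl A × K0 A) (QV k) (IHallAlg ρ),
      ∀ (M : A) (α : K0 A),
        b (Quotient.mk _ M, α) = IHallAlg.mk (Cpx.stalk ρ M) * kElt ρ α) := by
  have finA (X Y : A) : Finite (X ⟶ Y) := Module.finite_of_finite k
  have finE (X Y : A) : Finite (Ext X Y 1) := Module.finite_of_finite k
  have : FiniteHereditary A :=
    { finite_hom := finA
      finite_ext := finE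
      ext_two := fun X Y ξ => ξ.eq_zero_of_hasProjectiveDimensionLT 2 le_rfl }
  have hli := linearIndependent_basisVec ρ
  refine ⟨fun X Y => ⟨IHallAlg.isUnit_mk (Cpx.kk_isAcyclic Y), kElt_sub X Y⟩, ?_, ?_⟩
  · refine exists_equiv_adjoin kElt_zero kElt_add ?_
    -- The [K_α] are the members of the basis with M = 0, hence independent.
    have h (α : K0 A) : kElt ρ α = basisVec ρ (Quotient.mk _ 0, α) := by
      rw [basisVec_mk]
      exact (one_mul _).symm.trans (congrArg (· * kElt ρ α) IHallAlg.mk_stalk_zero.symm)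
    rw [show kElt ρ = basisVec ρ ∘ fun α => (Quotient.mk _ 0, α) from funext h]
    exact hli.comp _ fun _ _ hab => congrArg Prod.snd hab
  · refine ⟨Module.Basis.mk hli (span_basisVec ρ).ge, fun M α => ?_⟩
    rw [Module.Basis.mk_apply]
    exact basisVec_mk M α
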